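/- **Setting.** Let $n\ge 8$, $p\in[1,2]$, $\frac1p+\frac1q=1$ (so $q\in[2,\infty]$), and $$\rho_n=\min\{q-1,\,16\ln n-8\}\,n^{\frac2q-1}.$$ Let $\xi$ be a random element with law $P$ and $f(x)=\mathbb E_\xi F(x,\xi)$, $x\in\mathbb R^n$, where for $P$-almost every $\xi$ the function $F(\cdot,\xi)$ is convex and has a gradient $g(\cdot,\xi)$ that is $L(\xi)$-Lipschitz in the Euclidean norm, $0<L_2:=\sqrt{\mathbb E L(\xi)^2}<\infty$, and $\mathbb E_\xi\|g(x,\xi)-\nabla f(x)\|_2^2\le\sigma^2$ for all $x$. Let $x^*$ be a minimizer of $f$. For a point $x$, a Euclidean unit vector $e$ and a sample $\xi$, an oracle returns $$\widetilde f'(x,\xi,e)=\langle g(x,\xi),e\rangle+\zeta(x,\xi,e)+\eta(x,\xi,e),$$ where $\mathbb E_\xi\,\zeta(x,\xi,e)^2\le\Delta_\zeta$ and $|\eta(x,\xi,e)|\le\Delta_\eta$ a.s. in $\xi$, for all $x\in\mathbb R^n$ and all unit vectors $e$. A prox-function for $p$ is a differentiable $d:\mathbb R^n\to\mathbb R$ with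 $d(y)-d(x)-\langle\nabla d(x),y-x\rangle\ge\frac12\|y-x\|_p^2$ for all $x,y$; put $V[z](x)=d(x)-d(z)-\langle\nabla d(z),x-z\rangle$. The standard choices are $d(x)=\frac12\|x\|_2^2$ for $p=2$, and $d(x)=\frac{\mathrm e\,n^{(\kappa-1)(2-\kappa)/\kappa}\ln n}{2}\|x\|_\kappa^2$ with $\kappa=1+\frac1{\ln n}$ for $p=1$. **ARDD method** (starting point $x_0$, $N\ge1$ iterations, batch size $m\ge1$). Set $y_0=z_0=x_0$. For $k=0,\dots,N-1$, put $\alpha_{k+1}=\frac{k+2}{96n^2\rho_nL_2}$, $\tau_k=\frac{2}{k+2}$, $x_{k+1}=\tau_kz_k+(1-\tau_k)y_k$, draw $e_{k+1}$ uniformly on the Euclidean unit sphere and $\xi_{k+1,1},\dots,\xi_{k+1,m}\sim P$, all draws being independent, and set $$G_{k+1}=\frac1m\sum_{i=1}^m\widetilde f'(x_{k+1},\xi_{k+1,i},e_{k+1})\,e_{k+1},\qquad y_{k+1}=x_{k+1}-\frac1{2L_2}G_{k+1},$$ $$z_{k+1}=\operatorname*{arg\,min}_{z\in\mathbb R^n}\bigl\{\alpha_{k+1}n\langle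 G_{k+1},z-z_k\rangle+V[z_k](z)\bigr\}.$$ The output is $y_N$, and the method makes $Nm$ oracle calls. **Theorem.** (i) The standard choices of $d$ for $p=1$ and for $p=2$ are prox-functions. (ii) For every $p\in[1,2]$ and every prox-function $d$ for $p$, with $\Theta_p=V[x_0](x^*)$, the random variable $f(y_N)$ is integrable and $$\mathbb E f(y_N)-f(x^*)\le\frac{384\,\Theta_p n^2\rho_nL_2}{N^2}+\frac{4N}{nL_2}\cdot\frac{\sigma^2}{m}+\frac{61N}{24L_2}\Delta_\zeta+\frac{122N}{3L_2}\Delta_\eta^2+\frac{12\sqrt{2n\Theta_p}}{N^2}\Bigl(\frac{\sqrt{\Delta_\zeta}}2+2\Delta_\eta\Bigr)+\frac{N^2}{12n\rho_nL_2}\Bigl(\frac{\sqrt{\Delta_\zeta}}2+2\Delta_\eta\Bigr)^2.$$ (iii) There is an absolute constant $C>0$ such that the following holds. Let $p\in\{1,2\}$, $R_p>0$ and $0<\varepsilon\le n^{1+\frac2q}L_2R_p^2$. Then there are $N,m\ge1$, depending only on $n,p,L_2,\sigma,R_p,\varepsilon$, with $$Nm\le C(\ln n)^2\max\left\{n^{\frac12+\frac1q}\sqrt{\frac{L_2R_p^2}{\varepsilon}},\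 \frac{n^{\frac2q}\sigma^2R_p^2}{\varepsilon^2}\right\},$$ such that the ARDD method, run with these $N,m$ and with the standard prox-function centred at the starting point, $x\mapsto d(x-x_0)$, satisfies $\mathbb E f(y_N)-f(x^*)\le\varepsilon$ for every problem as above with $\|x^*-x_0\|_p\le R_p$ and with noise levels $$\Delta_\zeta\le\frac1{C(\ln n)^2}\min\left\{n^{1+\frac4q}L_2^2R_p^2,\ \frac{\varepsilon^2}{nR_p^2},\ \frac{\varepsilon^{3/2}}{n^{\frac12+\frac1q}}\sqrt{\frac{L_2}{R_p^2}}\right\},$$ $$\Delta_\eta\le\frac1{C\ln n}\min\left\{n^{\frac12+\frac2q}L_2R_p,\ \frac{\varepsilon}{\sqrt n\,R_p},\ \frac{\varepsilon^{3/4}}{n^{\frac14+\frac1{2q}}}\Bigl(\frac{L_2}{R_p^2}\Bigr)^{1/4}\right\}.$$ -/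

import Mathlib

open MeasureTheory ProbabilityTheory

noncomputable section

namespace ARDD

/-- `ℝⁿ` with its Euclidean norm and inner product. -/
abbrev Vec (n : ℕ) : Type := EuclideanSpace ℝ (Fin n)

/-- The `p`-norm `(∑ |x_i| ^ p) ^ (1 / p)` on `ℝⁿ`, for a real exponent `p ≥ 1`. -/
def pNorm {n : ℕ} (p : ℝ) (x : Vec n) : ℝ := (∑ i, |x i| ^ p) ^ (1 / p)

/-- `1 / q` for the exponent `q ∈ [2, ∞]` conjugate to `p ∈ [1, 2]` (it is `0` for `p = 1`, where
`q = ∞`). -/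
def invConj (p : ℝ) : ℝ := 1 - 1 / p

/-- `ρ_n = min {q - 1, 16 ln n - 8} n ^ (2 / q - 1)`, with `1 / p + 1 / q = 1`. For `p = 1` one has
`q = ∞`, so the minimum is `16 ln n - 8`; for `p > 1`, `q = p / (p - 1)`. -/
def rho (n : ℕ) (p : ℝ) : ℝ :=
  (if p = 1 then 16 * Real.log n - 8 else min (p / (p - 1) - 1) (16 * Real.log n - 8)) *
    (n : ℝ) ^ (2 * invConj p - 1)

/-- A prox-function: differentiable on `ℝⁿ` and `1`-strongly convex with respect to the `p`-norm.
Continuity and convexity follow. The normalisation `min d = 0` is not imposed: adding a constant to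
`d` does not change its Bregman divergence. -/
structure IsProxFunction {n : ℕ} (p : ℝ) (d : Vec n → ℝ) : Prop where
  differentiable : Differentiable ℝ d
  strongly_convex : ∀ x y : Vec n,
    (1 / 2) * pNorm p (y - x) ^ 2 ≤ d y - d x - inner ℝ (gradient d x) (y - x)

/-- The Bregman divergence `V[z](x)` of `d`. -/
def bregman {n : ℕ} (d : Vec n → ℝ) (z x : Vec n) : ℝ :=
  d x - d z - inner ℝ (gradient d z) (x - z)

/-- `κ = 1 + 1 / ln n`. -/
def kappa (n : ℕ) : ℝ := 1 + 1 / Real.log n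

/-- The standard prox-functions: `(e n^{(κ-1)(2-κ)/κ} ln n / 2) ‖x‖_κ²` for `p = 1`, and
`‖x‖₂² / 2` for `p = 2` (used for `p ∈ {1, 2}` only). -/
def stdProx (n : ℕ) (p : ℝ) (x : Vec n) : ℝ :=
  if p = 1 then
    Real.exp 1 * (n : ℝ) ^ ((kappa n - 1) * (2 - kappa n) / kappa n) * Real.log n / 2 *
      pNorm (kappa n) x ^ 2
  else (1 / 2) * ‖x‖ ^ 2

/-- The uniform probability distribution on the Euclidean unit sphere: the normalised surface
measure, as a measure on `ℝⁿ`. -/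
def uniformSphere (n : ℕ) : Measure (Vec n) :=
  (((volume : Measure (Vec n)).toSphere Set.univ)⁻¹ • (volume : Measure (Vec n)).toSphere).map
    Subtype.val

/-- The objective `f(x) = E_ξ F(x, ξ)`. -/
def objective {n : ℕ} {X : Type*} [MeasurableSpace X] (P : Measure X) (F : Vec n → X → ℝ)
    (x : Vec n) : ℝ := ∫ s, F x s ∂P

/-- The assumptions on the stochastic optimisation problem: for almost every `ξ`, `F(·, ξ)` is
convex and has the gradient `g(·, ξ)`, which is `L(ξ)`-Lipschitz in the Euclidean norm;
`L₂ = (E L(ξ)²)^{1/2}` is finite (and positive); and `E ‖g(x, ξ) - ∇f(x)‖₂² ≤ σ²` for all `x`. -/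
structure IsProblem {n : ℕ} {X : Type*} [MeasurableSpace X] (P : Measure X)
    (F : Vec n → X → ℝ) (g : Vec n → X → Vec n) (L : X → ℝ) (L₂ σ : ℝ) : Prop where
  measurable_F : Measurable (Function.uncurry F)
  measurable_g : Measurable (Function.uncurry g)
  integrable_F : ∀ x, Integrable (F x) P
  convex : ∀ᵐ s ∂P, ConvexOn ℝ Set.univ (fun x => F x s)
  grad : ∀ᵐ s ∂P, ∀ x, HasGradientAt (fun y => F y s) (g x s) x
  lipschitz : ∀ᵐ s ∂P, ∀ x y, ‖g x s - g y s‖ ≤ L s * ‖x - y‖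
  memLp_L : MemLp L 2 P
  L₂_eq : L₂ = √(∫ s, L s ^ 2 ∂P)
  L₂_pos : 0 < L₂
  integrable_variance : ∀ x, Integrable (fun s => ‖g x s - gradient (objective P F) x‖ ^ 2) P
  variance_le : ∀ x, ∫ s, ‖g x s - gradient (objective P F) x‖ ^ 2 ∂P ≤ σ ^ 2

/-- The assumptions on the two parts `ζ(x, ξ, e)` and `η(x, ξ, e)` of the oracle noise. -/
structure IsNoise {n : ℕ} {X : Type*} [MeasurableSpace X] (P : Measure X)
    (ζ η : Vec n → X → Vec n → ℝ) (Δζ Δη : ℝ) : Prop where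
  measurable_ζ : Measurable (fun t : Vec n × X × Vec n => ζ t.1 t.2.1 t.2.2)
  measurable_η : Measurable (fun t : Vec n × X × Vec n => η t.1 t.2.1 t.2.2)
  integrable_sq : ∀ x u : Vec n, ‖u‖ = 1 → Integrable (fun s => ζ x s u ^ 2) P
  sq_le : ∀ x u : Vec n, ‖u‖ = 1 → ∫ s, ζ x s u ^ 2 ∂P ≤ Δζ
  abs_le : ∀ x u : Vec n, ‖u‖ = 1 → ∀ᵐ s ∂P, |η x s u| ≤ Δη

/-- The noisy directional derivative `⟨g(x, ξ), e⟩ + ζ(x, ξ, e) + η(x, ξ, e)`. -/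
def oracle {n : ℕ} {X : Type*} (g : Vec n → X → Vec n) (ζ η : Vec n → X → Vec n → ℝ)
    (x : Vec n) (s : X) (u : Vec n) : ℝ := inner ℝ (g x s) u + ζ x s u + η x s u

/-- The mini-batch approximation `(1/m) ∑_i f̃'(x, ξ_i, e) e` of the gradient at `x`. -/
def gradEst {n m : ℕ} {X : Type*} (D : Vec n → X → Vec n → ℝ) (x : Vec n) (s : Fin m → X)
    (u : Vec n) : Vec n := ((1 / (m : ℝ)) * ∑ i, D x (s i) u) • u

/-- The random input of `N` iterations: all the directions `e_k` and all the samples `ξ_{k,i}` are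
independent, each `e_k` is uniform on the unit sphere and each `ξ_{k,i}` has law `P`. (The law of
one iteration's input is a product measure, and the iterations are independent.) -/
structure IsSampling {n N m : ℕ} {X Ω : Type*} [MeasurableSpace X] [MeasurableSpace Ω]
    (P : Measure X) (μ : Measure Ω) (e : Fin N → Ω → Vec n) (ξ : Fin N → Fin m → Ω → X) :
    Prop where
  measurable_e : ∀ k, Measurable (e k)
  measurable_ξ : ∀ k i, Measurable (ξ k i)
  law : ∀ k, μ.map (fun ω => (e k ω, fun i => ξ k i ω)) =
    (uniformSphere n).prod (Measure.pi fun _ : Fin m => P)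
  indep : iIndepFun (fun k ω => (e k ω, fun i => ξ k i ω)) μ

/-- The step size `α_{k+1} = (k + 2) / (96 n² ρ_n L₂)`. -/
def stepSize (n : ℕ) (p L₂ : ℝ) (k : ℕ) : ℝ := ((k : ℝ) + 2) / (96 * (n : ℝ) ^ 2 * rho n p * L₂)

/-- The coupling weight `τ_k = 2 / (k + 2)`. -/
def tau (k : ℕ) : ℝ := 2 / ((k : ℝ) + 2)

/-- `x_k`, `y_k`, `z_k` are produced by `N` iterations of the ARDD method from `x₀` with batch size
`m`, prox-function `d` and directional derivative oracle `D`. Iteration `k ∈ {0, …, N - 1}` uses the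
direction `e_{k+1}` and the samples `ξ_{k+1,i}`, here indexed by `k`. -/
structure IsRun {n N m : ℕ} {X Ω : Type*} (p L₂ : ℝ) (d : Vec n → ℝ) (D : Vec n → X → Vec n → ℝ)
    (x₀ : Vec n) (e : Fin N → Ω → Vec n) (ξ : Fin N → Fin m → Ω → X)
    (x y z : ℕ → Ω → Vec n) : Prop where
  y_zero : ∀ ω, y 0 ω = x₀
  z_zero : ∀ ω, z 0 ω = x₀
  x_succ : ∀ (k : Fin N) ω, x (k + 1) ω = tau k • z k ω + (1 - tau k) • y k ω
  y_succ : ∀ (k : Fin N) ω,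
    y (k + 1) ω = x (k + 1) ω - (1 / (2 * L₂)) • gradEst D (x (k + 1) ω) (ξ k · ω) (e k ω)
  z_succ : ∀ (k : Fin N) ω,
    IsMinOn (fun v => stepSize n p L₂ k * n *
        inner ℝ (gradEst D (x (k + 1) ω) (ξ k · ω) (e k ω)) (v - z k ω) + bregman d (z k ω) v)
      Set.univ (z (k + 1) ω)

end ARDD

end

noncomputable section

namespace ARDD

open scoped Pointwise

/-! ### Symmetries and second moments of the uniform distribution on the sphere. -/

section Sphere

/-! Write `s` for `∇f(x_{k+1})` and `γ` for the batch mean of the oracle values, so that the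
gradient estimate is `γ e`. The method couples a gradient step (`y`) with a mirror step (`z`), and
the proof follows the potential `(k + 1)² β (f(y_k) - f(x*)) + V[z_k](x*)`, where `β = 1 / (192 n²
ρ_n L₂)`. Smoothness of `f` bounds the first step and strong convexity of `d` bounds the second;
each bound has a linear and a quadratic term in `γ`. In expectation, and up to noise, `n ⟨z - x*, e⟩
γ` becomes `⟨s, z - x*⟩`, which by convexity controls the change of the weighted gap
(`coupling_inequality`), while `⟨s, e⟩ γ` becomes `‖s‖² / n`, which pays for the terms in `γ²`. The
value of `β` makes the terms in `‖s‖²` cancel exactly, so that only variance and oracle noise remain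
(`integral_stepUpper_le`).

The mirror step costs `E ‖e‖_q² γ²`, where the norm has to be separated from `γ²`. The dual norm is
therefore replaced by a weight `W`, a multiple of `‖e‖_{2k}²`, which dominates it and is invariant
under permutations and sign changes of the coordinates. For such a weight `E ⟨s, e⟩ ⟨w, e⟩ W(e) =
(⟨s, w⟩ / n) E W` holds with equality (`integral_inner_mul_inner`). The bound `E W ≤ 6 ρ_n`
(`exists_isDualWeight`) follows from `E e_i^{2k} ≤ (3k / n)^k`, which rotation invariance deduces
from Khintchine's inequality.

The bias of the noise leaves a term proportional to `E ‖z_k - x*‖ ≤ √(2 E V[z_k](x*))`. Hence the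
expected potential obeys `R_{k+1} ≤ R_k + a_k √R_k + h_k`, which `le_sq_of_sqrt_recursion` solves;
division by `(N + 1)² β` gives (ii).

Part (i) rests on the 2-uniform convexity of `ℓ_p` with constant `p - 1`
(`two_mul_pNorm_sq_add_le`). For (iii), put `T = n^{1/2 + 1/q} √(L₂ R² / ε)`; taking `N` of order `T
ln n` and `m` of order `1 + N σ² / (n L₂ ε)` makes each of the six terms of the bound at most `ε /
6` (`gap_bound_le`). -/

lemma uniformSphere_apply {n : ℕ} {s : Set (Vec n)} (hs : MeasurableSet s) :
    uniformSphere n s = ((volume : Measure (Vec n)).toSphere Set.univ)⁻¹ *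
      (n * volume (Set.Ioo (0 : ℝ) 1 • (s ∩ Metric.sphere (0 : Vec n) 1))) := by
  rw [uniformSphere, Measure.map_apply measurable_subtype_coe hs, Measure.smul_apply,
    Measure.toSphere_apply' _ (measurable_subtype_coe hs), Subtype.image_preimage_coe,
    smul_eq_mul, finrank_euclideanSpace_fin, Set.inter_comm]

lemma isProbabilityMeasure_uniformSphere {n : ℕ} (hn : n ≠ 0) :
    IsProbabilityMeasure (uniformSphere n) := by
  have : Nontrivial (Vec n) := by
    have : Nonempty (Fin n) := ⟨⟨0, Nat.pos_of_ne_zero hn⟩⟩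
    infer_instance
  have h0 : (volume : Measure (Vec n)).toSphere Set.univ ≠ 0 :=
    Measure.measure_univ_ne_zero.mpr (Measure.toSphere_ne_zero _)
  constructor
  rw [uniformSphere, Measure.map_apply measurable_subtype_coe MeasurableSet.univ,
    Set.preimage_univ, Measure.smul_apply, smul_eq_mul]
  exact ENNReal.inv_mul_cancel h0 (measure_ne_top _ _)

lemma ae_norm_eq_one_uniformSphere (n : ℕ) : ∀ᵐ e ∂uniformSphere n, ‖e‖ = 1 := by
  rw [uniformSphere, ae_map_iff measurable_subtype_coe.aemeasurable
    (measurableSet_eq_fun measurable_norm measurable_const)]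
  exact Filter.Eventually.of_forall fun e => by simp

/-- The surface measure of a set is a multiple of the volume of the cone over it; an isometry
commutes with taking cones and preserves volume. -/
lemma measurePreserving_uniformSphere {n : ℕ} (T : Vec n ≃ₗᵢ[ℝ] Vec n) :
    MeasurePreserving T (uniformSphere n) (uniformSphere n) := by
  refine ⟨T.continuous.measurable, ?_⟩
  ext s hs
  rw [Measure.map_apply T.continuous.measurable hs,
    uniformSphere_apply (T.continuous.measurable hs), uniformSphere_apply hs]
  congr 2
  have hset : Set.Ioo (0 : ℝ) 1 • (T ⁻¹' s ∩ Metric.sphere (0 : Vec n) 1) =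
      T ⁻¹' (Set.Ioo (0 : ℝ) 1 • (s ∩ Metric.sphere (0 : Vec n) 1)) := by
    ext v
    simp only [Set.mem_smul, Set.mem_inter_iff, Set.mem_preimage, mem_sphere_zero_iff_norm]
    constructor
    · rintro ⟨r, hr, w, ⟨hw, hw1⟩, rfl⟩
      exact ⟨r, hr, T w, ⟨hw, by simpa using hw1⟩, by simp⟩
    · rintro ⟨r, hr, w, ⟨hw, hw1⟩, h⟩
      refine ⟨r, hr, T.symm w, ⟨by simpa using hw, by simpa using hw1⟩, ?_⟩
      rw [← map_smul, h, T.symm_apply_apply]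
  rw [hset]
  exact T.measurePreserving.measure_preimage_equiv (f := T.toMeasurableEquiv) _

lemma integral_comp_isometry_uniformSphere {n : ℕ} (T : Vec n ≃ₗᵢ[ℝ] Vec n) (f : Vec n → ℝ) :
    ∫ e, f (T e) ∂uniformSphere n = ∫ e, f e ∂uniformSphere n :=
  (measurePreserving_uniformSphere T).integral_comp T.toMeasurableEquiv.measurableEmbedding f

lemma integrable_uniformSphere {n : ℕ} (hn : n ≠ 0) {f : Vec n → ℝ} (hf : Continuous f) :
    Integrable f (uniformSphere n) := by
  have := isProbabilityMeasure_uniformSphere hn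
  obtain ⟨C, hC⟩ := (isCompact_sphere (0 : Vec n) 1).exists_bound_of_continuousOn hf.continuousOn
  refine Integrable.of_bound hf.aestronglyMeasurable C ?_
  filter_upwards [ae_norm_eq_one_uniformSphere n] with e he
  exact hC e (by simpa using he)

/-- The exchange of two coordinates. -/
def swapIso {n : ℕ} (i j : Fin n) : Vec n ≃ₗᵢ[ℝ] Vec n :=
  LinearIsometryEquiv.piLpCongrLeft 2 ℝ ℝ (Equiv.swap i j)

lemma swapIso_apply {n : ℕ} (i j l : Fin n) (x : Vec n) :
    swapIso i j x l = x (Equiv.swap i j l) := by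
  simp [swapIso, LinearIsometryEquiv.piLpCongrLeft_apply, Equiv.piCongrLeft']

/-- The change of sign of one coordinate. -/
def flipIso {n : ℕ} (i : Fin n) : Vec n ≃ₗᵢ[ℝ] Vec n :=
  LinearIsometryEquiv.piLpCongrRight 2 fun j =>
    if j = i then LinearIsometryEquiv.neg ℝ else LinearIsometryEquiv.refl ℝ ℝ

lemma flipIso_apply {n : ℕ} (i l : Fin n) (x : Vec n) :
    flipIso i x l = if l = i then - x l else x l := by
  simp only [flipIso, LinearIsometryEquiv.piLpCongrRight_apply]
  split_ifs <;> simp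

/-- Invariance under exchanges and sign changes of the coordinates. -/
structure IsHyperoctahedral {n : ℕ} (ψ : Vec n → ℝ) : Prop where
  swap : ∀ i j x, ψ (swapIso i j x) = ψ x
  flip : ∀ i x, ψ (flipIso i x) = ψ x

/-- Flipping the sign of the `i`-th coordinate reverses the integrand. -/
lemma integral_coord_mul_coord {n : ℕ} {ψ : Vec n → ℝ} (hψ : IsHyperoctahedral ψ)
    {i j : Fin n} (hij : i ≠ j) : ∫ e, e i * e j * ψ e ∂uniformSphere n = 0 := by
  have h := integral_comp_isometry_uniformSphere (flipIso i) (fun e => e i * e j * ψ e)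
  have h2 : (fun e : Vec n => flipIso i e i * flipIso i e j * ψ (flipIso i e)) =
      fun e => - (e i * e j * ψ e) := by
    ext e
    rw [hψ.flip, flipIso_apply, flipIso_apply, if_pos rfl, if_neg hij.symm]
    ring
  rw [h2, integral_neg] at h
  linarith

/-- Exchanging coordinates shows that the integral does not depend on `i`, and the `n` integrals add
up to `∫ ψ` since `‖e‖ = 1` almost surely. -/
lemma integral_coord_sq {n : ℕ} (hn : n ≠ 0) {ψ : Vec n → ℝ} (hc : Continuous ψ)
    (hψ : IsHyperoctahedral ψ) (i : Fin n) :
    ∫ e, e i * e i * ψ e ∂uniformSphere n = (∫ e, ψ e ∂uniformSphere n) / n := by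
  have hsame : ∀ j, ∫ e, e j * e j * ψ e ∂uniformSphere n =
      ∫ e, e i * e i * ψ e ∂uniformSphere n := by
    intro j
    rw [← integral_comp_isometry_uniformSphere (swapIso i j) (fun e => e j * e j * ψ e)]
    congr 1
    ext e
    rw [hψ.swap, swapIso_apply, Equiv.swap_apply_right]
  have hsum : ∑ j, ∫ e, e j * e j * ψ e ∂uniformSphere n = ∫ e, ψ e ∂uniformSphere n := by
    rw [← integral_finsetSum]
    · refine integral_congr_ae ?_
      filter_upwards [ae_norm_eq_one_uniformSphere n] with e he
      rw [← Finset.sum_mul]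
      have : ∑ j, e j * e j = 1 := by
        have := EuclideanSpace.real_norm_sq_eq e
        rw [he] at this
        rw [← one_pow 2, this]
        exact Finset.sum_congr rfl fun j _ => (sq _).symm
      rw [this, one_mul]
    · intro j _
      exact integrable_uniformSphere hn (by fun_prop)
  rw [Finset.sum_congr rfl fun j _ => hsame j, Finset.sum_const, Finset.card_univ,
    Fintype.card_fin, nsmul_eq_mul] at hsum
  rw [← hsum]
  field_simp

/-- In the expansion in coordinates only the diagonal survives, with equal weights. Being an
equality, this separates the dual-norm weight from the squared directional derivative without loss.
-/
lemma integral_inner_mul_inner {n : ℕ} (hn : n ≠ 0) {ψ : Vec n → ℝ} (hc : Continuous ψ)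
    (hψ : IsHyperoctahedral ψ) (s w : Vec n) :
    ∫ e, inner ℝ s e * inner ℝ w e * ψ e ∂uniformSphere n =
      inner ℝ s w / n * ∫ e, ψ e ∂uniformSphere n := by
  have h1 : ∀ e : Vec n, inner ℝ s e * inner ℝ w e * ψ e =
      ∑ i, ∑ j, s i * w j * (e i * e j * ψ e) := by
    intro e
    simp only [PiLp.inner_apply, RCLike.inner_apply, conj_trivial]
    rw [Finset.sum_mul_sum, Finset.sum_mul]
    refine Finset.sum_congr rfl fun i _ => ?_
    rw [Finset.sum_mul]
    refine Finset.sum_congr rfl fun j _ => ?_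
    ring
  have hint : ∀ i j, Integrable (fun e : Vec n => s i * w j * (e i * e j * ψ e))
      (uniformSphere n) := fun i j => integrable_uniformSphere hn (by fun_prop)
  simp_rw [h1]
  rw [integral_finsetSum _ fun i _ => integrable_finsetSum _ fun j _ => hint i j]
  have h2 : ∀ i, ∫ e, ∑ j, s i * w j * (e i * e j * ψ e) ∂uniformSphere n =
      s i * w i * ((∫ e, ψ e ∂uniformSphere n) / n) := by
    intro i
    rw [integral_finsetSum _ fun j _ => hint i j]
    simp_rw [integral_const_mul]
    rw [Finset.sum_eq_single i, integral_coord_sq hn hc hψ]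
    · intro j _ hj
      rw [integral_coord_mul_coord hψ hj.symm, mul_zero]
    · simp
  simp_rw [h2]
  rw [← Finset.sum_mul]
  have : inner ℝ s w = ∑ i, s i * w i := by
    simp only [PiLp.inner_apply, RCLike.inner_apply, conj_trivial]
    exact Finset.sum_congr rfl fun i _ => mul_comm _ _
  rw [this]
  ring

lemma isHyperoctahedral_const {n : ℕ} (c : ℝ) : IsHyperoctahedral (fun _ : Vec n => c) :=
  ⟨fun _ _ _ => rfl, fun _ _ => rfl⟩

lemma integral_inner_mul_inner_uniformSphere {n : ℕ} (hn : n ≠ 0) (s w : Vec n) :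
    ∫ e, inner ℝ s e * inner ℝ w e ∂uniformSphere n = inner ℝ s w / n := by
  have := isProbabilityMeasure_uniformSphere hn
  simpa using integral_inner_mul_inner hn continuous_const (isHyperoctahedral_const (n := n) 1) s w

/-- The reflection in the hyperplane orthogonal to `u - v` maps `u` to `v`. -/
lemma integral_inner_pow_eq {n : ℕ} {u v : Vec n} (h : ‖u‖ = ‖v‖) (k : ℕ) :
    ∫ e, (inner ℝ u e) ^ k ∂uniformSphere n = ∫ e, (inner ℝ v e) ^ k ∂uniformSphere n := by
  set T : Vec n ≃ₗᵢ[ℝ] Vec n := (Submodule.span ℝ {u - v})ᗮ.reflection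
  have hT : T u = v := Submodule.reflection_sub h
  rw [← integral_comp_isometry_uniformSphere T (fun e => (inner ℝ v e) ^ k)]
  congr 1
  ext e
  rw [← hT, T.inner_map_map]

end Sphere

/-! ### Khintchine's inequality for even moments. -/

section Khintchine

/-- From `k` to `k + 1` the left side gains the factor `(2k + 2)(2k + 1) e ≤ 24 (k + 1)²`. The right
side gains `6 (k + 1)² (1 + 1/k)^{2k}`, which is at least as large because `(1 + 1/k)^k ≥ 2` by
Bernoulli. -/
lemma factorial_two_mul_le {k : ℕ} (hk : 1 ≤ k) :
    ((2 * k).factorial : ℝ) * Real.exp k ≤ (6 * (k : ℝ) ^ 2) ^ k := by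
  induction k, hk using Nat.le_induction with
  | base =>
    have := Real.exp_one_lt_d9
    norm_num [Nat.factorial]
    linarith
  | succ k hk ih =>
    have hk0 : (0 : ℝ) < k := by exact_mod_cast hk
    have hB : (2 : ℝ) * (k : ℝ) ^ k ≤ ((k : ℝ) + 1) ^ k := by
      have h1 := one_add_mul_le_pow (a := 1 / (k : ℝ)) (by
        have : 0 < 1 / (k : ℝ) := by positivity
        linarith) k
      have h2 : (1 : ℝ) + k * (1 / k) = 2 := by field_simp; norm_num
      rw [h2] at h1
      have h3 : ((k : ℝ) + 1) ^ k = (1 + 1 / (k : ℝ)) ^ k * (k : ℝ) ^ k := by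
        rw [← mul_pow]; congr 1; field_simp
      rw [h3]
      gcongr
    have hfac : ((2 * (k + 1)).factorial : ℝ) =
        (2 * k + 2) * (2 * k + 1) * ((2 * k).factorial : ℝ) := by
      rw [show 2 * (k + 1) = (2 * k + 1) + 1 by ring, Nat.factorial_succ, Nat.factorial_succ]
      push_cast
      ring
    have he : Real.exp ((k + 1 : ℕ) : ℝ) = Real.exp k * Real.exp 1 := by
      push_cast; rw [Real.exp_add]
    have hk2 : 4 * ((k : ℝ) ^ 2) ^ k ≤ (((k : ℝ) + 1) ^ 2) ^ k := by
      rw [← pow_mul, ← pow_mul, mul_comm 2 k, pow_mul, pow_mul]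
      calc 4 * ((k : ℝ) ^ k) ^ 2 = (2 * (k : ℝ) ^ k) ^ 2 := by ring
        _ ≤ _ := by gcongr
    rw [hfac, he]
    calc (2 * (k : ℝ) + 2) * (2 * k + 1) * ((2 * k).factorial : ℝ) * (Real.exp k * Real.exp 1)
        = ((2 * (k : ℝ) + 2) * (2 * k + 1) * Real.exp 1) *
          (((2 * k).factorial : ℝ) * Real.exp k) := by ring
      _ ≤ (24 * ((k : ℝ) + 1) ^ 2) * (6 * (k : ℝ) ^ 2) ^ k := by
          refine mul_le_mul ?_ ih (by positivity) (by positivity)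
          have h1 : (2 * (k : ℝ) + 2) * (2 * k + 1) ≤ 4 * ((k : ℝ) + 1) ^ 2 := by nlinarith
          have h2 : Real.exp 1 ≤ 6 := by linarith [Real.exp_one_lt_d9]
          have h3 := mul_le_mul h1 h2 (Real.exp_pos 1).le (by positivity)
          linarith
      _ = 6 * ((k : ℝ) + 1) ^ 2 * 6 ^ k * (4 * ((k : ℝ) ^ 2) ^ k) := by
          rw [mul_pow]; ring
      _ ≤ 6 * ((k : ℝ) + 1) ^ 2 * 6 ^ k * (((k : ℝ) + 1) ^ 2) ^ k := by gcongr
      _ = (6 * (((k + 1 : ℕ) : ℝ)) ^ 2) ^ (k + 1) := by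
          push_cast; rw [mul_pow 6, pow_succ, pow_succ]; ring

/-- The average of `(∑ ε_i x_i) ^ (2 k)` over all signs, by means of the exponential moment. -/
lemma khintchine_even {n k : ℕ} (hk : 1 ≤ k) (x : Fin n → ℝ) (hx : ∑ i, x i ^ 2 = 1) :
    ∑ ε ∈ Fintype.piFinset (fun _ : Fin n => ({1, -1} : Finset ℝ)), (∑ i, ε i * x i) ^ (2 * k) ≤
      2 ^ n * (3 * (k : ℝ)) ^ k := by
  have hk0 : (0 : ℝ) < k := by exact_mod_cast hk
  set S := Fintype.piFinset (fun _ : Fin n => ({1, -1} : Finset ℝ))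
  -- This `t` minimises `exp (t² / 2) / t^{2k}`, the factor that the exponential moment yields.
  set t : ℝ := √(2 * k) with ht
  have ht2 : t ^ 2 = 2 * k := Real.sq_sqrt (by positivity)
  have hexp : ∑ ε ∈ S, Real.exp (∑ i, ε i * (t * x i)) ≤ 2 ^ n * Real.exp k := by
    have h1 : ∀ ε ∈ S, Real.exp (∑ i, ε i * (t * x i)) = ∏ i, Real.exp (ε i * (t * x i)) :=
      fun ε _ => Real.exp_sum _ _
    rw [Finset.sum_congr rfl h1,
      ← Finset.prod_univ_sum (fun _ : Fin n => ({1, -1} : Finset ℝ))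
        fun i a => Real.exp (a * (t * x i))]
    have h2 : ∀ i, ∑ a ∈ ({1, -1} : Finset ℝ), Real.exp (a * (t * x i)) ≤
        2 * Real.exp ((t * x i) ^ 2 / 2) := by
      intro i
      rw [Finset.sum_pair (by norm_num)]
      have := Real.cosh_le_exp_half_sq (t * x i)
      rw [Real.cosh_eq] at this
      rw [one_mul, neg_one_mul]
      linarith
    calc ∏ i, ∑ a ∈ ({1, -1} : Finset ℝ), Real.exp (a * (t * x i))
        ≤ ∏ i, 2 * Real.exp ((t * x i) ^ 2 / 2) :=
          Finset.prod_le_prod (fun i _ => Finset.sum_nonneg fun _ _ => (Real.exp_pos _).le)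
            fun i _ => h2 i
      _ = 2 ^ n * Real.exp k := by
          rw [Finset.prod_mul_distrib, Finset.prod_const, Finset.card_univ, Fintype.card_fin,
            ← Real.exp_sum, ← Finset.sum_div]
          simp_rw [mul_pow]
          rw [← Finset.mul_sum, hx, ht2]
          congr 2
          ring
  have hneg : ∑ ε ∈ S, Real.exp (-∑ i, ε i * (t * x i)) =
      ∑ ε ∈ S, Real.exp (∑ i, ε i * (t * x i)) := by
    refine Finset.sum_bij' (fun ε _ => -ε) (fun ε _ => -ε) ?_ ?_ ?_ ?_ ?_
    · intro ε hε
      simp only [S, Fintype.mem_piFinset, Finset.mem_insert, Finset.mem_singleton] at hε ⊢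
      intro i
      rcases hε i with h | h <;> simp [h]
    · intro ε hε
      simp only [S, Fintype.mem_piFinset, Finset.mem_insert, Finset.mem_singleton] at hε ⊢
      intro i
      rcases hε i with h | h <;> simp [h]
    · intro ε _; simp
    · intro ε _; simp
    · intro ε _; simp
  -- The term of degree `2k` in the series of `cosh (t a)` is at most the whole sum, all terms being
  -- nonnegative.
  have hpt : ∀ ε : Fin n → ℝ, (2 * (k : ℝ)) ^ k * (∑ i, ε i * x i) ^ (2 * k) ≤
      ((2 * k).factorial : ℝ) * ((Real.exp (∑ i, ε i * (t * x i)) +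
        Real.exp (-∑ i, ε i * (t * x i))) / 2) := by
    intro ε
    set a := ∑ i, ε i * x i
    have ha : ∑ i, ε i * (t * x i) = t * a := by
      rw [Finset.mul_sum]; exact Finset.sum_congr rfl fun i _ => by ring
    rw [ha, ← Real.cosh_eq, ← ht2, ← pow_mul, ← mul_pow]
    have h := (Real.hasSum_cosh (t * a))
    have h2 := h.summable.le_tsum k (fun j _ => by
      rw [pow_mul]; positivity)
    rw [h.tsum_eq, div_le_iff₀ (by positivity)] at h2
    linarith
  have hsum : (2 * (k : ℝ)) ^ k * ∑ ε ∈ S, (∑ i, ε i * x i) ^ (2 * k) ≤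
      ((2 * k).factorial : ℝ) * (2 ^ n * Real.exp k) := by
    rw [Finset.mul_sum]
    refine (Finset.sum_le_sum fun ε _ => hpt ε).trans ?_
    rw [← Finset.mul_sum, ← Finset.sum_div, Finset.sum_add_distrib, hneg, add_self_div_two]
    gcongr
  have h6 : (6 * (k : ℝ) ^ 2) ^ k = (2 * (k : ℝ)) ^ k * (3 * k) ^ k := by
    rw [← mul_pow]; congr 1; ring
  have hle : (2 * (k : ℝ)) ^ k * ∑ ε ∈ S, (∑ i, ε i * x i) ^ (2 * k) ≤
      (2 * (k : ℝ)) ^ k * (2 ^ n * (3 * k) ^ k) := by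
    refine hsum.trans ?_
    have := factorial_two_mul_le hk
    rw [h6] at this
    calc ((2 * k).factorial : ℝ) * (2 ^ n * Real.exp k)
        = 2 ^ n * (((2 * k).factorial : ℝ) * Real.exp k) := by ring
      _ ≤ 2 ^ n * ((2 * (k : ℝ)) ^ k * (3 * k) ^ k) := by gcongr
      _ = _ := by ring
  exact le_of_mul_le_mul_left hle (by positivity)

end Khintchine

/-! ### Moments of the coordinates and of the `ℓ_{2k}` norm on the sphere. -/

section SphereMoments

/-- A sign vector `ε` has length `√n`, so by rotation invariance `⟨ε, e⟩` has the same moments as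
`√n e_i`. After averaging over all `ε` under the integral sign, Khintchine's inequality applies at
each fixed unit vector `e`. -/
lemma integral_coord_pow_le {n k : ℕ} (hn : n ≠ 0) (hk : 1 ≤ k) (i : Fin n) :
    ∫ e, e i ^ (2 * k) ∂uniformSphere n ≤ (3 * (k : ℝ) / n) ^ k := by
  have := isProbabilityMeasure_uniformSphere hn
  have hn0 : (0 : ℝ) < n := by exact_mod_cast Nat.pos_of_ne_zero hn
  set S := Fintype.piFinset (fun _ : Fin n => ({1, -1} : Finset ℝ)) with hS
  have hcard : (S.card : ℝ) = 2 ^ n := by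
    rw [hS, Fintype.card_piFinset]
    simp [Finset.card_pair (show (1 : ℝ) ≠ -1 by norm_num)]
  have hsq : ∀ ε ∈ S, ∀ j, ε j ^ 2 = 1 := by
    intro ε hε j
    simp only [hS, Fintype.mem_piFinset, Finset.mem_insert, Finset.mem_singleton] at hε
    rcases hε j with h | h <;> simp [h]
  have hrot : ∀ ε ∈ S, ∫ e : Vec n, (∑ j, ε j * e j) ^ (2 * k) ∂uniformSphere n =
      (n : ℝ) ^ k * ∫ e, e i ^ (2 * k) ∂uniformSphere n := by
    intro ε hε
    have hnorm : ‖(WithLp.toLp 2 ε : Vec n)‖ = ‖(√n • EuclideanSpace.single i (1 : ℝ) : Vec n)‖ := by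
      rw [EuclideanSpace.norm_eq, norm_smul, PiLp.norm_single, norm_one, mul_one,
        Real.norm_of_nonneg (Real.sqrt_nonneg _)]
      simp [hsq ε hε]
    have h := integral_inner_pow_eq hnorm (2 * k)
    have h1 : ∀ e : Vec n, inner ℝ (WithLp.toLp 2 ε : Vec n) e = ∑ j, ε j * e j := by
      intro e
      simp only [PiLp.inner_apply, RCLike.inner_apply, conj_trivial]
      exact Finset.sum_congr rfl fun j _ => mul_comm _ _
    have h2 : ∀ e : Vec n, inner ℝ (√n • EuclideanSpace.single i (1 : ℝ) : Vec n) e = √n * e i := by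
      intro e
      rw [real_inner_smul_left, EuclideanSpace.inner_single_left]
      simp
    simp_rw [h1, h2, mul_pow] at h
    rw [h, integral_const_mul]
    congr 1
    rw [pow_mul, Real.sq_sqrt hn0.le]
  have hsum : ∑ ε ∈ S, ∫ e : Vec n, (∑ j, ε j * e j) ^ (2 * k) ∂uniformSphere n =
      2 ^ n * ((n : ℝ) ^ k * ∫ e, e i ^ (2 * k) ∂uniformSphere n) := by
    rw [Finset.sum_congr rfl hrot, Finset.sum_const, nsmul_eq_mul, hcard]
  have hint : ∀ ε ∈ S, Integrable (fun e : Vec n => (∑ j, ε j * e j) ^ (2 * k))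
      (uniformSphere n) := fun ε _ => integrable_uniformSphere hn (by fun_prop)
  rw [← integral_finsetSum _ hint] at hsum
  have hle : ∫ e : Vec n, ∑ ε ∈ S, (∑ j, ε j * e j) ^ (2 * k) ∂uniformSphere n ≤
      ∫ _ : Vec n, 2 ^ n * (3 * (k : ℝ)) ^ k ∂uniformSphere n := by
    refine integral_mono_ae (integrable_finsetSum _ hint) (integrable_const _) ?_
    filter_upwards [ae_norm_eq_one_uniformSphere n] with e he
    refine khintchine_even hk (fun j => e j) ?_
    rw [← EuclideanSpace.real_norm_sq_eq, he, one_pow]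
  rw [hsum, integral_const, probReal_univ, one_smul] at hle
  have := le_of_mul_le_mul_left hle (by positivity)
  rw [div_pow, le_div_iff₀ (by positivity)]
  linarith

/-- The square of the `ℓ_{2k}` norm. -/
def evenNormSq {n : ℕ} (k : ℕ) (e : Vec n) : ℝ := (∑ i, e i ^ (2 * k)) ^ (1 / (k : ℝ))

lemma continuous_evenNormSq {n k : ℕ} : Continuous (evenNormSq (n := n) k) := by
  unfold evenNormSq
  exact Continuous.rpow_const (by fun_prop) fun _ => Or.inr (by positivity)

lemma evenNormSq_nonneg {n k : ℕ} (e : Vec n) : 0 ≤ evenNormSq k e :=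
  Real.rpow_nonneg (Finset.sum_nonneg fun i _ => by rw [pow_mul]; positivity) _

lemma isHyperoctahedral_evenNormSq {n k : ℕ} : IsHyperoctahedral (evenNormSq (n := n) k) := by
  constructor
  · intro i j x
    unfold evenNormSq
    simp_rw [swapIso_apply]
    rw [Equiv.sum_comp (Equiv.swap i j) (fun l => x l ^ (2 * k))]
  · intro i x
    unfold evenNormSq
    congr 1
    refine Finset.sum_congr rfl fun l _ => ?_
    rw [flipIso_apply]
    split_ifs
    · rw [pow_mul, neg_sq, ← pow_mul]
    · rfl

/-- Jensen for `t ↦ t^k`: the `k`-th power of the integrand is `∑ e_i^{2k}`, whose mean is at most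
`n (3k / n)^k`. -/
lemma integral_evenNormSq_le {n k : ℕ} (hn : n ≠ 0) (hk : 1 ≤ k) :
    ∫ e, evenNormSq k e ∂uniformSphere n ≤ 3 * k * (n : ℝ) ^ (1 / (k : ℝ) - 1) := by
  have := isProbabilityMeasure_uniformSphere hn
  have hn0 : (0 : ℝ) < n := by exact_mod_cast Nat.pos_of_ne_zero hn
  have hk0 : (0 : ℝ) < k := by exact_mod_cast hk
  have hk1 : (1 : ℝ) ≤ k := by exact_mod_cast hk
  have hpos : ∀ e : Vec n, 0 ≤ ∑ i, e i ^ (2 * k) := fun e =>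
    Finset.sum_nonneg fun i _ => by rw [pow_mul]; positivity
  have hJ := (convexOn_pow k).map_integral_le (μ := uniformSphere n)
    (f := evenNormSq (n := n) k) (by fun_prop) isClosed_Ici
    (Filter.Eventually.of_forall fun e => evenNormSq_nonneg e)
    (integrable_uniformSphere hn continuous_evenNormSq)
    (integrable_uniformSphere hn (by exact (continuous_pow k).comp continuous_evenNormSq))
  have hpow : ∀ e : Vec n, evenNormSq k e ^ k = ∑ i, e i ^ (2 * k) := by
    intro e
    rw [evenNormSq, ← Real.rpow_natCast, ← Real.rpow_mul (hpos e), one_div,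
      inv_mul_cancel₀ hk0.ne', Real.rpow_one]
  simp_rw [hpow] at hJ
  rw [integral_finsetSum _ fun i _ => integrable_uniformSphere hn (by fun_prop)] at hJ
  have hb : (∫ e, evenNormSq k e ∂uniformSphere n) ^ k ≤ n * (3 * (k : ℝ) / n) ^ k := by
    refine hJ.trans ((Finset.sum_le_sum fun i _ => integral_coord_pow_le hn hk i).trans ?_)
    simp
  refine le_of_pow_le_pow_left₀ (n := k) (by omega) (by positivity) (hb.trans (le_of_eq ?_))
  rw [mul_pow _ ((n : ℝ) ^ _), ← Real.rpow_natCast ((n : ℝ) ^ _), ← Real.rpow_mul hn0.le, sub_mul,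
    one_div, inv_mul_cancel₀ hk0.ne', one_mul, Real.rpow_sub hn0, Real.rpow_one,
    Real.rpow_natCast, div_pow]
  ring

end SphereMoments

/-! ### Comparison of `p`-norms and Hölder's inequality. -/

section Norms

lemma pNorm_nonneg {n : ℕ} (p : ℝ) (x : Vec n) : 0 ≤ pNorm p x :=
  Real.rpow_nonneg (Finset.sum_nonneg fun _ _ => Real.rpow_nonneg (abs_nonneg _) _) _

lemma sum_abs_rpow_nonneg {n : ℕ} (p : ℝ) (x : Vec n) : 0 ≤ ∑ i, |x i| ^ p :=
  Finset.sum_nonneg fun _ _ => Real.rpow_nonneg (abs_nonneg _) _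

lemma pNorm_rpow {n : ℕ} {p : ℝ} (hp : 0 < p) (x : Vec n) :
    pNorm p x ^ p = ∑ i, |x i| ^ p := by
  rw [pNorm, ← Real.rpow_mul (sum_abs_rpow_nonneg p x), one_div, inv_mul_cancel₀ hp.ne',
    Real.rpow_one]

lemma abs_le_pNorm {n : ℕ} {p : ℝ} (hp : 0 < p) (x : Vec n) (i : Fin n) : |x i| ≤ pNorm p x := by
  refine (Real.rpow_le_rpow_iff (abs_nonneg _) (pNorm_nonneg p x) hp).mp ?_
  rw [pNorm_rpow hp]
  exact Finset.single_le_sum (f := fun i => |x i| ^ p)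
    (fun _ _ => Real.rpow_nonneg (abs_nonneg _) _) (Finset.mem_univ i)

lemma pNorm_two {n : ℕ} (x : Vec n) : pNorm 2 x = ‖x‖ := by
  rw [pNorm, EuclideanSpace.norm_eq, Real.sqrt_eq_rpow]
  simp

lemma pNorm_anti {n : ℕ} {p r : ℝ} (hp : 0 < p) (hpr : p ≤ r) (x : Vec n) :
    pNorm r x ≤ pNorm p x := by
  have hr : 0 < r := hp.trans_le hpr
  refine (Real.rpow_le_rpow_iff (pNorm_nonneg r x) (pNorm_nonneg p x) hr).mp ?_
  rw [pNorm_rpow hr]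
  have h : ∀ i ∈ Finset.univ, |x i| ^ r ≤ |x i| ^ p * pNorm p x ^ (r - p) := by
    intro i _
    calc |x i| ^ r = |x i| ^ (p + (r - p)) := by ring_nf
      _ = |x i| ^ p * |x i| ^ (r - p) :=
          Real.rpow_add_of_nonneg (abs_nonneg _) hp.le (by linarith)
      _ ≤ _ := by
          gcongr
          exact abs_le_pNorm hp x i
  refine (Finset.sum_le_sum h).trans (le_of_eq ?_)
  rw [← Finset.sum_mul, ← pNorm_rpow hp,
    ← Real.rpow_add_of_nonneg (pNorm_nonneg p x) hp.le (by linarith)]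
  ring_nf

lemma pNorm_le_rpow_mul_pNorm {n : ℕ} {p r : ℝ} (hr : 0 < r) (hrp : r ≤ p) (x : Vec n) :
    pNorm r x ≤ (n : ℝ) ^ (1 / r - 1 / p) * pNorm p x := by
  have hp : 0 < p := hr.trans_le hrp
  refine (Real.rpow_le_rpow_iff (pNorm_nonneg r x)
    (mul_nonneg (by positivity) (pNorm_nonneg p x)) hp).mp ?_
  have h := Real.rpow_sum_le_const_mul_sum_rpow Finset.univ (fun i => |x i| ^ r)
    (p := p / r) ((one_le_div hr).mpr hrp)
  simp_rw [abs_of_nonneg (Real.rpow_nonneg (abs_nonneg (x _)) r)] at h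
  have e1 : ∀ i, (|x i| ^ r) ^ (p / r) = |x i| ^ p := fun i => by
    rw [← Real.rpow_mul (abs_nonneg _), mul_div_cancel₀ _ hr.ne']
  simp_rw [e1] at h
  rw [Finset.card_univ, Fintype.card_fin, ← pNorm_rpow hr, ← pNorm_rpow hp,
    ← Real.rpow_mul (pNorm_nonneg _ _), mul_div_cancel₀ _ hr.ne'] at h
  rw [Real.mul_rpow (by positivity) (pNorm_nonneg _ _), ← Real.rpow_mul (by positivity)]
  refine h.trans (le_of_eq ?_)
  congr 2
  field_simp

lemma norm_le_pNorm {n : ℕ} {p : ℝ} (hp : 0 < p) (hp2 : p ≤ 2) (x : Vec n) : ‖x‖ ≤ pNorm p x := by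
  rw [← pNorm_two]
  exact pNorm_anti hp hp2 x

lemma inner_sq_le_evenNormSq_mul {n k : ℕ} (hk : 1 ≤ k) {r : ℝ}
    (hr : (2 * (k : ℝ)).HolderConjugate r) (e w : Vec n) :
    inner ℝ e w ^ 2 ≤ evenNormSq k e * pNorm r w ^ 2 := by
  have hk0 : (0 : ℝ) < k := by exact_mod_cast hk
  have h := Real.inner_le_Lp_mul_Lq Finset.univ (fun i => |e i|) (fun i => |w i|) hr
  simp_rw [abs_abs] at h
  have h1 : |inner ℝ e w| ≤ ∑ i, |e i| * |w i| := by
    simp only [PiLp.inner_apply, RCLike.inner_apply, conj_trivial]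
    refine (Finset.abs_sum_le_sum_abs _ _).trans (le_of_eq ?_)
    exact Finset.sum_congr rfl fun i _ => by rw [abs_mul, mul_comm]
  have h2 : ∀ i, |e i| ^ (2 * (k : ℝ)) = e i ^ (2 * k) := fun i => by
    rw [show (2 * (k : ℝ)) = ((2 * k : ℕ) : ℝ) by push_cast; ring, Real.rpow_natCast, pow_mul,
      sq_abs, ← pow_mul]
  simp_rw [h2] at h
  have hpos : 0 ≤ ∑ i, e i ^ (2 * k) :=
    Finset.sum_nonneg fun i _ => by rw [pow_mul]; positivity
  have h3 : ((∑ i, e i ^ (2 * k)) ^ (1 / (2 * (k : ℝ)))) ^ 2 = evenNormSq k e := by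
    rw [evenNormSq, ← Real.rpow_natCast, ← Real.rpow_mul hpos]
    congr 1
    push_cast
    field_simp
  rw [← sq_abs, ← h3, ← mul_pow]
  exact pow_le_pow_left₀ (abs_nonneg _) (h1.trans h) 2

end Norms

/-! ### A symmetric weight that dominates the squared dual norm. -/

section DualWeight

lemma two_le_log {n : ℕ} (hn : 8 ≤ n) : 2 ≤ Real.log n := by
  have h8 : Real.log 8 ≤ Real.log n :=
    Real.log_le_log (by norm_num) (by exact_mod_cast hn)
  have : Real.log 8 = 3 * Real.log 2 := by
    rw [show (8 : ℝ) = 2 ^ 3 by norm_num, Real.log_pow]; norm_num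
  linarith [Real.log_two_gt_d9]

lemma two_le_conj {p : ℝ} (hp1 : 1 < p) (hp2 : p ≤ 2) : 2 ≤ p / (p - 1) := by
  rw [le_div_iff₀ (by linarith)]; linarith

lemma rho_pos {n : ℕ} {p : ℝ} (hn : 8 ≤ n) (hp1 : 1 ≤ p) (hp2 : p ≤ 2) : 0 < rho n p := by
  have := two_le_log hn
  have hn0 : (0 : ℝ) < n := by exact_mod_cast (by omega : 0 < n)
  unfold rho
  refine mul_pos ?_ (Real.rpow_pos_of_pos hn0 _)
  split_ifs with h
  · linarith
  · have := two_le_conj (lt_of_le_of_ne hp1 (Ne.symm h)) hp2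
    exact lt_min (by linarith) (by linarith)

/-- A weight which bounds the square of the norm dual to `‖·‖_p`, and has small mean on the
sphere. -/
structure IsDualWeight {n : ℕ} (p : ℝ) (W : Vec n → ℝ) : Prop where
  continuous : Continuous W
  hyperoctahedral : IsHyperoctahedral W
  nonneg : ∀ e, 0 ≤ W e
  inner_sq_le : ∀ e w, inner ℝ e w ^ 2 ≤ W e * pNorm p w ^ 2
  integral_le : ∫ e, W e ∂uniformSphere n ≤ 6 * rho n p

/-- Hölder's inequality bounds `⟨e, w⟩` through the exponent conjugate to `2k`; the factor `K` pays
for the passage from that norm to the `p`-norm. -/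
lemma isDualWeight_of_evenNormSq {n k : ℕ} {p K : ℝ} (hn : n ≠ 0) (hk : 1 ≤ k) (hK : 0 ≤ K)
    (h : ∀ w : Vec n, pNorm (2 * (k : ℝ)).conjExponent w ^ 2 ≤ K * pNorm p w ^ 2)
    (hint : K * (3 * k * (n : ℝ) ^ (1 / (k : ℝ) - 1)) ≤ 6 * rho n p) :
    IsDualWeight (n := n) p fun e => K * evenNormSq k e where
  continuous := continuous_const.mul continuous_evenNormSq
  hyperoctahedral := ⟨fun i j x => by rw [isHyperoctahedral_evenNormSq.swap],
    fun i x => by rw [isHyperoctahedral_evenNormSq.flip]⟩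
  nonneg e := mul_nonneg hK (evenNormSq_nonneg e)
  inner_sq_le e w := by
    have hk1 : (1 : ℝ) ≤ k := by exact_mod_cast hk
    refine (inner_sq_le_evenNormSq_mul hk
      (Real.HolderConjugate.conjExponent (by linarith)) e w).trans ?_
    refine (mul_le_mul_of_nonneg_left (h w) (evenNormSq_nonneg e)).trans (le_of_eq (by ring))
  integral_le := by
    rw [integral_const_mul]
    exact (mul_le_mul_of_nonneg_left (integral_evenNormSq_le hn hk) hK).trans hint

/-- If `q - 1` attains the minimum in `ρ_n`, take the least `k` with `2k ≥ q`: the factor lost in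
comparing norms is exactly compensated by the smaller moment of `‖e‖_{2k}²`. Otherwise take `k = ⌈ln
n⌉`: then `2k ≤ q`, so nothing is lost in comparing norms, and `n^{1/k} ≤ e` keeps the moment of
order `ln n / n`. -/
lemma exists_isDualWeight {n : ℕ} {p : ℝ} (hn : 8 ≤ n) (hp1 : 1 ≤ p) (hp2 : p ≤ 2) :
    ∃ W : Vec n → ℝ, IsDualWeight p W := by
  have hlog := two_le_log hn
  have hn0 : (0 : ℝ) < n := by exact_mod_cast (by omega : 0 < n)
  have hn1 : (1 : ℝ) ≤ n := by exact_mod_cast (by omega : 1 ≤ n)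
  have hn' : n ≠ 0 := by omega
  by_cases hA : p ≠ 1 ∧ p / (p - 1) - 1 ≤ 16 * Real.log n - 8
  · obtain ⟨hp, hq⟩ := hA
    have hp1' : 1 < p := lt_of_le_of_ne hp1 (Ne.symm hp)
    have hp0 : 0 < p - 1 := by linarith
    set q := p / (p - 1) with hqdef
    have hq2 : 2 ≤ q := two_le_conj hp1' hp2
    have hqinv : 1 / q = invConj p := by rw [hqdef, invConj]; field_simp
    obtain ⟨k, hkq, hkq2⟩ : ∃ k : ℕ, q ≤ 2 * k ∧ (k : ℝ) ≤ q / 2 + 1 := by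
      refine ⟨⌈q / 2⌉₊, ?_, (Nat.ceil_lt_add_one (by linarith)).le⟩
      linarith [Nat.le_ceil (q / 2)]
    have hk1 : (1 : ℝ) ≤ k := by linarith
    have hk : 1 ≤ k := by exact_mod_cast hk1
    have hconj := Real.HolderConjugate.conjExponent (p := 2 * (k : ℝ)) (by linarith)
    set r := (2 * (k : ℝ)).conjExponent
    have hr : 1 / r = 1 - 1 / (2 * (k : ℝ)) := by
      have := hconj.inv_add_inv_eq_one
      rw [one_div, one_div]; linarith
    have hp_inv : 1 / p = 1 - 1 / q := by rw [hqinv, invConj]; ring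
    have hrp : r ≤ p := by
      refine le_of_one_div_le_one_div (by linarith) ?_
      rw [hr, hp_inv]
      have := one_div_le_one_div_of_le (by linarith : (0 : ℝ) < q) hkq
      linarith
    refine ⟨_, isDualWeight_of_evenNormSq (K := ((n : ℝ) ^ (1 / r - 1 / p)) ^ 2) hn' hk
      (by positivity) ?_ ?_⟩
    · intro w
      rw [← mul_pow]
      exact pow_le_pow_left₀ (pNorm_nonneg _ _)
        (pNorm_le_rpow_mul_pNorm hconj.symm.pos hrp w) 2
    · have he : ((n : ℝ) ^ (1 / r - 1 / p)) ^ 2 * (3 * k * (n : ℝ) ^ (1 / (k : ℝ) - 1)) =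
          3 * k * (n : ℝ) ^ (2 * invConj p - 1) := by
        rw [← Real.rpow_natCast, ← Real.rpow_mul hn0.le, mul_left_comm, ← Real.rpow_add hn0]
        congr 2
        rw [hr, hp_inv, ← hqinv]
        push_cast
        field_simp
        ring
      rw [he, rho, if_neg hp, min_eq_left hq, ← mul_assoc]
      -- The claim is `3k ≤ 6 (q - 1)`, which follows from `k ≤ q / 2 + 1` and `q ≥ 2`.
      refine mul_le_mul_of_nonneg_right ?_ (by positivity)
      linarith
  · have hrho : rho n p = (16 * Real.log n - 8) * (n : ℝ) ^ (2 * invConj p - 1) := by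
      unfold rho
      split_ifs with h
      · rfl
      · rw [min_eq_right]
        by_contra h2
        exact hA ⟨h, (not_le.mp h2).le⟩
    obtain ⟨k, hk, hk2⟩ : ∃ k : ℕ, Real.log n ≤ k ∧ (k : ℝ) ≤ Real.log n + 1 :=
      ⟨⌈Real.log n⌉₊, Nat.le_ceil _, (Nat.ceil_lt_add_one (by linarith)).le⟩
    have hk1 : (1 : ℝ) ≤ k := by linarith
    have hconj := Real.HolderConjugate.conjExponent (p := 2 * (k : ℝ)) (by linarith)
    refine ⟨_, isDualWeight_of_evenNormSq (K := 1) hn' (by exact_mod_cast hk1) zero_le_one ?_ ?_⟩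
    · set r := (2 * (k : ℝ)).conjExponent
      intro w
      rw [one_mul]
      refine pow_le_pow_left₀ (pNorm_nonneg _ _) (pNorm_anti (by linarith) ?_ w) 2
      by_cases hp : p = 1
      · rw [hp]; exact hconj.symm.lt.le
      · have hp1' : 1 < p := lt_of_le_of_ne hp1 (Ne.symm hp)
        have hq : 16 * Real.log n - 8 < p / (p - 1) - 1 := by
          by_contra h2
          exact hA ⟨hp, not_lt.mp h2⟩
        -- In this case `q > 16 ln n - 7`, which exceeds `2 (ln n + 1) ≥ 2k` because `ln n ≥ 2`.
        have hkq : 2 * (k : ℝ) ≤ p / (p - 1) := by linarith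
        refine le_of_one_div_le_one_div hconj.symm.pos ?_
        have h1 := hconj.inv_add_inv_eq_one
        have h2 := one_div_le_one_div_of_le (by linarith : (0 : ℝ) < 2 * k) hkq
        have h3 : 1 / (p / (p - 1)) = 1 - 1 / p := by
          have : p - 1 ≠ 0 := by linarith
          field_simp
        rw [h3, one_div (2 * (k : ℝ))] at h2
        rw [one_div r]
        linarith
    · rw [hrho, one_mul]
      have h1 : (n : ℝ) ^ (1 / (k : ℝ)) ≤ 3 := by
        rw [Real.rpow_def_of_pos hn0]
        have : Real.log n * (1 / (k : ℝ)) ≤ 1 := by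
          rw [mul_one_div, div_le_one (by linarith)]; exact hk
        linarith [Real.exp_le_exp.mpr this, Real.exp_one_lt_d9]
      have h2 : (n : ℝ) ^ (-1 : ℝ) ≤ (n : ℝ) ^ (2 * invConj p - 1) := by
        refine Real.rpow_le_rpow_of_exponent_le hn1 ?_
        have : 1 / p ≤ 1 := by rw [div_le_one (by linarith)]; exact hp1
        unfold invConj
        linarith
      calc 3 * (k : ℝ) * (n : ℝ) ^ (1 / (k : ℝ) - 1)
          = 3 * k * (n : ℝ) ^ (1 / (k : ℝ)) * (n : ℝ) ^ (-1 : ℝ) := by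
            rw [sub_eq_add_neg, Real.rpow_add hn0]; ring
        _ ≤ 3 * (Real.log n + 1) * 3 * (n : ℝ) ^ (2 * invConj p - 1) := by gcongr
        _ ≤ 6 * (16 * Real.log n - 8) * (n : ℝ) ^ (2 * invConj p - 1) := by
            refine mul_le_mul_of_nonneg_right ?_ (by positivity)
            linarith
        _ = _ := by ring

end DualWeight

/-! ### First-order inequalities for convex and for smooth functions. -/

section Calculus

variable {n : ℕ}

lemma hasDerivAt_comp_line {f : Vec n → ℝ} {v x h : Vec n} {t : ℝ}
    (hf : HasGradientAt f v (x + t • h)) :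
    HasDerivAt (fun t : ℝ => f (x + t • h)) (inner ℝ v h) t := by
  have hl : HasDerivAt (fun t : ℝ => x + t • h) h t := by
    simpa using ((hasDerivAt_id t).smul_const h).const_add x
  have h2 := hf.hasFDerivAt.comp_hasDerivAt t hl
  rw [InnerProductSpace.toDual_apply_apply] at h2
  exact h2

lemma ConvexOn.add_inner_le {f : Vec n → ℝ} (hf : ConvexOn ℝ Set.univ f) {v x : Vec n}
    (hv : HasGradientAt f v x) (y : Vec n) : f x + inner ℝ v (y - x) ≤ f y := by
  have hc : ConvexOn ℝ Set.univ (fun t : ℝ => f (x + t • (y - x))) := by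
    refine ⟨convex_univ, fun a _ b _ r s hr hs hrs => ?_⟩
    have h := hf.2 (Set.mem_univ (x + a • (y - x))) (Set.mem_univ (x + b • (y - x))) hr hs hrs
    refine le_trans (le_of_eq ?_) h
    simp only
    congr 1
    have : x = r • x + s • x := by rw [← add_smul, hrs, one_smul]
    nth_rewrite 1 [this]
    simp only [smul_eq_mul]
    module
  have hd : HasDerivAt (fun t : ℝ => f (x + t • (y - x))) (inner ℝ v (y - x)) 0 :=
    hasDerivAt_comp_line (by simpa using hv)
  have := hc.le_slope_of_hasDerivAt (Set.mem_univ 0) (Set.mem_univ 1) one_pos hd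
  simp [slope] at this
  linarith

/-- The descent lemma. Along the segment the function minus its quadratic model has nonpositive
derivative, by Cauchy–Schwarz and the Lipschitz bound. -/
lemma le_add_inner_add_of_lipschitz {f : Vec n → ℝ} {G : Vec n → Vec n} {K : ℝ}
    (hf : ∀ x, HasGradientAt f (G x) x) (hG : ∀ x y, ‖G x - G y‖ ≤ K * ‖x - y‖)
    (x h : Vec n) : f (x + h) ≤ f x + inner ℝ (G x) h + K / 2 * ‖h‖ ^ 2 := by
  set φ : ℝ → ℝ := fun t => f (x + t • h) - t * inner ℝ (G x) h - K / 2 * t ^ 2 * ‖h‖ ^ 2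
  have hd : ∀ t, HasDerivAt φ (inner ℝ (G (x + t • h)) h - inner ℝ (G x) h -
      K * t * ‖h‖ ^ 2) t := by
    intro t
    have h1 := hasDerivAt_comp_line (hf (x + t • h))
    have h2 := (hasDerivAt_id t).mul_const (inner ℝ (G x) h)
    have h3 := (((hasDerivAt_id t).pow 2).const_mul (K / 2)).mul_const (‖h‖ ^ 2)
    refine ((h1.sub h2).sub h3).congr_deriv ?_
    simp only [id, Nat.cast_ofNat, Nat.add_one_sub_one, pow_one]
    ring
  have hanti : AntitoneOn φ (Set.Icc 0 1) := by
    refine antitoneOn_of_deriv_nonpos (convex_Icc 0 1)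
      (fun t _ => (hd t).continuousAt.continuousWithinAt)
      (fun t _ => (hd t).differentiableAt.differentiableWithinAt) ?_
    intro t ht
    rw [interior_Icc] at ht
    rw [(hd t).deriv, ← inner_sub_left]
    have h1 := real_inner_le_norm (G (x + t • h) - G x) h
    have h2 := hG (x + t • h) x
    rw [add_sub_cancel_left, norm_smul, Real.norm_of_nonneg ht.1.le] at h2
    have h3 := mul_le_mul_of_nonneg_right h2 (norm_nonneg h)
    linarith [sq ‖h‖]
  have := hanti (Set.left_mem_Icc.mpr zero_le_one) (Set.right_mem_Icc.mpr zero_le_one) zero_le_one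
  simp [φ] at this
  linarith

end Calculus

/-! ### The objective is convex and `L₂`-smooth. -/

section Problem

variable {n : ℕ} {X : Type*} [MeasurableSpace X] {P : Measure X}
  {F : Vec n → X → ℝ} {g : Vec n → X → Vec n} {L : X → ℝ} {L₂ σ : ℝ}

lemma IsProblem.measurable_grad (h : IsProblem P F g L L₂ σ) (x : Vec n) : Measurable (g x) :=
  h.measurable_g.comp measurable_prodMk_left

lemma IsProblem.memLp_sub (h : IsProblem P F g L L₂ σ) (x : Vec n) :
    MemLp (fun s => g x s - gradient (objective P F) x) 2 P :=
  (memLp_two_iff_integrable_sq_norm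
    ((h.measurable_grad x).sub_const _).aestronglyMeasurable).mpr (h.integrable_variance x)

variable [IsProbabilityMeasure P]

lemma IsProblem.memLp_g (h : IsProblem P F g L L₂ σ) (x : Vec n) : MemLp (g x) 2 P := by
  have := (h.memLp_sub x).add (memLp_const (gradient (objective P F) x))
  refine this.congr_norm (h.measurable_grad x).aestronglyMeasurable ?_
  exact Filter.Eventually.of_forall fun s => by simp

lemma IsProblem.integrable_g (h : IsProblem P F g L L₂ σ) (x : Vec n) : Integrable (g x) P :=
  (h.memLp_g x).integrable one_le_two

lemma IsProblem.integrable_L (h : IsProblem P F g L L₂ σ) : Integrable L P :=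
  h.memLp_L.integrable one_le_two

/-- Differentiation under the integral sign. On the unit ball around `x` the gradients are dominated
by `‖g(x, ξ)‖ + |L(ξ)|`, which is integrable. -/
lemma IsProblem.hasGradientAt_integral (h : IsProblem P F g L L₂ σ) (x : Vec n) :
    HasGradientAt (objective P F) (∫ s, g x s ∂P) x := by
  have hT : Measurable fun s => InnerProductSpace.toDual ℝ (Vec n) (g x s) :=
    (InnerProductSpace.toDual ℝ (Vec n)).continuous.measurable.comp (h.measurable_grad x)
  have hint : Integrable (fun s => InnerProductSpace.toDual ℝ (Vec n) (g x s)) P :=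
    (h.integrable_g x).norm.mono' hT.aestronglyMeasurable
      (Filter.Eventually.of_forall fun s => by simp)
  have key := hasFDerivAt_integral_of_dominated_of_fderiv_le (𝕜 := ℝ) (μ := P)
    (F := F) (x₀ := x) (s := Metric.ball x 1)
    (F' := fun y s => InnerProductSpace.toDual ℝ (Vec n) (g y s))
    (bound := fun s => ‖g x s‖ + |L s|) (Metric.ball_mem_nhds x one_pos)
    (Filter.Eventually.of_forall fun y => (h.integrable_F y).aestronglyMeasurable)
    (h.integrable_F x) hT.aestronglyMeasurable ?_ ?_ ?_
  · have heq : ∫ s, InnerProductSpace.toDual ℝ (Vec n) (g x s) ∂P =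
        InnerProductSpace.toDual ℝ (Vec n) (∫ s, g x s ∂P) := by
      ext v
      rw [ContinuousLinearMap.integral_apply hint]
      simp only [InnerProductSpace.toDual_apply_apply]
      simp_rw [real_inner_comm v]
      exact integral_inner (h.integrable_g x) v
    rw [heq] at key
    exact key
  · filter_upwards [h.lipschitz] with s hs y hy
    rw [LinearIsometryEquiv.norm_map]
    have h1 := hs y x
    have h2 : ‖y - x‖ ≤ 1 := (mem_ball_iff_norm.mp hy).le
    have h3 : L s * ‖y - x‖ ≤ |L s| := by
      calc L s * ‖y - x‖ ≤ |L s| * ‖y - x‖ := by gcongr; exact le_abs_self _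
        _ ≤ |L s| * 1 := by gcongr
        _ = _ := mul_one _
    have h4 : ‖g y s‖ ≤ ‖g x s‖ + ‖g y s - g x s‖ := by
      simpa using norm_add_le (g x s) (g y s - g x s)
    linarith
  · exact (h.integrable_g x).norm.add h.integrable_L.abs
  · filter_upwards [h.grad] with s hs y _
    exact (hs y).hasFDerivAt

lemma IsProblem.gradient_eq (h : IsProblem P F g L L₂ σ) (x : Vec n) :
    gradient (objective P F) x = ∫ s, g x s ∂P :=
  (h.hasGradientAt_integral x).gradient

lemma IsProblem.hasGradientAt (h : IsProblem P F g L L₂ σ) (x : Vec n) :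
    HasGradientAt (objective P F) (gradient (objective P F) x) x := by
  rw [h.gradient_eq]
  exact h.hasGradientAt_integral x

/-- The mean of `L(ξ)` is the Lipschitz constant that averaging gives for `∇f`; by Jensen it is
dominated by `L₂`. -/
lemma IsProblem.integral_L_le (h : IsProblem P F g L L₂ σ) : ∫ s, L s ∂P ≤ L₂ := by
  have hJ := (convexOn_pow 2 |>.subset (Set.Ici_subset_Ici.mpr le_rfl) (convex_Ici 0)).map_integral_le
    (μ := P) (f := fun s => |L s|) (by fun_prop) isClosed_Ici
    (Filter.Eventually.of_forall fun s => Set.mem_Ici.mpr (abs_nonneg _)) h.integrable_L.abs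
    (by simpa [Function.comp_def, sq_abs] using h.memLp_L.integrable_sq)
  simp only [sq_abs] at hJ
  rw [h.L₂_eq]
  refine Real.le_sqrt_of_sq_le (le_trans ?_ hJ)
  refine sq_le_sq' ?_ ?_
  · have := abs_integral_le_integral_abs (μ := P) (f := L)
    linarith [neg_abs_le (∫ s, L s ∂P)]
  · exact (le_abs_self _).trans abs_integral_le_integral_abs

lemma IsProblem.lipschitz_gradient (h : IsProblem P F g L L₂ σ) (x y : Vec n) :
    ‖gradient (objective P F) x - gradient (objective P F) y‖ ≤ L₂ * ‖x - y‖ := by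
  rw [h.gradient_eq, h.gradient_eq, ← integral_sub (h.integrable_g x) (h.integrable_g y)]
  refine (norm_integral_le_of_norm_le (h.integrable_L.mul_const ‖x - y‖) ?_).trans ?_
  · filter_upwards [h.lipschitz] with s hs using hs x y
  · rw [integral_mul_const]
    exact mul_le_mul_of_nonneg_right h.integral_L_le (norm_nonneg _)

lemma IsProblem.continuous_gradient (h : IsProblem P F g L L₂ σ) :
    Continuous (gradient (objective P F)) := by
  refine (LipschitzWith.of_dist_le_mul (K := ⟨L₂, h.L₂_pos.le⟩) fun x y => ?_).continuous
  rw [dist_eq_norm, dist_eq_norm]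
  exact h.lipschitz_gradient x y

lemma IsProblem.continuous_objective (h : IsProblem P F g L L₂ σ) :
    Continuous (objective P F) :=
  continuous_iff_continuousAt.mpr fun x => (h.hasGradientAt x).hasFDerivAt.continuousAt

lemma IsProblem.add_inner_le (h : IsProblem P F g L L₂ σ) (x y : Vec n) :
    objective P F x + inner ℝ (gradient (objective P F) x) (y - x) ≤ objective P F y := by
  have hc : ConvexOn ℝ Set.univ (objective P F) := by
    refine ⟨convex_univ, fun a _ b _ r s hr hs hrs => ?_⟩
    unfold objective
    rw [smul_eq_mul, smul_eq_mul, ← integral_const_mul, ← integral_const_mul,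
      ← integral_add ((h.integrable_F a).const_mul r) ((h.integrable_F b).const_mul s)]
    refine integral_mono_ae (h.integrable_F _)
      (((h.integrable_F a).const_mul r).add ((h.integrable_F b).const_mul s)) ?_
    filter_upwards [h.convex] with t ht
    exact ht.2 (Set.mem_univ a) (Set.mem_univ b) hr hs hrs
  exact ConvexOn.add_inner_le hc (h.hasGradientAt x) y

lemma IsProblem.descent (h : IsProblem P F g L L₂ σ) (x v : Vec n) :
    objective P F (x + v) ≤
      objective P F x + inner ℝ (gradient (objective P F) x) v + L₂ / 2 * ‖v‖ ^ 2 :=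
  le_add_inner_add_of_lipschitz h.hasGradientAt h.lipschitz_gradient x v

end Problem

/-! ### Moments of a batch mean. -/

section Batch

lemma sq_integral_le {Y : Type*} [MeasurableSpace Y] {π : Measure Y} [IsProbabilityMeasure π]
    {f : Y → ℝ} (hf : MemLp f 2 π) : (∫ y, f y ∂π) ^ 2 ≤ ∫ y, f y ^ 2 ∂π := by
  have h := variance_nonneg f π
  rw [variance_eq_sub hf] at h
  simpa using h

variable {X : Type*} [MeasurableSpace X] {P : Measure X} [IsProbabilityMeasure P] {m : ℕ}

lemma memLp_comp_eval {f : X → ℝ} (hf : MemLp f 2 P) (i : Fin m) :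
    MemLp (fun ξ : Fin m → X => f (ξ i)) 2 (Measure.pi fun _ => P) :=
  hf.comp_measurePreserving (measurePreserving_eval (fun _ => P) i)

lemma integral_comp_eval_const {f : X → ℝ} (hf : AEStronglyMeasurable f P) (i : Fin m) :
    ∫ ξ, f (ξ i) ∂(Measure.pi fun _ : Fin m => P) = ∫ s, f s ∂P :=
  integral_comp_eval (μ := fun _ => P) hf

lemma memLp_batch_mean {f : X → ℝ} (hf : MemLp f 2 P) :
    MemLp (fun ξ : Fin m → X => (1 / (m : ℝ)) * ∑ i, f (ξ i)) 2 (Measure.pi fun _ => P) :=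
  (memLp_finsetSum _ fun i _ => memLp_comp_eval hf i).const_mul _

lemma integral_batch_mean (hm : 1 ≤ m) {f : X → ℝ} (hf : MemLp f 2 P) :
    ∫ ξ : Fin m → X, (1 / (m : ℝ)) * ∑ i, f (ξ i) ∂(Measure.pi fun _ => P) = ∫ s, f s ∂P := by
  have hm0 : (m : ℝ) ≠ 0 := by positivity
  rw [integral_const_mul, integral_finsetSum _ fun i _ =>
    (memLp_comp_eval hf i).integrable one_le_two]
  simp_rw [integral_comp_eval_const hf.aestronglyMeasurable]
  simp [hm0]

lemma integral_batch_mean_sq_of_integral_eq_zero (hm : 1 ≤ m) {f : X → ℝ} (hf : MemLp f 2 P)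
    (h0 : ∫ s, f s ∂P = 0) :
    ∫ ξ : Fin m → X, ((1 / (m : ℝ)) * ∑ i, f (ξ i)) ^ 2 ∂(Measure.pi fun _ => P) =
      1 / m * ∫ s, f s ^ 2 ∂P := by
  have hm0 : (m : ℝ) ≠ 0 := by positivity
  have h := variance_sum_pi (μ := fun _ : Fin m => P) (X := fun _ => f) fun _ => hf
  have hz : ∫ ξ : Fin m → X, (∑ i, fun ω : Fin m → X => f (ω i)) ξ ∂(Measure.pi fun _ => P) = 0 := by
    simp_rw [Finset.sum_apply]
    rw [integral_finsetSum _ fun i _ => (memLp_comp_eval hf i).integrable one_le_two]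
    simp_rw [integral_comp_eval_const hf.aestronglyMeasurable, h0]
    simp
  rw [variance_of_integral_eq_zero (memLp_finsetSum' _ fun i _ => memLp_comp_eval hf i).aemeasurable
    hz] at h
  simp_rw [variance_of_integral_eq_zero hf.aemeasurable h0, Finset.sum_apply] at h
  simp_rw [mul_pow]
  rw [integral_const_mul, h]
  simp
  field_simp

lemma integral_batch_mean_sq_le (hm : 1 ≤ m) {f : X → ℝ} (hf : MemLp f 2 P) :
    ∫ ξ : Fin m → X, ((1 / (m : ℝ)) * ∑ i, f (ξ i)) ^ 2 ∂(Measure.pi fun _ => P) ≤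
      ∫ s, f s ^ 2 ∂P := by
  have hm0 : (m : ℝ) ≠ 0 := by positivity
  have hsq : MemLp (fun ξ : Fin m → X => (1 / (m : ℝ)) * ∑ i, f (ξ i)) 2 (Measure.pi fun _ => P) :=
    memLp_batch_mean hf
  have hint : ∀ i : Fin m, Integrable (fun ξ : Fin m → X => f (ξ i) ^ 2) (Measure.pi fun _ => P) :=
    fun i => (memLp_comp_eval hf i).integrable_sq
  calc ∫ ξ : Fin m → X, ((1 / (m : ℝ)) * ∑ i, f (ξ i)) ^ 2 ∂(Measure.pi fun _ => P)
      ≤ ∫ ξ : Fin m → X, (1 / (m : ℝ)) * ∑ i, f (ξ i) ^ 2 ∂(Measure.pi fun _ => P) := by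
        refine integral_mono hsq.integrable_sq
          ((integrable_finsetSum _ fun i _ => hint i).const_mul _) fun ξ => ?_
        have h := sq_sum_le_card_mul_sum_sq (s := Finset.univ) (f := fun i => f (ξ i))
        rw [Finset.card_univ, Fintype.card_fin] at h
        simp only
        rw [mul_pow]
        calc (1 / (m : ℝ)) ^ 2 * (∑ i, f (ξ i)) ^ 2
            ≤ (1 / (m : ℝ)) ^ 2 * (m * ∑ i, f (ξ i) ^ 2) := by gcongr
          _ = _ := by field_simp
    _ = ∫ s, f s ^ 2 ∂P := by
        rw [integral_const_mul, integral_finsetSum _ fun i _ => hint i]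
        simp_rw [integral_comp_eval_const (hf.integrable_sq.aestronglyMeasurable)]
        simp [hm0]

/-- Averaging divides the second moment of the centred part `A` by `m`. The part `B`, which need not
be centred, gains nothing and is split off by `(u + v)² ≤ 2u² + 2v²`. -/
lemma integral_batch_sq_le (hm : 1 ≤ m) {A B : X → ℝ} (hA : MemLp A 2 P) (hB : MemLp B 2 P)
    (h0 : ∫ s, A s ∂P = 0) (c : ℝ) :
    ∫ ξ : Fin m → X, ((1 / (m : ℝ)) * ∑ i, (c + A (ξ i) + B (ξ i))) ^ 2 ∂(Measure.pi fun _ => P) ≤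
      2 * (c ^ 2 + 1 / m * ∫ s, A s ^ 2 ∂P) + 2 * ∫ s, B s ^ 2 ∂P := by
  have hm0 : (m : ℝ) ≠ 0 := by positivity
  have hcA : MemLp (fun s => c + A s) 2 P := (memLp_const c).add hA
  have hcAB : MemLp (fun s => c + A s + B s) 2 P := hcA.add hB
  have hAm : MemLp (fun ξ : Fin m → X => (1 / (m : ℝ)) * ∑ i, A (ξ i)) 2 (Measure.pi fun _ => P) :=
    memLp_batch_mean hA
  have hBm : MemLp (fun ξ : Fin m → X => (1 / (m : ℝ)) * ∑ i, B (ξ i)) 2 (Measure.pi fun _ => P) :=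
    memLp_batch_mean hB
  have iA : Integrable (fun ξ : Fin m → X => 2 * c * ((1 / (m : ℝ)) * ∑ i, A (ξ i)))
      (Measure.pi fun _ => P) := (hAm.integrable one_le_two).const_mul (2 * c)
  have i0 : Integrable (fun ξ : Fin m → X => c ^ 2 + 2 * c * ((1 / (m : ℝ)) * ∑ i, A (ξ i)))
      (Measure.pi fun _ => P) := (integrable_const (c ^ 2)).add iA
  have i1 : Integrable (fun ξ : Fin m → X => 2 * (c ^ 2 + 2 * c * ((1 / (m : ℝ)) * ∑ i, A (ξ i)) +
      ((1 / (m : ℝ)) * ∑ i, A (ξ i)) ^ 2)) (Measure.pi fun _ => P) :=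
    (i0.add hAm.integrable_sq).const_mul 2
  have i2 : Integrable (fun ξ : Fin m → X => 2 * ((1 / (m : ℝ)) * ∑ i, B (ξ i)) ^ 2)
      (Measure.pi fun _ => P) := hBm.integrable_sq.const_mul 2
  calc ∫ ξ : Fin m → X, ((1 / (m : ℝ)) * ∑ i, (c + A (ξ i) + B (ξ i))) ^ 2 ∂(Measure.pi fun _ => P)
      ≤ ∫ ξ : Fin m → X, (2 * (c ^ 2 + 2 * c * ((1 / (m : ℝ)) * ∑ i, A (ξ i)) +
          ((1 / (m : ℝ)) * ∑ i, A (ξ i)) ^ 2) + 2 * ((1 / (m : ℝ)) * ∑ i, B (ξ i)) ^ 2)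
          ∂(Measure.pi fun _ => P) := by
        refine integral_mono (memLp_batch_mean hcAB).integrable_sq (i1.add i2) fun ξ => ?_
        simp only [Finset.sum_add_distrib, Finset.sum_const, Finset.card_univ, Fintype.card_fin,
          nsmul_eq_mul]
        have : (1 / (m : ℝ)) * (m * c + ∑ i, A (ξ i) + ∑ i, B (ξ i)) =
            c + (1 / (m : ℝ)) * ∑ i, A (ξ i) + (1 / (m : ℝ)) * ∑ i, B (ξ i) := by
          field_simp
        rw [this]
        nlinarith [sq_nonneg (c + (1 / (m : ℝ)) * ∑ i, A (ξ i) - (1 / (m : ℝ)) * ∑ i, B (ξ i))]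
    _ = 2 * (c ^ 2 + 1 / m * ∫ s, A s ^ 2 ∂P) +
          2 * ∫ ξ : Fin m → X, ((1 / (m : ℝ)) * ∑ i, B (ξ i)) ^ 2 ∂(Measure.pi fun _ => P) := by
        rw [integral_add i1 i2, integral_const_mul, integral_const_mul,
          integral_add i0 hAm.integrable_sq, integral_add (integrable_const (c ^ 2)) iA,
          integral_const_mul,
          integral_batch_mean hm hA, h0, integral_batch_mean_sq_of_integral_eq_zero hm hA h0]
        simp
    _ ≤ _ := by
        have := integral_batch_mean_sq_le hm hB
        linarith

end Batch

/-! ### Bias and second moment of the oracle noise. -/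

section Noise

variable {n : ℕ} {X : Type*} [MeasurableSpace X] {P : Measure X}
  {ζ η : Vec n → X → Vec n → ℝ} {Δζ Δη : ℝ}

lemma IsNoise.Δζ_nonneg (h : IsNoise P ζ η Δζ Δη) {u : Vec n} (hu : ‖u‖ = 1) : 0 ≤ Δζ :=
  (integral_nonneg fun _ => sq_nonneg _).trans (h.sq_le 0 u hu)

lemma IsNoise.measurable_ζ_section (h : IsNoise P ζ η Δζ Δη) (x u : Vec n) :
    Measurable fun s => ζ x s u :=
  h.measurable_ζ.comp (by fun_prop : Measurable fun s : X => (x, s, u))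

lemma IsNoise.measurable_η_section (h : IsNoise P ζ η Δζ Δη) (x u : Vec n) :
    Measurable fun s => η x s u :=
  h.measurable_η.comp (by fun_prop : Measurable fun s : X => (x, s, u))

lemma IsNoise.memLp_ζ (h : IsNoise P ζ η Δζ Δη) (x : Vec n) {u : Vec n} (hu : ‖u‖ = 1) :
    MemLp (fun s => ζ x s u) 2 P :=
  (memLp_two_iff_integrable_sq (h.measurable_ζ_section x u).aestronglyMeasurable).mpr
    (h.integrable_sq x u hu)

variable [IsProbabilityMeasure P]

lemma IsNoise.Δη_nonneg (h : IsNoise P ζ η Δζ Δη) {u : Vec n} (hu : ‖u‖ = 1) : 0 ≤ Δη := by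
  obtain ⟨s, hs⟩ := (h.abs_le 0 u hu).exists
  exact (abs_nonneg _).trans hs

lemma IsNoise.memLp_η (h : IsNoise P ζ η Δζ Δη) (x : Vec n) {u : Vec n} (hu : ‖u‖ = 1) :
    MemLp (fun s => η x s u) 2 P :=
  MemLp.of_bound (h.measurable_η_section x u).aestronglyMeasurable Δη (h.abs_le x u hu)

lemma IsNoise.memLp_add (h : IsNoise P ζ η Δζ Δη) (x : Vec n) {u : Vec n} (hu : ‖u‖ = 1) :
    MemLp (fun s => ζ x s u + η x s u) 2 P :=
  (h.memLp_ζ x hu).add (h.memLp_η x hu)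

lemma IsNoise.abs_integral_le (h : IsNoise P ζ η Δζ Δη) (x : Vec n) {u : Vec n} (hu : ‖u‖ = 1) :
    |∫ s, (ζ x s u + η x s u) ∂P| ≤ √Δζ + Δη := by
  rw [integral_add ((h.memLp_ζ x hu).integrable one_le_two)
    ((h.memLp_η x hu).integrable one_le_two)]
  refine (abs_add_le _ _).trans (add_le_add ?_ ?_)
  · rw [← Real.sqrt_sq_eq_abs]
    exact Real.sqrt_le_sqrt ((sq_integral_le (h.memLp_ζ x hu)).trans (h.sq_le x u hu))
  · have := norm_integral_le_of_norm_le (integrable_const Δη)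
      (f := fun s => η x s u) (h.abs_le x u hu)
    simpa using this

/-- The split `(a + b)² ≤ (5/4) a² + 5 b²` is uneven on purpose: it leads to the final coefficient
`35/16` of `Δζ`, below the required `61/24`, whereas the even split would give `7/2`. -/
lemma IsNoise.integral_sq_le (h : IsNoise P ζ η Δζ Δη) (x : Vec n) {u : Vec n} (hu : ‖u‖ = 1) :
    ∫ s, (ζ x s u + η x s u) ^ 2 ∂P ≤ 5 / 4 * Δζ + 5 * Δη ^ 2 := by
  have i1 := (h.integrable_sq x u hu).const_mul (5 / 4)
  calc ∫ s, (ζ x s u + η x s u) ^ 2 ∂P ≤ ∫ s, (5 / 4 * ζ x s u ^ 2 + 5 * Δη ^ 2) ∂P := by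
        refine integral_mono_ae (h.memLp_add x hu).integrable_sq
          (i1.add (integrable_const _)) ?_
        filter_upwards [h.abs_le x u hu] with s hs
        have h2 : η x s u ^ 2 ≤ Δη ^ 2 := by
          rw [← sq_abs (η x s u)]
          exact pow_le_pow_left₀ (abs_nonneg _) hs 2
        nlinarith [sq_nonneg (ζ x s u / 2 - 2 * η x s u)]
    _ ≤ _ := by
        rw [integral_add i1 (integrable_const _), integral_const_mul, integral_const,
          probReal_univ, one_smul]
        linarith [h.sq_le x u hu]

end Noise

/-! ### Averaging over the random input of one iteration. -/

section OneStep

/-- The batch average of the directional derivatives returned by the oracle. -/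
def batchDeriv {n m : ℕ} {X : Type*} (D : Vec n → X → Vec n → ℝ) (x : Vec n) (s : Fin m → X)
    (u : Vec n) : ℝ := (1 / (m : ℝ)) * ∑ i, D x (s i) u

lemma gradEst_eq {n m : ℕ} {X : Type*} (D : Vec n → X → Vec n → ℝ) (x : Vec n) (s : Fin m → X)
    (u : Vec n) : gradEst D x s u = batchDeriv D x s u • u := rfl

variable {n m : ℕ} {X : Type*} [MeasurableSpace X] {P : Measure X}
  {F : Vec n → X → ℝ} {g : Vec n → X → Vec n} {L : X → ℝ} {L₂ σ : ℝ}
  {ζ η : Vec n → X → Vec n → ℝ} {Δζ Δη : ℝ}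

lemma measurable_batchDeriv (hP : IsProblem P F g L L₂ σ) (hN : IsNoise P ζ η Δζ Δη) :
    Measurable fun t : Vec n × (Vec n × (Fin m → X)) =>
      batchDeriv (oracle g ζ η) t.1 t.2.2 t.2.1 := by
  unfold batchDeriv oracle
  refine (Finset.measurable_sum _ fun i _ => ?_).const_mul _
  have hi : Measurable fun t : Vec n × (Vec n × (Fin m → X)) => t.2.2 i :=
    (measurable_pi_apply i).comp (measurable_snd.comp measurable_snd)
  have hx : Measurable fun t : Vec n × (Vec n × (Fin m → X)) => t.1 := measurable_fst
  have hu : Measurable fun t : Vec n × (Vec n × (Fin m → X)) => t.2.1 :=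
    measurable_fst.comp measurable_snd
  refine ((Measurable.inner (hP.measurable_g.comp (hx.prodMk hi)) hu).add ?_).add ?_
  · exact hN.measurable_ζ.comp (hx.prodMk (hi.prodMk hu))
  · exact hN.measurable_η.comp (hx.prodMk (hi.prodMk hu))

lemma measurable_batchDeriv_section (hP : IsProblem P F g L L₂ σ) (hN : IsNoise P ζ η Δζ Δη)
    (x : Vec n) : Measurable fun t : Vec n × (Fin m → X) =>
      batchDeriv (oracle g ζ η) x t.2 t.1 := by
  have h := (measurable_batchDeriv (m := m) hP hN).comp (measurable_prodMk_left (x := x))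
  simp only [Function.comp_def] at h
  exact h

lemma IsProblem.memLp_inner_sub (hP : IsProblem P F g L L₂ σ) (x u : Vec n) :
    MemLp (fun s => inner ℝ (g x s - gradient (objective P F) x) u) 2 P := by
  refine MemLp.of_le_mul (c := ‖u‖) (hP.memLp_sub x)
    (Measurable.inner ((hP.measurable_grad x).sub_const _)
      measurable_const).aestronglyMeasurable ?_
  exact Filter.Eventually.of_forall fun s => (norm_inner_le_norm _ _).trans (le_of_eq (mul_comm _ _))

lemma batchDeriv_oracle_eq (x u : Vec n) (s : Fin m → X) :
    batchDeriv (oracle g ζ η) x s u = (1 / (m : ℝ)) * ∑ i,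
      (inner ℝ (gradient (objective P F) x) u +
        inner ℝ (g x (s i) - gradient (objective P F) x) u + (ζ x (s i) u + η x (s i) u)) := by
  unfold batchDeriv oracle
  congr 1
  refine Finset.sum_congr rfl fun i _ => ?_
  rw [inner_sub_left]
  ring

lemma integral_inner_sub_sq_le (hP : IsProblem P F g L L₂ σ) (x : Vec n) {u : Vec n}
    (hu : ‖u‖ = 1) : ∫ s, inner ℝ (g x s - gradient (objective P F) x) u ^ 2 ∂P ≤ σ ^ 2 := by
  refine (integral_mono (hP.memLp_inner_sub x u).integrable_sq (hP.integrable_variance x)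
    fun s => ?_).trans (hP.variance_le x)
  simp only
  rw [← sq_abs]
  have := abs_real_inner_le_norm (g x s - gradient (objective P F) x) u
  rw [hu, mul_one] at this
  exact pow_le_pow_left₀ (abs_nonneg _) this 2

lemma integrable_weighted_inner_sub_sq (hn : n ≠ 0) (hP : IsProblem P F g L L₂ σ) (x : Vec n)
    {ψ : Vec n → ℝ} (hc : Continuous ψ) :
    Integrable (fun t : Vec n × X => ψ t.1 *
      inner ℝ (g x t.2 - gradient (objective P F) x) t.1 ^ 2) ((uniformSphere n).prod P) := by
  have := isProbabilityMeasure_uniformSphere hn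
  have hdom : Integrable (fun t : Vec n × X => (|ψ t.1| * ‖t.1‖ ^ 2) *
      ‖g x t.2 - gradient (objective P F) x‖ ^ 2) ((uniformSphere n).prod P) :=
    (integrable_uniformSphere hn (f := fun e => |ψ e| * ‖e‖ ^ 2) (by fun_prop)).mul_prod (hP.integrable_variance x)
  refine hdom.mono' (Measurable.aestronglyMeasurable ?_) (Filter.Eventually.of_forall fun t => ?_)
  · refine (hc.measurable.comp measurable_fst).mul (Measurable.pow_const ?_ 2)
    exact Measurable.inner (((hP.measurable_grad x).comp measurable_snd).sub_const _) measurable_fst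
  · rw [norm_mul, norm_pow, Real.norm_eq_abs, mul_assoc, ← mul_pow]
    have := norm_inner_le_norm (𝕜 := ℝ) (g x t.2 - gradient (objective P F) x) t.1
    gcongr
    rwa [mul_comm]

variable [IsProbabilityMeasure P]

lemma IsProblem.integral_inner_sub (hP : IsProblem P F g L L₂ σ) (x u : Vec n) :
    ∫ s, inner ℝ (g x s - gradient (objective P F) x) u ∂P = 0 := by
  have hi : Integrable (fun s => g x s - gradient (objective P F) x) P :=
    (hP.integrable_g x).sub (integrable_const _)
  simp_rw [real_inner_comm u]
  rw [integral_inner hi, integral_sub (hP.integrable_g x) (integrable_const _), hP.gradient_eq]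
  simp

lemma memLp_const_add_add {A B : X → ℝ} (hA : MemLp A 2 P) (hB : MemLp B 2 P) (c : ℝ) :
    MemLp (fun s => c + A s + B s) 2 P :=
  ((memLp_const c).add hA).add hB

lemma integral_const_add_add {A B : X → ℝ} (hA : MemLp A 2 P) (hB : MemLp B 2 P)
    (h0 : ∫ s, A s ∂P = 0) (c : ℝ) : ∫ s, (c + A s + B s) ∂P = c + ∫ s, B s ∂P := by
  have hcA : MemLp (fun s => c + A s) 2 P := (memLp_const c).add hA
  rw [integral_add (hcA.integrable one_le_two) (hB.integrable one_le_two),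
    integral_add (integrable_const c) (hA.integrable one_le_two), h0]
  simp

lemma memLp_batchDeriv (hP : IsProblem P F g L L₂ σ) (hN : IsNoise P ζ η Δζ Δη) (x : Vec n)
    {u : Vec n} (hu : ‖u‖ = 1) :
    MemLp (fun s : Fin m → X => batchDeriv (oracle g ζ η) x s u) 2 (Measure.pi fun _ => P) := by
  simp_rw [batchDeriv_oracle_eq (P := P) (F := F)]
  exact memLp_batch_mean (memLp_const_add_add (hP.memLp_inner_sub x u) (hN.memLp_add x hu)
    (inner ℝ (gradient (objective P F) x) u))

lemma integral_batchDeriv (hm : 1 ≤ m) (hP : IsProblem P F g L L₂ σ) (hN : IsNoise P ζ η Δζ Δη)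
    (x : Vec n) {u : Vec n} (hu : ‖u‖ = 1) :
    ∫ s : Fin m → X, batchDeriv (oracle g ζ η) x s u ∂(Measure.pi fun _ => P) =
      inner ℝ (gradient (objective P F) x) u + ∫ s, (ζ x s u + η x s u) ∂P := by
  simp_rw [batchDeriv_oracle_eq (P := P) (F := F)]
  rw [integral_batch_mean hm (memLp_const_add_add (hP.memLp_inner_sub x u) (hN.memLp_add x hu)
      (inner ℝ (gradient (objective P F) x) u)),
    integral_const_add_add (hP.memLp_inner_sub x u) (hN.memLp_add x hu)
      (hP.integral_inner_sub x u)]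

lemma integral_batchDeriv_sq_le (hm : 1 ≤ m) (hP : IsProblem P F g L L₂ σ)
    (hN : IsNoise P ζ η Δζ Δη) (x : Vec n) {u : Vec n} (hu : ‖u‖ = 1) :
    ∫ s : Fin m → X, batchDeriv (oracle g ζ η) x s u ^ 2 ∂(Measure.pi fun _ => P) ≤
      2 * (inner ℝ (gradient (objective P F) x) u ^ 2 +
        1 / m * ∫ s, inner ℝ (g x s - gradient (objective P F) x) u ^ 2 ∂P) +
      2 * (5 / 4 * Δζ + 5 * Δη ^ 2) := by
  simp_rw [batchDeriv_oracle_eq (P := P) (F := F)]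
  have := integral_batch_sq_le hm (hP.memLp_inner_sub x u) (hN.memLp_add x hu)
    (hP.integral_inner_sub x u) (inner ℝ (gradient (objective P F) x) u)
  linarith [hN.integral_sq_le x hu]

lemma exists_bound_of_norm_eq_one {ψ : Vec n → ℝ} (hc : Continuous ψ) :
    ∃ C, ∀ᵐ e ∂uniformSphere n, ‖ψ e‖ ≤ C := by
  obtain ⟨C, hC⟩ := (isCompact_sphere (0 : Vec n) 1).exists_bound_of_continuousOn hc.continuousOn
  refine ⟨C, ?_⟩
  filter_upwards [ae_norm_eq_one_uniformSphere n] with e he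
  exact hC e (by simpa using he)

/-- By Fubini the direction is averaged first. For a fixed sample this gives exactly `‖g - ∇f‖² / n`
times the mean of `ψ`, so the variance enters with the factor `1 / n`. -/
lemma integral_weighted_inner_sub_sq_le (hn : n ≠ 0) (hP : IsProblem P F g L L₂ σ) (x : Vec n)
    {ψ : Vec n → ℝ} (hc : Continuous ψ) (hψ : IsHyperoctahedral ψ)
    (h0 : 0 ≤ ∫ e, ψ e ∂uniformSphere n) :
    ∫ e, ψ e * ∫ s, inner ℝ (g x s - gradient (objective P F) x) e ^ 2 ∂P ∂uniformSphere n ≤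
      σ ^ 2 / n * ∫ e, ψ e ∂uniformSphere n := by
  have := isProbabilityMeasure_uniformSphere hn
  have h2 : ∀ e, ψ e * ∫ s, inner ℝ (g x s - gradient (objective P F) x) e ^ 2 ∂P =
      ∫ s, ψ e * inner ℝ (g x s - gradient (objective P F) x) e ^ 2 ∂P :=
    fun e => (integral_const_mul _ _).symm
  simp_rw [h2]
  rw [integral_integral_swap (f := fun e s => ψ e *
    inner ℝ (g x s - gradient (objective P F) x) e ^ 2)
    (integrable_weighted_inner_sub_sq hn hP x hc)]
  have h1 : ∀ s, ∫ e, ψ e * inner ℝ (g x s - gradient (objective P F) x) e ^ 2 ∂uniformSphere n =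
      ‖g x s - gradient (objective P F) x‖ ^ 2 * (1 / n * ∫ e, ψ e ∂uniformSphere n) := by
    intro s
    have h := integral_inner_mul_inner hn hc hψ (g x s - gradient (objective P F) x)
      (g x s - gradient (objective P F) x)
    rw [real_inner_self_eq_norm_sq] at h
    calc _ = ∫ e, inner ℝ (g x s - gradient (objective P F) x) e *
          inner ℝ (g x s - gradient (objective P F) x) e * ψ e ∂uniformSphere n := by
          congr 1; ext e; ring
      _ = _ := by rw [h]; ring
  simp_rw [h1]
  rw [integral_mul_const]
  calc _ ≤ σ ^ 2 * (1 / n * ∫ e, ψ e ∂uniformSphere n) :=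
        mul_le_mul_of_nonneg_right (hP.variance_le x) (by positivity)
    _ = _ := by ring

lemma integrable_batchDeriv_sq (hn : n ≠ 0) (hm : 1 ≤ m) (hP : IsProblem P F g L L₂ σ)
    (hN : IsNoise P ζ η Δζ Δη) (x : Vec n) :
    Integrable (fun t : Vec n × (Fin m → X) => batchDeriv (oracle g ζ η) x t.2 t.1 ^ 2)
      ((uniformSphere n).prod (Measure.pi fun _ => P)) := by
  have := isProbabilityMeasure_uniformSphere hn
  have hmeas : Measurable fun t : Vec n × (Fin m → X) =>
      batchDeriv (oracle g ζ η) x t.2 t.1 ^ 2 :=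
    (measurable_batchDeriv_section hP hN x).pow_const 2
  rw [integrable_prod_iff hmeas.aestronglyMeasurable]
  constructor
  · filter_upwards [ae_norm_eq_one_uniformSphere n] with e he
    exact (memLp_batchDeriv hP hN x he).integrable_sq
  · refine Integrable.of_bound (C := 2 * (‖gradient (objective P F) x‖ ^ 2 + 1 / m * σ ^ 2) +
      2 * (5 / 4 * Δζ + 5 * Δη ^ 2))
      hmeas.norm.stronglyMeasurable.integral_prod_right'.aestronglyMeasurable ?_
    filter_upwards [ae_norm_eq_one_uniformSphere n] with e he
    simp_rw [norm_pow, Real.norm_eq_abs, sq_abs]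
    rw [abs_of_nonneg (integral_nonneg fun _ => sq_nonneg _)]
    refine (integral_batchDeriv_sq_le hm hP hN x he).trans ?_
    have h1 : inner ℝ (gradient (objective P F) x) e ^ 2 ≤ ‖gradient (objective P F) x‖ ^ 2 := by
      have := abs_real_inner_le_norm (gradient (objective P F) x) e
      rw [he, mul_one] at this
      rw [← sq_abs]
      exact pow_le_pow_left₀ (abs_nonneg _) this 2
    have h2 := integral_inner_sub_sq_le hP x he
    gcongr

/-- By Jensen from `E ⟨w, e⟩² = ‖w‖² / n`. This is why the bias of the noise is amplified by `√n`
rather than `n`. -/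
lemma integral_abs_inner_le (hn : n ≠ 0) (w : Vec n) :
    ∫ e, |inner ℝ w e| ∂uniformSphere n ≤ ‖w‖ / √n := by
  have := isProbabilityMeasure_uniformSphere hn
  have h := sq_integral_le (π := uniformSphere n) (f := fun e => |inner ℝ w e|)
    ((memLp_two_iff_integrable_sq (by fun_prop)).mpr
      (integrable_uniformSphere hn (by fun_prop)))
  have h2 := integral_inner_mul_inner_uniformSphere hn w w
  rw [real_inner_self_eq_norm_sq] at h2
  simp only [sq_abs] at h
  simp_rw [← sq] at h2
  rw [h2] at h
  refine (Real.le_sqrt_of_sq_le h).trans (le_of_eq ?_)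
  rw [Real.sqrt_div (by positivity), Real.sqrt_sq (norm_nonneg _)]

/-- For fixed `e`, the mean of `γ` over the samples is `⟨s, e⟩ + B` with `|B| ≤ √Δζ + Δη` and `B² ≤
Q`. In the `c₁` term the bias costs a quarter of the gain, by `⟨s, e⟩ B ≥ -⟨s, e⟩² / 4 - B²`, which
leaves the factor `3/4`. In the `c₂` term there is nothing to absorb it, so it stays as a multiple
of `|⟨w, e⟩|`. The expressions quadratic in `e` are then averaged exactly. -/
lemma integral_step_le (hn : n ≠ 0) (hm : 1 ≤ m) (hP : IsProblem P F g L L₂ σ)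
    (hN : IsNoise P ζ η Δζ Δη) (x w : Vec n) {ψ : Vec n → ℝ} (hc : Continuous ψ)
    (hψ : IsHyperoctahedral ψ) (hψ0 : ∀ e, 0 ≤ ψ e) {c₀ c₁ c₂ : ℝ} (h1 : 0 ≤ c₁) (h2 : 0 ≤ c₂) :
    Integrable (fun t : Vec n × (Fin m → X) => c₀ -
        c₁ * (inner ℝ (gradient (objective P F) x) t.1 * batchDeriv (oracle g ζ η) x t.2 t.1) -
        c₂ * (inner ℝ w t.1 * batchDeriv (oracle g ζ η) x t.2 t.1) +
        ψ t.1 * batchDeriv (oracle g ζ η) x t.2 t.1 ^ 2)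
      ((uniformSphere n).prod (Measure.pi fun _ => P)) ∧
    ∫ t : Vec n × (Fin m → X), (c₀ -
        c₁ * (inner ℝ (gradient (objective P F) x) t.1 * batchDeriv (oracle g ζ η) x t.2 t.1) -
        c₂ * (inner ℝ w t.1 * batchDeriv (oracle g ζ η) x t.2 t.1) +
        ψ t.1 * batchDeriv (oracle g ζ η) x t.2 t.1 ^ 2)
        ∂((uniformSphere n).prod (Measure.pi fun _ => P)) ≤
      c₀ - c₁ * (3 / 4 * (‖gradient (objective P F) x‖ ^ 2 / n) - (5 / 4 * Δζ + 5 * Δη ^ 2)) -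
        c₂ * (inner ℝ (gradient (objective P F) x) w / n - (√Δζ + Δη) * (‖w‖ / √n)) +
        (∫ e, ψ e ∂uniformSphere n) * (2 * ((‖gradient (objective P F) x‖ ^ 2 + σ ^ 2 / m) / n) +
          2 * (5 / 4 * Δζ + 5 * Δη ^ 2)) := by
  have := isProbabilityMeasure_uniformSphere hn
  set s := gradient (objective P F) x with hs
  set Q := 5 / 4 * Δζ + 5 * Δη ^ 2 with hQ
  set γ : Vec n → (Fin m → X) → ℝ := fun e ξ => batchDeriv (oracle g ζ η) x ξ e
  have hγm : Measurable fun t : Vec n × (Fin m → X) => γ t.1 t.2 :=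
    measurable_batchDeriv_section hP hN x
  have hγ2 : Integrable (fun t : Vec n × (Fin m → X) => γ t.1 t.2 ^ 2)
      ((uniformSphere n).prod (Measure.pi fun _ => P)) := integrable_batchDeriv_sq hn hm hP hN x
  have hγL : MemLp (fun t : Vec n × (Fin m → X) => γ t.1 t.2) 2
      ((uniformSphere n).prod (Measure.pi fun _ => P)) :=
    (memLp_two_iff_integrable_sq hγm.aestronglyMeasurable).mpr hγ2
  have hγ1 := hγL.integrable one_le_two
  have hbd : ∀ {φ : Vec n → ℝ}, Continuous φ → ∀ {f : Vec n × (Fin m → X) → ℝ},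
      Integrable f ((uniformSphere n).prod (Measure.pi fun _ => P)) →
      Integrable (fun t => φ t.1 * f t) ((uniformSphere n).prod (Measure.pi fun _ => P)) := by
    intro φ hφ f hf
    obtain ⟨C, hC⟩ := exists_bound_of_norm_eq_one hφ
    exact hf.bdd_mul (hφ.measurable.comp measurable_fst).aestronglyMeasurable
      (Measure.quasiMeasurePreserving_fst.ae hC)
  have hI : Integrable (fun t : Vec n × (Fin m → X) => c₀ - c₁ * (inner ℝ s t.1 * γ t.1 t.2) -
      c₂ * (inner ℝ w t.1 * γ t.1 t.2) + ψ t.1 * γ t.1 t.2 ^ 2)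
      ((uniformSphere n).prod (Measure.pi fun _ => P)) :=
    ((((integrable_const c₀).sub ((hbd (by fun_prop) hγ1).const_mul c₁)).sub
      ((hbd (by fun_prop) hγ1).const_mul c₂)).add (hbd hc hγ2))
  refine ⟨hI, ?_⟩
  rw [integral_prod _ hI]
  set T : Vec n → ℝ := fun e => ∫ t, inner ℝ (g x t - s) e ^ 2 ∂P
  have hTint : Integrable (fun e => ψ e * T e) (uniformSphere n) := by
    have := (integrable_weighted_inner_sub_sq hn hP x hc).integral_prod_left
    simpa only [integral_const_mul] using this
  have iK : Integrable (fun e => c₀ - c₁ * (3 / 4 * inner ℝ s e ^ 2 - Q) -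
      c₂ * (inner ℝ s e * inner ℝ w e - (√Δζ + Δη) * |inner ℝ w e|) +
      (2 * (inner ℝ s e * inner ℝ s e * ψ e) + 2 * Q * ψ e)) (uniformSphere n) :=
    integrable_uniformSphere hn (by fun_prop)
  calc ∫ e, ∫ ξ, (c₀ - c₁ * (inner ℝ s e * γ e ξ) - c₂ * (inner ℝ w e * γ e ξ) +
        ψ e * γ e ξ ^ 2) ∂(Measure.pi fun _ => P) ∂uniformSphere n
      ≤ ∫ e, ((c₀ - c₁ * (3 / 4 * inner ℝ s e ^ 2 - Q) -
          c₂ * (inner ℝ s e * inner ℝ w e - (√Δζ + Δη) * |inner ℝ w e|) +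
          (2 * (inner ℝ s e * inner ℝ s e * ψ e) + 2 * Q * ψ e)) +
          2 / m * (ψ e * T e)) ∂uniformSphere n := by
        refine integral_mono_ae hI.integral_prod_left (iK.add (hTint.const_mul _)) ?_
        filter_upwards [ae_norm_eq_one_uniformSphere n] with e he
        have hL := memLp_batchDeriv (m := m) hP hN x he
        have j1 : Integrable (fun ξ => γ e ξ) (Measure.pi fun _ => P) := hL.integrable one_le_two
        have j2 : Integrable (fun ξ => γ e ξ ^ 2) (Measure.pi fun _ => P) := hL.integrable_sq
        have e1 : ∫ ξ, (c₀ - c₁ * (inner ℝ s e * γ e ξ) - c₂ * (inner ℝ w e * γ e ξ) +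
            ψ e * γ e ξ ^ 2) ∂(Measure.pi fun _ => P) =
            c₀ - (c₁ * inner ℝ s e + c₂ * inner ℝ w e) * ∫ ξ, γ e ξ ∂(Measure.pi fun _ => P) +
            ψ e * ∫ ξ, γ e ξ ^ 2 ∂(Measure.pi fun _ => P) := by
          have : ∀ ξ, c₀ - c₁ * (inner ℝ s e * γ e ξ) - c₂ * (inner ℝ w e * γ e ξ) +
              ψ e * γ e ξ ^ 2 = (c₀ - (c₁ * inner ℝ s e + c₂ * inner ℝ w e) * γ e ξ) +
              ψ e * γ e ξ ^ 2 := fun ξ => by ring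
          simp_rw [this]
          have j3 : Integrable (fun ξ => c₀ - (c₁ * inner ℝ s e + c₂ * inner ℝ w e) * γ e ξ)
            (Measure.pi fun _ => P) := (integrable_const c₀).sub (j1.const_mul _)
          rw [integral_add j3 (j2.const_mul _), integral_sub (integrable_const c₀)
            (j1.const_mul _), integral_const_mul, integral_const_mul]
          simp
        rw [e1]
        have hJ1 : ∫ ξ, γ e ξ ∂(Measure.pi fun _ => P) =
          inner ℝ s e + ∫ t, (ζ x t e + η x t e) ∂P := integral_batchDeriv hm hP hN x he
        have hJ2 : ∫ ξ, γ e ξ ^ 2 ∂(Measure.pi fun _ => P) ≤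
          2 * (inner ℝ s e ^ 2 + 1 / m * T e) + 2 * Q := integral_batchDeriv_sq_le hm hP hN x he
        rw [hJ1]
        have hb := hN.abs_integral_le x he
        have hbq := (sq_integral_le (hN.memLp_add x he)).trans (hN.integral_sq_le x he)
        set B := ∫ t, (ζ x t e + η x t e) ∂P
        have k1 : 3 / 4 * inner ℝ s e ^ 2 - Q ≤ inner ℝ s e * (inner ℝ s e + B) := by
          nlinarith [sq_nonneg (inner ℝ s e / 2 + B)]
        have k2 : inner ℝ s e * inner ℝ w e - (√Δζ + Δη) * |inner ℝ w e| ≤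
            inner ℝ w e * (inner ℝ s e + B) := by
          have := neg_abs_le (inner ℝ w e * B)
          rw [abs_mul] at this
          nlinarith [mul_le_mul_of_nonneg_left hb (abs_nonneg (inner ℝ w e))]
        have k3 := mul_le_mul_of_nonneg_left hJ2 (hψ0 e)
        have k4 := mul_le_mul_of_nonneg_left k1 h1
        have k5 := mul_le_mul_of_nonneg_left k2 h2
        have k6 : ψ e * (2 * (inner ℝ s e ^ 2 + 1 / m * T e) + 2 * Q) =
          2 * (inner ℝ s e * inner ℝ s e * ψ e) + 2 * Q * ψ e + 2 / m * (ψ e * T e) := by ring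
        linarith
    _ ≤ _ := by
        have v1 : ∫ e, inner ℝ s e * inner ℝ s e * ψ e ∂uniformSphere n =
            ‖s‖ ^ 2 / n * ∫ e, ψ e ∂uniformSphere n := by
          rw [integral_inner_mul_inner hn hc hψ, real_inner_self_eq_norm_sq]
        have v2 : ∫ e, inner ℝ s e ^ 2 ∂uniformSphere n = ‖s‖ ^ 2 / n := by
          simp_rw [sq (inner ℝ s _)]
          rw [integral_inner_mul_inner_uniformSphere hn, real_inner_self_eq_norm_sq]
        have v3 := integral_inner_mul_inner_uniformSphere hn s w
        have v4 := integral_abs_inner_le hn w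
        have v5 := integral_weighted_inner_sub_sq_le hn hP x hc hψ (integral_nonneg hψ0)
        have q1 : Integrable (fun e => inner ℝ s e ^ 2) (uniformSphere n) :=
          integrable_uniformSphere hn (by fun_prop)
        have q2 : Integrable (fun e => inner ℝ s e * inner ℝ w e) (uniformSphere n) :=
          integrable_uniformSphere hn (by fun_prop)
        have q3 : Integrable (fun e => |inner ℝ w e|) (uniformSphere n) :=
          integrable_uniformSphere hn (by fun_prop)
        have q4 : Integrable (fun e => inner ℝ s e * inner ℝ s e * ψ e) (uniformSphere n) :=
          integrable_uniformSphere hn (by fun_prop)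
        have q5 : Integrable ψ (uniformSphere n) := integrable_uniformSphere hn hc
        have q6 : Integrable (fun e => c₀ + c₁ * Q - c₁ * (3 / 4) * inner ℝ s e ^ 2)
          (uniformSphere n) := integrable_uniformSphere hn (by fun_prop)
        have q7 : Integrable (fun e => c₀ + c₁ * Q - c₁ * (3 / 4) * inner ℝ s e ^ 2 -
          c₂ * (inner ℝ s e * inner ℝ w e)) (uniformSphere n) :=
          integrable_uniformSphere hn (by fun_prop)
        have q8 : Integrable (fun e => c₀ + c₁ * Q - c₁ * (3 / 4) * inner ℝ s e ^ 2 -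
          c₂ * (inner ℝ s e * inner ℝ w e) + c₂ * (√Δζ + Δη) * |inner ℝ w e|)
          (uniformSphere n) := integrable_uniformSphere hn (by fun_prop)
        have q9 : Integrable (fun e => c₀ + c₁ * Q - c₁ * (3 / 4) * inner ℝ s e ^ 2 -
          c₂ * (inner ℝ s e * inner ℝ w e) + c₂ * (√Δζ + Δη) * |inner ℝ w e| +
          2 * (inner ℝ s e * inner ℝ s e * ψ e))
          (uniformSphere n) := integrable_uniformSphere hn (by fun_prop)
        have hval : ∫ e, (c₀ - c₁ * (3 / 4 * inner ℝ s e ^ 2 - Q) -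
            c₂ * (inner ℝ s e * inner ℝ w e - (√Δζ + Δη) * |inner ℝ w e|) +
            (2 * (inner ℝ s e * inner ℝ s e * ψ e) + 2 * Q * ψ e)) ∂uniformSphere n =
            c₀ + c₁ * Q - c₁ * (3 / 4) * (‖s‖ ^ 2 / n) - c₂ * (inner ℝ s w / n) +
            c₂ * (√Δζ + Δη) * (∫ e, |inner ℝ w e| ∂uniformSphere n) +
            2 * (‖s‖ ^ 2 / n * ∫ e, ψ e ∂uniformSphere n) +
            2 * Q * ∫ e, ψ e ∂uniformSphere n := by
          have : ∀ e, c₀ - c₁ * (3 / 4 * inner ℝ s e ^ 2 - Q) -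
              c₂ * (inner ℝ s e * inner ℝ w e - (√Δζ + Δη) * |inner ℝ w e|) +
              (2 * (inner ℝ s e * inner ℝ s e * ψ e) + 2 * Q * ψ e) =
              c₀ + c₁ * Q - c₁ * (3 / 4) * inner ℝ s e ^ 2 -
              c₂ * (inner ℝ s e * inner ℝ w e) + c₂ * (√Δζ + Δη) * |inner ℝ w e| +
              2 * (inner ℝ s e * inner ℝ s e * ψ e) + 2 * Q * ψ e := fun e => by ring
          simp_rw [this]
          rw [integral_add q9 (q5.const_mul _), integral_add q8 (q4.const_mul _),
            integral_add q7 (q3.const_mul _), integral_sub q6 (q2.const_mul _),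
            integral_sub (integrable_const _) (q1.const_mul _)]
          simp_rw [integral_const_mul]
          rw [v1, v2, v3]
          simp
        rw [integral_add iK (hTint.const_mul _), hval, integral_const_mul]
        obtain ⟨e₀, he₀⟩ := (ae_norm_eq_one_uniformSphere n).exists
        have hb0 : 0 ≤ √Δζ + Δη := add_nonneg (Real.sqrt_nonneg _) (hN.Δη_nonneg he₀)
        have w1 := mul_le_mul_of_nonneg_left v4 (mul_nonneg h2 hb0)
        have w2 := mul_le_mul_of_nonneg_left v5 (by positivity : 0 ≤ 2 / (m : ℝ))
        have w3 : 2 / (m : ℝ) * (σ ^ 2 / n * ∫ e, ψ e ∂uniformSphere n) =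
          (∫ e, ψ e ∂uniformSphere n) * (2 * (σ ^ 2 / m / n)) := by ring
        have w4 : c₂ * (√Δζ + Δη) * (‖w‖ / √n) = c₂ * ((√Δζ + Δη) * (‖w‖ / √n)) := by ring
        have w5 : (∫ e, ψ e ∂uniformSphere n) * (2 * ((‖s‖ ^ 2 + σ ^ 2 / m) / n) + 2 * Q) =
          2 * (‖s‖ ^ 2 / n * ∫ e, ψ e ∂uniformSphere n) +
            (∫ e, ψ e ∂uniformSphere n) * (2 * (σ ^ 2 / m / n)) +
            2 * Q * ∫ e, ψ e ∂uniformSphere n := by ring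
        rw [w5]
        linarith

end OneStep

/-! ### The mirror step. -/

section Mirror

variable {n : ℕ} {p : ℝ} {d : Vec n → ℝ}

lemma IsProxFunction.hasGradientAt (hd : IsProxFunction p d) (x : Vec n) :
    HasGradientAt d (gradient d x) x :=
  (hd.differentiable x).hasGradientAt

lemma IsProxFunction.half_sq_le_bregman (hd : IsProxFunction p d) (z u : Vec n) :
    1 / 2 * pNorm p (u - z) ^ 2 ≤ bregman d z u := hd.strongly_convex z u

lemma IsProxFunction.half_norm_sq_le_bregman (hd : IsProxFunction p d) (hp : 0 < p) (hp2 : p ≤ 2)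
    (z u : Vec n) : 1 / 2 * ‖z - u‖ ^ 2 ≤ bregman d z u := by
  refine le_trans ?_ (hd.half_sq_le_bregman z u)
  rw [norm_sub_rev]
  have := norm_le_pNorm hp hp2 (u - z)
  gcongr

/-- Strong convexity at `z` and at `u`, added together, bounds `‖z - u‖²` by `⟨∇d(z) - ∇d(u), z -
u⟩`. -/
lemma IsProxFunction.norm_sub_le_norm_gradient_sub (hd : IsProxFunction p d) (hp : 0 < p)
    (hp2 : p ≤ 2) (z u : Vec n) : ‖z - u‖ ≤ ‖gradient d z - gradient d u‖ := by
  have h1 := hd.half_norm_sq_le_bregman hp hp2 z u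
  have h2 := hd.half_norm_sq_le_bregman hp hp2 u z
  have h3 := real_inner_le_norm (gradient d z - gradient d u) (z - u)
  have h4 : bregman d z u + bregman d u z = inner ℝ (gradient d z - gradient d u) (z - u) := by
    unfold bregman
    rw [inner_sub_left, ← neg_sub z u, inner_neg_right]
    ring
  rw [norm_sub_rev u z] at h2
  by_contra hlt
  push Not at hlt
  have hpos : 0 < ‖z - u‖ := (norm_nonneg _).trans_lt hlt
  nlinarith [mul_lt_mul_of_pos_right hlt hpos]

/-- Since `∇d` does not shrink distances, it has a 1-Lipschitz inverse on its range, which extends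
to the whole space. The purpose is measurability: a minimiser `z_{k+1}` is recovered as `J` of its
gradient, which is a measurable function of the past. -/
lemma IsProxFunction.exists_continuous_inverse (hd : IsProxFunction p d) (hp : 0 < p)
    (hp2 : p ≤ 2) : ∃ J : Vec n → Vec n, Continuous J ∧ ∀ z, J (gradient d z) = z := by
  have hinj : Function.Injective (gradient d) := fun z u h => by
    have := hd.norm_sub_le_norm_gradient_sub hp hp2 z u
    rw [h, sub_self, norm_zero] at this
    exact sub_eq_zero.mp (norm_le_zero_iff.mp this)
  have hl : LipschitzOnWith 1 (Function.invFun (gradient d)) (Set.range (gradient d)) := by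
    refine LipschitzOnWith.of_dist_le_mul ?_
    rintro _ ⟨z, rfl⟩ _ ⟨u, rfl⟩
    rw [Function.leftInverse_invFun hinj, Function.leftInverse_invFun hinj, dist_eq_norm,
      dist_eq_norm, NNReal.coe_one, one_mul]
    exact hd.norm_sub_le_norm_gradient_sub hp hp2 z u
  obtain ⟨J, hJ, hJeq⟩ := hl.extend_finite_dimension
  refine ⟨J, hJ.continuous, fun z => ?_⟩
  rw [← hJeq ⟨z, rfl⟩, Function.leftInverse_invFun hinj]

/-- The first-order condition on every line through the minimiser. -/
lemma IsProxFunction.gradient_eq_of_isMinOn (hd : IsProxFunction p d) {a : ℝ} {G z z' : Vec n}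
    (h : IsMinOn (fun v => a * inner ℝ G (v - z) + bregman d z v) Set.univ z') :
    gradient d z' = gradient d z - a • G := by
  have key : ∀ v, inner ℝ (a • G + (gradient d z' - gradient d z)) v = 0 := by
    intro v
    have hmin : IsLocalMin (fun t : ℝ => a * inner ℝ G (z' + t • v - z) +
        bregman d z (z' + t • v)) 0 := by
      refine Filter.Eventually.of_forall fun t => ?_
      have := h (Set.mem_univ (z' + t • v))
      simpa using this
    have hder : HasDerivAt (fun t : ℝ => a * inner ℝ G (z' + t • v - z) +
        bregman d z (z' + t • v))
        (a * inner ℝ G v + (inner ℝ (gradient d z') v - inner ℝ (gradient d z) v)) 0 := by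
      have hlin : ∀ w : Vec n, HasDerivAt (fun t : ℝ => inner ℝ w (z' + t • v - z))
          (inner ℝ w v) 0 := by
        intro w
        have h1 : (fun t : ℝ => inner ℝ w (z' + t • v - z)) =
            fun t => inner ℝ w (z' - z) + t * inner ℝ w v := by
          ext t
          rw [add_sub_right_comm, inner_add_right, real_inner_smul_right]
        rw [h1]
        simpa using ((hasDerivAt_id (0 : ℝ)).mul_const (inner ℝ w v)).const_add
          (inner ℝ w (z' - z))
      have h2 : HasDerivAt (fun t : ℝ => d (z' + t • v)) (inner ℝ (gradient d z') v) 0 :=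
        hasDerivAt_comp_line (by simpa using hd.hasGradientAt z')
      exact ((hlin G).const_mul a).add ((h2.sub_const (d z)).sub (hlin (gradient d z)))
    have := hmin.hasDerivAt_eq_zero hder
    rw [inner_add_left, real_inner_smul_left, inner_sub_left]
    exact this
  have h0 := inner_self_eq_zero.mp (key (a • G + (gradient d z' - gradient d z)))
  rw [← sub_eq_zero, ← h0]
  abel

lemma mul_le_half_add_half {t γ W N : ℝ} (hW : 0 ≤ W) (h : t ^ 2 ≤ W * N ^ 2) :
    γ * t ≤ 1 / 2 * γ ^ 2 * W + 1 / 2 * N ^ 2 := by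
  refine le_of_abs_le (abs_le_of_sq_le_sq ?_ (by positivity))
  calc (γ * t) ^ 2 = γ ^ 2 * t ^ 2 := by ring
    _ ≤ γ ^ 2 * (W * N ^ 2) := by gcongr
    _ ≤ _ := by nlinarith [sq_nonneg (γ ^ 2 * W - N ^ 2)]

/-- By the three-point identity, `V[z'](u) = V[z](u) - V[z](z') + a γ ⟨e, u - z'⟩`. The term
`V[z](z') ≥ ‖z' - z‖_p² / 2` absorbs `a γ ⟨e, z - z'⟩` by Young's inequality in the form
`mul_le_half_add_half`. -/
lemma IsProxFunction.bregman_mirror_le (hd : IsProxFunction p d) {W : Vec n → ℝ}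
    (hW : IsDualWeight p W) {a γ : ℝ} {e z z' : Vec n}
    (h : gradient d z' = gradient d z - a • (γ • e)) (u : Vec n) :
    bregman d z' u ≤ bregman d z u - a * (inner ℝ (z - u) e * γ) + 1 / 2 * a ^ 2 * (W e * γ ^ 2) := by
  have h1 := hd.half_sq_le_bregman z z'
  have h2 := mul_le_half_add_half (γ := - (a * γ)) (hW.nonneg e) (hW.inner_sq_le e (z' - z))
  have h3 : bregman d z' u = bregman d z u - bregman d z z' + inner ℝ (a • (γ • e)) (u - z') := by
    unfold bregman
    rw [h, inner_sub_left]
    simp only [inner_sub_right]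
    ring
  rw [h3, real_inner_smul_left, real_inner_smul_left]
  have h4 : inner ℝ e (u - z') = - inner ℝ (z - u) e - inner ℝ e (z' - z) := by
    rw [real_inner_comm e (z - u), ← inner_neg_right, ← inner_sub_right]
    congr 1
    abel
  rw [h4]
  nlinarith

/-- The right side of the mirror inequality is nonnegative at every state, whether or not a
minimiser exists there. It is thus a nonnegative integrand, and bounds on its sections give
integrability. -/
lemma IsProxFunction.bregman_sub_add_nonneg (hd : IsProxFunction p d) {W : Vec n → ℝ}
    (hW : IsDualWeight p W) (a γ : ℝ) (e z u : Vec n) :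
    0 ≤ bregman d z u - a * (inner ℝ (z - u) e * γ) + 1 / 2 * a ^ 2 * (W e * γ ^ 2) := by
  have h1 := hd.half_sq_le_bregman z u
  have h2 := mul_le_half_add_half (γ := - (a * γ)) (hW.nonneg e) (hW.inner_sq_le e (u - z))
  have h4 : inner ℝ e (u - z) = - inner ℝ (z - u) e := by
    rw [real_inner_comm e (z - u), ← inner_neg_right]
    congr 1
    abel
  rw [h4] at h2
  nlinarith

lemma measurable_gradient (f : Vec n → ℝ) : Measurable (gradient f) :=
  (InnerProductSpace.toDual ℝ (Vec n)).symm.continuous.measurable.comp (measurable_fderiv ℝ f)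

lemma IsProxFunction.measurable_bregman (hd : IsProxFunction p d) (u : Vec n) :
    Measurable fun z => bregman d z u := by
  unfold bregman
  have h1 : Measurable d := hd.differentiable.continuous.measurable
  have h2 := measurable_gradient d
  exact ((h1.const_sub (d u))).sub (h2.inner (measurable_id.const_sub u))

end Mirror

/-! ### Independence of the state and the next input. -/

section Independence

variable {Ω A B : Type*} [MeasurableSpace Ω] [MeasurableSpace A] [MeasurableSpace B]
  {μ : Measure Ω}

/-- This takes the place of conditional expectation. As `H ≥ 0`, a bound on the integral of every
section gives both integrability under the product law and the estimate. -/
lemma integral_comp_indepFun_le [IsProbabilityMeasure μ] {S : Ω → A} {I : Ω → B} (hS : Measurable S) (hI : Measurable I)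
    (hind : IndepFun S I μ) {ν : Measure B} [IsProbabilityMeasure ν] (hν : μ.map I = ν)
    {H : A × B → ℝ} (hH : Measurable H) (hH0 : ∀ t, 0 ≤ H t) {K : A → ℝ} (hK : Measurable K)
    (hsec : ∀ a, Integrable (fun b => H (a, b)) ν ∧ ∫ b, H (a, b) ∂ν ≤ K a)
    (hKS : Integrable (fun ω => K (S ω)) μ) :
    Integrable (fun ω => H (S ω, I ω)) μ ∧ ∫ ω, H (S ω, I ω) ∂μ ≤ ∫ ω, K (S ω) ∂μ := by
  have hlaw : μ.map (fun ω => (S ω, I ω)) = (μ.map S).prod ν := by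
    rw [(indepFun_iff_map_prod_eq_prod_map_map hS.aemeasurable hI.aemeasurable).mp hind, hν]
  have hprob : IsProbabilityMeasure (μ.map S) := Measure.isProbabilityMeasure_map hS.aemeasurable
  have hKint : Integrable K (μ.map S) :=
    (integrable_map_measure hK.aestronglyMeasurable hS.aemeasurable).mpr hKS
  have hHint : Integrable H ((μ.map S).prod ν) := by
    rw [integrable_prod_iff hH.aestronglyMeasurable]
    refine ⟨Filter.Eventually.of_forall fun a => (hsec a).1, ?_⟩
    refine hKint.mono' hH.norm.stronglyMeasurable.integral_prod_right'.aestronglyMeasurable ?_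
    refine Filter.Eventually.of_forall fun a => ?_
    simp_rw [Real.norm_of_nonneg (hH0 _)]
    rw [Real.norm_of_nonneg (integral_nonneg fun b => hH0 (a, b))]
    exact (hsec a).2
  have hpair : Measurable fun ω => (S ω, I ω) := hS.prodMk hI
  constructor
  · rw [← hlaw] at hHint
    exact (integrable_map_measure hH.aestronglyMeasurable hpair.aemeasurable).mp hHint
  · calc ∫ ω, H (S ω, I ω) ∂μ = ∫ t, H t ∂(μ.map (fun ω => (S ω, I ω))) :=
          (integral_map hpair.aemeasurable hH.aestronglyMeasurable).symm
      _ = ∫ a, ∫ b, H (a, b) ∂ν ∂(μ.map S) := by rw [hlaw, integral_prod _ hHint]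
      _ ≤ ∫ a, K a ∂(μ.map S) :=
          integral_mono hHint.integral_prod_left hKint fun a => (hsec a).2
      _ = ∫ ω, K (S ω) ∂μ := integral_map hS.aemeasurable hK.aestronglyMeasurable

/-- A state which is updated by a measurable function of the past state and of a fresh input is
independent of the next input. -/
lemma indepFun_of_recursion {N : ℕ} {inp : Fin N → Ω → B} (hinp : ∀ k, Measurable (inp k))
    (hind : iIndepFun inp μ) {S : ℕ → Ω → A} {a₀ : A} (h0 : ∀ ω, S 0 ω = a₀)
    {Φ : ℕ → A × B → A} (hΦ : ∀ k, Measurable (Φ k))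
    (hS : ∀ (k : Fin N) ω, S (k + 1) ω = Φ k (S k ω, inp k ω)) :
    (∀ k ≤ N, Measurable (S k)) ∧ ∀ k : Fin N, IndepFun (S k) (inp k) μ := by
  set past : ℕ → MeasurableSpace Ω := fun k =>
    ⨆ j ∈ {j : Fin N | (j : ℕ) < k}, MeasurableSpace.comap (inp j) inferInstance with hpast
  have hmeas : ∀ k ≤ N, Measurable[past k] (S k) := by
    intro k
    induction k with
    | zero =>
      intro _
      have : S 0 = fun _ => a₀ := funext h0
      rw [this]
      exact measurable_const
    | succ k ih =>
      intro hk
      have hmono : past k ≤ past (k + 1) :=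
        biSup_mono fun j (hj : (j : ℕ) < k) => (Nat.lt_succ_of_lt hj : (j : ℕ) < k + 1)
      have h1 : Measurable[past (k + 1)] (S k) := (ih (by omega)).mono hmono le_rfl
      have h2 : Measurable[past (k + 1)] (inp ⟨k, hk⟩) := by
        refine (comap_measurable (inp ⟨k, hk⟩)).mono ?_ le_rfl
        exact le_biSup (fun j : Fin N => MeasurableSpace.comap (inp j) inferInstance)
          (show ((⟨k, hk⟩ : Fin N) : ℕ) < k + 1 from Nat.lt_succ_self k)
      have : S (k + 1) = fun ω => Φ k (S k ω, inp ⟨k, hk⟩ ω) := funext fun ω => hS ⟨k, hk⟩ ω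
      rw [this]
      exact (hΦ k).comp (h1.prodMk h2)
  have hle : ∀ k, past k ≤ ‹MeasurableSpace Ω› := fun k =>
    iSup₂_le fun j _ => (hinp j).comap_le
  refine ⟨fun k hk => (hmeas k hk).mono (hle k) le_rfl, fun k => ?_⟩
  -- The state at time `k` is measurable with respect to the inputs of index below `k`, a set of
  -- indices that omits `k`.
  have hdisj : Disjoint {j : Fin N | (j : ℕ) < k} {k} := by
    rw [Set.disjoint_singleton_right]
    simp
  have h := indep_iSup_of_disjoint (fun j => (hinp j).comap_le) hind.iIndep hdisj
  rw [iSup_singleton] at h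
  exact (IndepFun_iff_Indep _ _ _).mpr
    (indep_of_indep_of_le_left h (hmeas k k.2.le).comap_le)

end Independence

/-! ### Expected change of the potential in one iteration. -/

section Step

variable {n m : ℕ} {X : Type*} [MeasurableSpace X] {P : Measure X}
  {F : Vec n → X → ℝ} {g : Vec n → X → Vec n} {L : X → ℝ} {L₂ σ : ℝ}
  {ζ η : Vec n → X → Vec n → ℝ} {Δζ Δη p : ℝ} {d : Vec n → ℝ} {W : Vec n → ℝ}

/-- The scale `1 / (192 n² ρ_n L₂)` of the weights in the potential function. -/
def potScale (n : ℕ) (p L₂ : ℝ) : ℝ := 1 / (192 * (n : ℝ) ^ 2 * rho n p * L₂)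

lemma potScale_pos (hn : 8 ≤ n) (hp1 : 1 ≤ p) (hp2 : p ≤ 2) (hL : 0 < L₂) :
    0 < potScale n p L₂ := by
  have := rho_pos hn hp1 hp2
  have hn0 : (0 : ℝ) < n := by exact_mod_cast (by omega : 0 < n)
  unfold potScale
  positivity

lemma stepSize_eq (n : ℕ) (p L₂ : ℝ) (k : ℕ) :
    stepSize n p L₂ k = 2 * ((k : ℝ) + 2) * potScale n p L₂ := by
  unfold stepSize potScale
  rw [show (192 : ℝ) * (n : ℝ) ^ 2 * rho n p * L₂ = 2 * (96 * (n : ℝ) ^ 2 * rho n p * L₂) by ring,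
    one_div, mul_inv]
  ring

/-- The point `x_{k+1}` as a function of `(y_k, z_k)`. -/
def couple (k : ℕ) (t : Vec n × Vec n) : Vec n := tau k • t.2 + (1 - tau k) • t.1

/-- The weight of `γ²` in the upper bound for one iteration. -/
def stepWeight (p L₂ : ℝ) (W : Vec n → ℝ) (k : ℕ) (e : Vec n) : ℝ :=
  ((k : ℝ) + 2) ^ 2 * potScale n p L₂ / (8 * L₂) * ‖e‖ ^ 2 +
    1 / 2 * (stepSize n p L₂ k * n) ^ 2 * W e

/-- The upper bound for the potential after one iteration, as a function of `(y_k, z_k)` and of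
the random input. -/
def stepUpper (p L₂ : ℝ) (W : Vec n → ℝ) (P : Measure X) (F : Vec n → X → ℝ)
    (D : Vec n → X → Vec n → ℝ) (d : Vec n → ℝ) (xs : Vec n) (k : ℕ)
    (t : (Vec n × Vec n) × (Vec n × (Fin m → X))) : ℝ :=
  (((k : ℝ) + 2) ^ 2 * potScale n p L₂ * (objective P F (couple k t.1) - objective P F xs) +
      bregman d t.1.2 xs) -
    ((k : ℝ) + 2) ^ 2 * potScale n p L₂ / (2 * L₂) *
      (inner ℝ (gradient (objective P F) (couple k t.1)) t.2.1 *
        batchDeriv D (couple k t.1) t.2.2 t.2.1) -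
    stepSize n p L₂ k * n * (inner ℝ (t.1.2 - xs) t.2.1 * batchDeriv D (couple k t.1) t.2.2 t.2.1) +
    stepWeight p L₂ W k t.2.1 * batchDeriv D (couple k t.1) t.2.2 t.2.1 ^ 2

/-- The bound for the conditional expectation of `stepUpper`. -/
def stepMean (p L₂ σ Δζ Δη : ℝ) (m : ℕ) (P : Measure X) (F : Vec n → X → ℝ) (d : Vec n → ℝ)
    (xs : Vec n) (k : ℕ) (t : Vec n × Vec n) : ℝ :=
  (k : ℝ) * (k + 2) * potScale n p L₂ * (objective P F t.1 - objective P F xs) +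
    bregman d t.2 xs + stepSize n p L₂ k * √n * (√Δζ + Δη) * ‖t.2 - xs‖ +
    ((k : ℝ) + 2) ^ 2 * potScale n p L₂ *
      (7 / (8 * L₂) * (5 / 4 * Δζ + 5 * Δη ^ 2) + 3 / (8 * L₂ * n) * (σ ^ 2 / m))

lemma measurable_couple (k : ℕ) : Measurable (couple (n := n) k) := by
  unfold couple
  fun_prop

lemma stepUpper_eq (D : Vec n → X → Vec n → ℝ) (xs : Vec n) (k : ℕ)
    (t : (Vec n × Vec n) × (Vec n × (Fin m → X))) (hL : L₂ ≠ 0) :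
    stepUpper p L₂ W P F D d xs k t =
      ((k : ℝ) + 2) ^ 2 * potScale n p L₂ * (objective P F (couple k t.1) -
        1 / (2 * L₂) * (inner ℝ (gradient (objective P F) (couple k t.1)) t.2.1 *
          batchDeriv D (couple k t.1) t.2.2 t.2.1) +
        1 / (8 * L₂) * (‖t.2.1‖ ^ 2 * batchDeriv D (couple k t.1) t.2.2 t.2.1 ^ 2) -
        objective P F xs) +
      (bregman d t.1.2 xs - stepSize n p L₂ k * n *
        (inner ℝ (t.1.2 - xs) t.2.1 * batchDeriv D (couple k t.1) t.2.2 t.2.1) +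
        1 / 2 * (stepSize n p L₂ k * n) ^ 2 *
          (W t.2.1 * batchDeriv D (couple k t.1) t.2.2 t.2.1 ^ 2)) := by
  unfold stepUpper stepWeight
  field_simp
  ring

variable [IsProbabilityMeasure P]

lemma descent_step (hP : IsProblem P F g L L₂ σ) (x e : Vec n) (γ : ℝ) :
    objective P F (x - (1 / (2 * L₂)) • (γ • e)) ≤ objective P F x -
      1 / (2 * L₂) * (inner ℝ (gradient (objective P F) x) e * γ) +
      1 / (8 * L₂) * (‖e‖ ^ 2 * γ ^ 2) := by
  have hL := hP.L₂_pos
  have h := hP.descent x (- ((1 / (2 * L₂)) • (γ • e)))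
  rw [← sub_eq_add_neg, inner_neg_right, norm_neg, real_inner_smul_right, real_inner_smul_right,
    norm_smul, norm_smul, Real.norm_eq_abs, Real.norm_eq_abs, mul_pow, mul_pow, sq_abs, sq_abs] at h
  refine h.trans (le_of_eq ?_)
  field_simp
  ring

/-- The first summand dominates the gap at the point reached by the gradient step, and the second is
the nonnegative mirror bound. No run is involved, so this holds at every argument. -/
lemma stepUpper_nonneg (hn : 8 ≤ n) (hp1 : 1 ≤ p) (hp2 : p ≤ 2) (hP : IsProblem P F g L L₂ σ)
    (hd : IsProxFunction p d) (hW : IsDualWeight p W) (D : Vec n → X → Vec n → ℝ) {xs : Vec n}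
    (hxs : ∀ v, objective P F xs ≤ objective P F v) (k : ℕ)
    (t : (Vec n × Vec n) × (Vec n × (Fin m → X))) :
    0 ≤ stepUpper p L₂ W P F D d xs k t := by
  rw [stepUpper_eq _ _ _ _ hP.L₂_pos.ne']
  have hβ := potScale_pos hn hp1 hp2 hP.L₂_pos
  refine add_nonneg (mul_nonneg (by positivity) ?_) (hd.bregman_sub_add_nonneg hW _ _ _ _ _)
  have := descent_step hP (couple k t.1) t.2.1 (batchDeriv D (couple k t.1) t.2.2 t.2.1)
  linarith [hxs (couple k t.1 - (1 / (2 * L₂)) •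
    (batchDeriv D (couple k t.1) t.2.2 t.2.1 • t.2.1))]

lemma potential_le_stepUpper (hn : 8 ≤ n) (hp1 : 1 ≤ p) (hp2 : p ≤ 2)
    (hP : IsProblem P F g L L₂ σ) (hd : IsProxFunction p d) (hW : IsDualWeight p W)
    (D : Vec n → X → Vec n → ℝ) (xs : Vec n) (k : ℕ)
    (t : (Vec n × Vec n) × (Vec n × (Fin m → X))) {z' : Vec n}
    (hz : gradient d z' = gradient d t.1.2 - (stepSize n p L₂ k * n) •
      (batchDeriv D (couple k t.1) t.2.2 t.2.1 • t.2.1)) :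
    ((k : ℝ) + 2) ^ 2 * potScale n p L₂ * (objective P F (couple k t.1 - (1 / (2 * L₂)) •
      (batchDeriv D (couple k t.1) t.2.2 t.2.1 • t.2.1)) - objective P F xs) + bregman d z' xs ≤
      stepUpper p L₂ W P F D d xs k t := by
  rw [stepUpper_eq _ _ _ _ hP.L₂_pos.ne']
  have hβ := potScale_pos hn hp1 hp2 hP.L₂_pos
  refine add_le_add (mul_le_mul_of_nonneg_left ?_ (by positivity))
    (hd.bregman_mirror_le hW hz xs)
  have := descent_step hP (couple k t.1) t.2.1 (batchDeriv D (couple k t.1) t.2.2 t.2.1)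
  linarith

lemma measurable_stepUpper (hP : IsProblem P F g L L₂ σ) (hN : IsNoise P ζ η Δζ Δη)
    (hd : IsProxFunction p d) (hW : IsDualWeight p W) (xs : Vec n) (k : ℕ) :
    Measurable (stepUpper (m := m) p L₂ W P F (oracle g ζ η) d xs k) := by
  have hx : Measurable fun t : (Vec n × Vec n) × (Vec n × (Fin m → X)) => couple k t.1 :=
    (measurable_couple k).comp measurable_fst
  have hz : Measurable fun t : (Vec n × Vec n) × (Vec n × (Fin m → X)) => t.1.2 :=
    measurable_snd.comp measurable_fst
  have he : Measurable fun t : (Vec n × Vec n) × (Vec n × (Fin m → X)) => t.2.1 :=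
    measurable_fst.comp measurable_snd
  have hγ : Measurable fun t : (Vec n × Vec n) × (Vec n × (Fin m → X)) =>
      batchDeriv (oracle g ζ η) (couple k t.1) t.2.2 t.2.1 := by
    have h := (measurable_batchDeriv (m := m) hP hN).comp (hx.prodMk measurable_snd)
    simp only [Function.comp_def] at h
    exact h
  have hf : Measurable fun t : (Vec n × Vec n) × (Vec n × (Fin m → X)) =>
      objective P F (couple k t.1) := hP.continuous_objective.measurable.comp hx
  have hs : Measurable fun t : (Vec n × Vec n) × (Vec n × (Fin m → X)) =>
      gradient (objective P F) (couple k t.1) := hP.continuous_gradient.measurable.comp hx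
  have hV : Measurable fun t : (Vec n × Vec n) × (Vec n × (Fin m → X)) => bregman d t.1.2 xs :=
    (hd.measurable_bregman xs).comp hz
  have hψ : Measurable fun t : (Vec n × Vec n) × (Vec n × (Fin m → X)) =>
      stepWeight p L₂ W k t.2.1 := by
    unfold stepWeight
    exact ((he.norm.pow_const 2).const_mul _).add ((hW.continuous.measurable.comp he).const_mul _)
  unfold stepUpper
  exact ((((hf.sub_const _).const_mul _).add hV).sub (((hs.inner he).mul hγ).const_mul _)
    |>.sub ((((hz.sub_const xs).inner he).mul hγ).const_mul _)).add (hψ.mul (hγ.pow_const 2))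

lemma measurable_stepMean (hP : IsProblem P F g L L₂ σ) (hd : IsProxFunction p d) (xs : Vec n)
    (k : ℕ) : Measurable (stepMean p L₂ σ Δζ Δη m P F d xs k) := by
  unfold stepMean
  exact ((((hP.continuous_objective.measurable.comp measurable_fst).sub_const _).const_mul _).add
    ((hd.measurable_bregman xs).comp measurable_snd) |>.add
    ((measurable_snd.sub_const xs).norm.const_mul _)).add_const _

/-- From `(k + 2) x = 2 z + k y` follows `2 (z - x*) = 2 (x - x*) + k (x - y)`. Convexity at `x`,
used towards `x*` and towards `y`, then gives the claim. -/
lemma coupling_inequality (hP : IsProblem P F g L L₂ σ) (xs : Vec n) (k : ℕ) (t : Vec n × Vec n) :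
    ((k : ℝ) + 2) * (objective P F (couple k t) - objective P F xs) -
      k * (objective P F t.1 - objective P F xs) ≤
      2 * inner ℝ (gradient (objective P F) (couple k t)) (t.2 - xs) := by
  set x := couple k t with hx
  have hk : (0 : ℝ) < (k : ℝ) + 2 := by positivity
  have h1 := hP.add_inner_le x xs
  have h2 := hP.add_inner_le x t.1
  have h3 : (2 : ℝ) • (t.2 - xs) = - (2 : ℝ) • (xs - x) - (k : ℝ) • (t.1 - x) := by
    have : ((k : ℝ) + 2) • x = (2 : ℝ) • t.2 + (k : ℝ) • t.1 := by
      rw [hx, couple, tau, smul_add, smul_smul, smul_smul]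
      congr 2
      · field_simp
      · field_simp; ring
    have h4 : (2 : ℝ) • t.2 = ((k : ℝ) + 2) • x - (k : ℝ) • t.1 := by rw [this]; abel
    rw [smul_sub, h4]
    module
  rw [← real_inner_smul_right, h3, inner_sub_right, real_inner_smul_right, real_inner_smul_right]
  have h4 := mul_le_mul_of_nonneg_left h2 (Nat.cast_nonneg (α := ℝ) k)
  nlinarith

lemma isHyperoctahedral_stepWeight (hW : IsDualWeight p W) (k : ℕ) :
    IsHyperoctahedral (stepWeight p L₂ W k) := by
  constructor
  · intro i j x
    unfold stepWeight
    rw [hW.hyperoctahedral.swap, LinearIsometryEquiv.norm_map]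
  · intro i x
    unfold stepWeight
    rw [hW.hyperoctahedral.flip, LinearIsometryEquiv.norm_map]

lemma continuous_stepWeight (hW : IsDualWeight p W) (k : ℕ) :
    Continuous (stepWeight p L₂ W k) := by
  have := hW.continuous
  unfold stepWeight
  fun_prop

/-- In units of `(k + 2)² β`, the gradient step contributes `1 / (8 L₂)`. The mirror step
contributes `12 n² ρ_n β = 1 / (16 L₂)`, from `E W ≤ 6 ρ_n` and `α = 2 (k + 2) β`. -/
lemma integral_stepWeight_le (hn : 8 ≤ n) (hp1 : 1 ≤ p) (hp2 : p ≤ 2) (hL : 0 < L₂)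
    (hW : IsDualWeight p W) (k : ℕ) :
    ∫ e, stepWeight p L₂ W k e ∂uniformSphere n ≤
      3 / (16 * L₂) * (((k : ℝ) + 2) ^ 2 * potScale n p L₂) := by
  have hn' : n ≠ 0 := by omega
  have := isProbabilityMeasure_uniformSphere hn'
  have hρ := rho_pos hn hp1 hp2
  have hn0 : (0 : ℝ) < n := by exact_mod_cast (by omega : 0 < n)
  have h1 : ∫ e : Vec n, ‖e‖ ^ 2 ∂uniformSphere n = 1 := by
    rw [integral_congr_ae (g := fun _ => (1 : ℝ))]
    · simp
    · filter_upwards [ae_norm_eq_one_uniformSphere n] with e he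
      rw [he, one_pow]
  unfold stepWeight
  rw [integral_add ((integrable_uniformSphere hn' (by fun_prop)).const_mul _)
    ((integrable_uniformSphere hn' hW.continuous).const_mul _), integral_const_mul,
    integral_const_mul, h1]
  have h2 := mul_le_mul_of_nonneg_left hW.integral_le
    (by positivity : 0 ≤ 1 / 2 * (stepSize n p L₂ k * n) ^ 2)
  refine (add_le_add le_rfl h2).trans (le_of_eq ?_)
  rw [stepSize_eq, potScale]
  field_simp
  ring

lemma integral_stepUpper_le (hn : 8 ≤ n) (hm : 1 ≤ m) (hp1 : 1 ≤ p) (hp2 : p ≤ 2)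
    (hP : IsProblem P F g L L₂ σ) (hN : IsNoise P ζ η Δζ Δη) (hW : IsDualWeight p W) (xs : Vec n)
    (k : ℕ) (t : Vec n × Vec n) :
    Integrable (fun b => stepUpper p L₂ W P F (oracle g ζ η) d xs k (t, b))
      ((uniformSphere n).prod (Measure.pi fun _ : Fin m => P)) ∧
    ∫ b, stepUpper p L₂ W P F (oracle g ζ η) d xs k (t, b)
      ∂((uniformSphere n).prod (Measure.pi fun _ : Fin m => P)) ≤
      stepMean p L₂ σ Δζ Δη m P F d xs k t := by
  have hn' : n ≠ 0 := by omega
  have := isProbabilityMeasure_uniformSphere hn'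
  have hL := hP.L₂_pos
  have hβ := potScale_pos hn hp1 hp2 hL
  have hn0 : (0 : ℝ) < n := by exact_mod_cast (by omega : 0 < n)
  have hm0 : (0 : ℝ) < m := by exact_mod_cast hm
  have hψ0 : ∀ e, 0 ≤ stepWeight p L₂ W k e := fun e => by
    have := hW.nonneg e
    unfold stepWeight
    positivity
  have hα : stepSize n p L₂ k = 2 * ((k : ℝ) + 2) * potScale n p L₂ := stepSize_eq n p L₂ k
  have hα0 : 0 ≤ stepSize n p L₂ k := by rw [hα]; positivity
  have h := integral_step_le (m := m) hn' hm hP hN (couple k t) (t.2 - xs)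
    (continuous_stepWeight (L₂ := L₂) hW k) (isHyperoctahedral_stepWeight hW k) hψ0
    (c₀ := ((k : ℝ) + 2) ^ 2 * potScale n p L₂ * (objective P F (couple k t) - objective P F xs) +
      bregman d t.2 xs)
    (c₁ := ((k : ℝ) + 2) ^ 2 * potScale n p L₂ / (2 * L₂)) (c₂ := stepSize n p L₂ k * n)
    (by positivity) (by positivity)
  refine ⟨h.1, h.2.trans ?_⟩
  obtain ⟨e₀, he₀⟩ := (ae_norm_eq_one_uniformSphere n).exists
  have hΔ := hN.Δζ_nonneg he₀
  have hΨ := integral_stepWeight_le hn hp1 hp2 hL hW k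
  set s := gradient (objective P F) (couple k t)
  set Ψ := ∫ e, stepWeight p L₂ W k e ∂uniformSphere n
  set Q := 5 / 4 * Δζ + 5 * Δη ^ 2
  set β := potScale n p L₂
  have hQ : 0 ≤ Q := by positivity
  have hΨ2 : Ψ * (2 * ((‖s‖ ^ 2 + σ ^ 2 / m) / n) + 2 * Q) ≤
      3 / (16 * L₂) * (((k : ℝ) + 2) ^ 2 * β) * (2 * ((‖s‖ ^ 2 + σ ^ 2 / m) / n) + 2 * Q) :=
    mul_le_mul_of_nonneg_right hΨ (by positivity)
  have hc : ((k : ℝ) + 2) * β * (((k : ℝ) + 2) * (objective P F (couple k t) - objective P F xs) -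
      k * (objective P F t.1 - objective P F xs)) ≤
      ((k : ℝ) + 2) * β * (2 * inner ℝ s (t.2 - xs)) :=
    mul_le_mul_of_nonneg_left (coupling_inequality hP xs k t) (by positivity)
  have hsn : stepSize n p L₂ k * n * (inner ℝ s (t.2 - xs) / n -
      (√Δζ + Δη) * (‖t.2 - xs‖ / √n)) = ((k : ℝ) + 2) * β * (2 * inner ℝ s (t.2 - xs)) -
      stepSize n p L₂ k * √n * (√Δζ + Δη) * ‖t.2 - xs‖ := by
    have h1 : stepSize n p L₂ k * n * (inner ℝ s (t.2 - xs) / n) =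
        ((k : ℝ) + 2) * β * (2 * inner ℝ s (t.2 - xs)) := by
      rw [hα]; field_simp
    have h2 : stepSize n p L₂ k * n * ((√Δζ + Δη) * (‖t.2 - xs‖ / √n)) =
        stepSize n p L₂ k * √n * (√Δζ + Δη) * ‖t.2 - xs‖ := by
      have : (n : ℝ) / √n = √n := Real.div_sqrt
      calc _ = stepSize n p L₂ k * (n / √n) * (√Δζ + Δη) * ‖t.2 - xs‖ := by ring
        _ = _ := by rw [this]
    rw [mul_sub, h1, h2]
  rw [hsn]
  unfold stepMean
  -- The coefficients of `‖s‖² / n` agree, `(1/2)(3/4) = (3/16) 2`; this is what the constant `192`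
  -- in `β` is for. The coefficients of `Q` add up to `1/2 + 3/8 = 7/8`.
  have hfin : ((k : ℝ) + 2) ^ 2 * β / (2 * L₂) * (3 / 4 * (‖s‖ ^ 2 / n) - Q) =
      3 / (16 * L₂) * (((k : ℝ) + 2) ^ 2 * β) * (2 * ((‖s‖ ^ 2 + σ ^ 2 / m) / n) + 2 * Q) -
      ((k : ℝ) + 2) ^ 2 * β * (7 / (8 * L₂) * Q + 3 / (8 * L₂ * n) * (σ ^ 2 / m)) := by
    field_simp
    ring
  rw [hfin]
  change _ ≤ (k : ℝ) * (k + 2) * β * (objective P F t.1 - objective P F xs) + bregman d t.2 xs +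
    stepSize n p L₂ k * √n * (√Δζ + Δη) * ‖t.2 - xs‖ +
    ((k : ℝ) + 2) ^ 2 * β * (7 / (8 * L₂) * Q + 3 / (8 * L₂ * n) * (σ ^ 2 / m))
  linarith

end Step

/-! ### Solving the recursion for the potential. -/

section Recursion

/-- Let `r_k` be the base of the square in the bound, so that `√R_k ≤ r_k` by induction. Expanding
the square gives `r_{k+1}² ≥ r_k² + a_k r_k + h_k`; the half in front of the sum of the `a_j` is
what makes the cross term `a_k r_k` appear. -/
lemma le_sq_of_sqrt_recursion {R a h : ℕ → ℝ} {N : ℕ} (hR : ∀ k, 0 ≤ R k) (ha : ∀ k, 0 ≤ a k)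
    (hh : ∀ k, 0 ≤ h k) (hrec : ∀ k < N, R (k + 1) ≤ R k + a k * √(R k) + h k) :
    ∀ k ≤ N, R k ≤ (√(R 0 + ∑ j ∈ Finset.range k, h j) + (∑ j ∈ Finset.range k, a j) / 2) ^ 2 := by
  intro k
  induction k with
  | zero => intro _; simp [Real.sq_sqrt (hR 0)]
  | succ k ih =>
    intro hk
    have ihk := ih (by omega)
    rw [Finset.sum_range_succ, Finset.sum_range_succ]
    set A := R 0 + ∑ j ∈ Finset.range k, h j with hA
    set S := ∑ j ∈ Finset.range k, a j
    have hA0 : 0 ≤ A := add_nonneg (hR 0) (Finset.sum_nonneg fun j _ => hh j)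
    have hS0 : 0 ≤ S := Finset.sum_nonneg fun j _ => ha j
    have h1 : √(R k) ≤ √A + S / 2 := Real.sqrt_le_iff.mpr ⟨by positivity, ihk⟩
    have h2 : R (k + 1) ≤ (√A + S / 2) ^ 2 + a k * (√A + S / 2) + h k := by
      have := hrec k (by omega)
      have := mul_le_mul_of_nonneg_left h1 (ha k)
      linarith
    rw [← add_assoc, ← hA]
    have h3 : √A ≤ √(A + h k) := Real.sqrt_le_sqrt (by linarith [hh k])
    have h4 : √A ^ 2 = A := Real.sq_sqrt hA0
    have h5 : √(A + h k) ^ 2 = A + h k := Real.sq_sqrt (by linarith [hh k])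
    have h6 : 0 ≤ S + a k := add_nonneg hS0 (ha k)
    nlinarith [mul_le_mul_of_nonneg_right h3 h6, sq_nonneg (a k)]

lemma sum_range_add_two (N : ℕ) :
    ∑ k ∈ Finset.range N, ((k : ℝ) + 2) = N * (N + 3) / 2 := by
  induction N with
  | zero => simp
  | succ N ih => rw [Finset.sum_range_succ, ih]; push_cast; ring

lemma sum_range_add_two_sq_le (N : ℕ) :
    ∑ k ∈ Finset.range N, ((k : ℝ) + 2) ^ 2 ≤ N * ((N : ℝ) + 1) ^ 2 := by
  calc ∑ k ∈ Finset.range N, ((k : ℝ) + 2) ^ 2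
      ≤ ∑ _k ∈ Finset.range N, ((N : ℝ) + 1) ^ 2 := by
        refine Finset.sum_le_sum fun k hk => ?_
        have : (k : ℝ) + 1 ≤ N := by exact_mod_cast Finset.mem_range.mp hk
        have h0 : (0 : ℝ) ≤ k := Nat.cast_nonneg k
        exact pow_le_pow_left₀ (by positivity) (by linarith) 2
    _ = _ := by simp

/-- Division by `(N + 1)² β`, with `N + 3 ≤ 2 (N + 1)` for the bias term; the rest compares
constants. -/
lemma gap_le_of_weighted_gap_le {n N m ρ L₂ Θ Δζ Δη σ φ : ℝ} (hL : 0 < L₂) (hρ : 0 < ρ)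
    (hn0 : 0 < n) (hm0 : 0 < m) (hN0 : 1 ≤ N) (hΘ : 0 ≤ Θ) (hΔζ : 0 ≤ Δζ) (hΔη : 0 ≤ Δη)
    (hbound : (N + 1) ^ 2 * (1 / (192 * n ^ 2 * ρ * L₂)) * φ ≤
      2 * Θ + 2 * (N * (N + 1) ^ 2 * (1 / (192 * n ^ 2 * ρ * L₂) *
        (7 / (8 * L₂) * (5 / 4 * Δζ + 5 * Δη ^ 2) + 3 / (8 * L₂ * n) * (σ ^ 2 / m)))) +
      (1 / (192 * n ^ 2 * ρ * L₂)) ^ 2 * n * (√Δζ + Δη) ^ 2 * (N * (N + 3)) ^ 2) :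
    φ ≤ 384 * Θ * n ^ 2 * ρ * L₂ / N ^ 2
          + 4 * N / (n * L₂) * (σ ^ 2 / m)
          + 61 * N / (24 * L₂) * Δζ
          + 122 * N / (3 * L₂) * Δη ^ 2
          + 12 * √(2 * n * Θ) / N ^ 2 * (√Δζ / 2 + 2 * Δη)
          + N ^ 2 / (12 * n * ρ * L₂) * (√Δζ / 2 + 2 * Δη) ^ 2 := by
  set b := √Δζ + Δη with hb
  have hb0 : 0 ≤ b := add_nonneg (Real.sqrt_nonneg _) hΔη
  set ν := 7 / (8 * L₂) * (5 / 4 * Δζ + 5 * Δη ^ 2) + 3 / (8 * L₂ * n) * (σ ^ 2 / m) with hν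
  set β := 1 / (192 * n ^ 2 * ρ * L₂) with hβdef
  have hβ : 0 < β := by positivity
  have hNpos : (0 : ℝ) < N := by linarith
  have hφN : φ ≤ 2 * Θ / (β * N ^ 2) + 2 * N * ν + 4 * β * n * b ^ 2 * N ^ 2 := by
    have hM : 0 < (N + 1) ^ 2 * β := by positivity
    refine le_of_mul_le_mul_left (hbound.trans ?_) hM
    have t1 : 2 * Θ ≤ (N + 1) ^ 2 * β * (2 * Θ / (β * N ^ 2)) := by
      have : (N + 1) ^ 2 * β * (2 * Θ / (β * N ^ 2)) =
          2 * Θ * ((N + 1) ^ 2 / N ^ 2) := by field_simp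
      rw [this]
      refine le_mul_of_one_le_right (by positivity) ?_
      rw [one_le_div (by positivity)]
      exact pow_le_pow_left₀ hNpos.le (by linarith) 2
    have t2 : β ^ 2 * n * b ^ 2 * (N * (N + 3)) ^ 2 ≤
        (N + 1) ^ 2 * β * (4 * β * n * b ^ 2 * N ^ 2) := by
      have h1 : (N + 3) ^ 2 ≤ 4 * (N + 1) ^ 2 := by nlinarith
      have h2 := mul_le_mul_of_nonneg_left h1
        (by positivity : 0 ≤ β ^ 2 * n * b ^ 2 * N ^ 2)
      linarith
    linarith
  refine hφN.trans ?_
  have u1 : 2 * Θ / (β * N ^ 2) = 384 * Θ * n ^ 2 * ρ * L₂ / N ^ 2 := by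
    rw [hβdef]
    field_simp
    ring
  have u2 : 4 * β * n * b ^ 2 * N ^ 2 ≤
      N ^ 2 / (12 * n * ρ * L₂) * (√Δζ / 2 + 2 * Δη) ^ 2 := by
    have h1 : b ^ 2 ≤ 4 * (√Δζ / 2 + 2 * Δη) ^ 2 := by
      have : b ≤ 2 * (√Δζ / 2 + 2 * Δη) := by rw [hb]; linarith
      calc b ^ 2 ≤ (2 * (√Δζ / 2 + 2 * Δη)) ^ 2 := pow_le_pow_left₀ hb0 this 2
        _ = _ := by ring
    calc 4 * β * n * b ^ 2 * N ^ 2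
        ≤ 4 * β * n * (4 * (√Δζ / 2 + 2 * Δη) ^ 2) * N ^ 2 := by gcongr
      _ = _ := by
          rw [hβdef]
          field_simp
          ring
  have u3 : 2 * N * ν ≤ 4 * N / (n * L₂) * (σ ^ 2 / m) + 61 * N / (24 * L₂) * Δζ +
      122 * N / (3 * L₂) * Δη ^ 2 := by
    have e1 : 2 * N * ν = N / L₂ * (35 / 16 * Δζ) + N / L₂ * (35 / 4 * Δη ^ 2) +
        N / (n * L₂) * (σ ^ 2 / m) * (3 / 4) := by
      rw [hν]; field_simp; ring
    have e2 : 4 * N / (n * L₂) * (σ ^ 2 / m) + 61 * N / (24 * L₂) * Δζ +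
        122 * N / (3 * L₂) * Δη ^ 2 = N / L₂ * (61 / 24 * Δζ) +
        N / L₂ * (122 / 3 * Δη ^ 2) + N / (n * L₂) * (σ ^ 2 / m) * 4 := by
      field_simp; ring
    rw [e1, e2]
    refine add_le_add (add_le_add (mul_le_mul_of_nonneg_left ?_ (by positivity))
      (mul_le_mul_of_nonneg_left ?_ (by positivity)))
      (mul_le_mul_of_nonneg_left (by norm_num) (by positivity))
    · linarith
    · linarith [sq_nonneg Δη]
  -- The cross term between `Θ` and the bias has already been absorbed in the hypothesis, so this
  -- summand of the bound is slack and only its sign matters.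
  have u4 : 0 ≤ 12 * √(2 * n * Θ) / N ^ 2 * (√Δζ / 2 + 2 * Δη) := by positivity
  linarith

end Recursion

/-! ### One iteration as a function of the state and the input. -/

section RunEquations

variable {n N m : ℕ} {p L₂ : ℝ} {X Ω : Type*} {d : Vec n → ℝ} {x₀ : Vec n}
  {e : Fin N → Ω → Vec n} {ξ : Fin N → Fin m → Ω → X} {x y z : ℕ → Ω → Vec n}

lemma IsRun.couple_eq {D : Vec n → X → Vec n → ℝ} (hrun : IsRun p L₂ d D x₀ e ξ x y z)
    (k : Fin N) (ω : Ω) : x (k + 1) ω = couple k (y k ω, z k ω) :=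
  hrun.x_succ k ω

lemma IsRun.y_eq {D : Vec n → X → Vec n → ℝ} (hrun : IsRun p L₂ d D x₀ e ξ x y z)
    (k : Fin N) (ω : Ω) : y (k + 1) ω = couple k (y k ω, z k ω) - (1 / (2 * L₂)) •
      (batchDeriv D (couple k (y k ω, z k ω)) (ξ k · ω) (e k ω) • e k ω) := by
  rw [hrun.y_succ, hrun.couple_eq, gradEst_eq]

lemma IsRun.gradient_eq {D : Vec n → X → Vec n → ℝ} (hrun : IsRun p L₂ d D x₀ e ξ x y z)
    (hd : IsProxFunction p d) (k : Fin N) (ω : Ω) :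
    gradient d (z (k + 1) ω) = gradient d (z k ω) - (stepSize n p L₂ k * n) •
      (batchDeriv D (couple k (y k ω, z k ω)) (ξ k · ω) (e k ω) • e k ω) := by
  have h := hrun.z_succ k ω
  rw [hrun.couple_eq, gradEst_eq] at h
  exact hd.gradient_eq_of_isMinOn h

end RunEquations

/-! ### The convergence bound. -/

section Convergence

variable {n N m : ℕ} {p : ℝ} {X Ω : Type*} [MeasurableSpace X] [MeasurableSpace Ω]
  {P : Measure X} {μ : Measure Ω}
  {F : Vec n → X → ℝ} {g : Vec n → X → Vec n} {L : X → ℝ}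
  {ζ η : Vec n → X → Vec n → ℝ} {L₂ σ Δζ Δη : ℝ} {d : Vec n → ℝ} {x₀ xs : Vec n}
  {e : Fin N → Ω → Vec n} {ξ : Fin N → Fin m → Ω → X} {x y z : ℕ → Ω → Vec n}

lemma IsRun.indepFun (hP : IsProblem P F g L L₂ σ) (hN : IsNoise P ζ η Δζ Δη)
    (hp1 : 1 ≤ p) (hp2 : p ≤ 2) (hd : IsProxFunction p d) (hs : IsSampling P μ e ξ)
    (hrun : IsRun p L₂ d (oracle g ζ η) x₀ e ξ x y z) :
    (∀ k ≤ N, Measurable fun ω => (y k ω, z k ω)) ∧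
      ∀ k : Fin N, IndepFun (fun ω => (y k ω, z k ω)) (fun ω => (e k ω, fun i => ξ k i ω)) μ := by
  obtain ⟨J, hJ, hJd⟩ := hd.exists_continuous_inverse (by linarith) hp2
  refine indepFun_of_recursion (S := fun k ω => (y k ω, z k ω))
    (inp := fun k ω => (e k ω, fun i => ξ k i ω)) (a₀ := (x₀, x₀))
    -- The `z`-component is computed from the optimality condition, inverted by `J`, since the
    -- choice of a minimiser carries no measurability of its own.
    (Φ := fun k t => (couple k t.1 - (1 / (2 * L₂)) •
        (batchDeriv (oracle g ζ η) (couple k t.1) t.2.2 t.2.1 • t.2.1),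
      J (gradient d t.1.2 - (stepSize n p L₂ k * n) •
        (batchDeriv (oracle g ζ η) (couple k t.1) t.2.2 t.2.1 • t.2.1))))
    (fun k => (hs.measurable_e k).prodMk (measurable_pi_lambda _ fun i => hs.measurable_ξ k i))
    hs.indep (fun ω => by rw [hrun.y_zero, hrun.z_zero]) ?_ ?_
  · intro k
    have hx : Measurable fun t : (Vec n × Vec n) × (Vec n × (Fin m → X)) => couple k t.1 :=
      (measurable_couple k).comp measurable_fst
    have he : Measurable fun t : (Vec n × Vec n) × (Vec n × (Fin m → X)) => t.2.1 :=
      measurable_fst.comp measurable_snd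
    have hγ : Measurable fun t : (Vec n × Vec n) × (Vec n × (Fin m → X)) =>
        batchDeriv (oracle g ζ η) (couple k t.1) t.2.2 t.2.1 := by
      have h := (measurable_batchDeriv (m := m) hP hN).comp (hx.prodMk measurable_snd)
      simp only [Function.comp_def] at h
      exact h
    have hG := hγ.smul he
    have hz : Measurable fun t : (Vec n × Vec n) × (Vec n × (Fin m → X)) =>
        gradient d t.1.2 := (measurable_gradient d).comp (measurable_snd.comp measurable_fst)
    exact (hx.sub (hG.const_smul (1 / (2 * L₂)))).prodMk
      (hJ.measurable.comp (hz.sub (hG.const_smul (stepSize n p L₂ k * n))))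
  · intro k ω
    rw [hrun.y_eq, ← hrun.gradient_eq hd, hJd]

variable [IsProbabilityMeasure P] [IsProbabilityMeasure μ]

/-- The weight of the functional gap in the potential after `k` iterations. -/
def gapWeight (n : ℕ) (p L₂ : ℝ) (k : ℕ) : ℝ :=
  if k = 0 then 0 else ((k : ℝ) + 1) ^ 2 * potScale n p L₂

/-- Averages the one-iteration bound over the state, which is independent of the fresh input. Strong
convexity and Jensen turn the bias term into the square root of the expected divergence.
Integrability is passed on from step to step, as the iterates need not be bounded. -/
lemma IsRun.step (hn : 8 ≤ n) (hm : 1 ≤ m) (hp1 : 1 ≤ p) (hp2 : p ≤ 2)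
    (hP : IsProblem P F g L L₂ σ) (hN : IsNoise P ζ η Δζ Δη)
    (hxs : ∀ v, objective P F xs ≤ objective P F v) (hd : IsProxFunction p d)
    (hs : IsSampling P μ e ξ) (hrun : IsRun p L₂ d (oracle g ζ η) x₀ e ξ x y z) (k : Fin N)
    (hφ : Integrable (fun ω => objective P F (y k ω) - objective P F xs) μ)
    (hV : Integrable (fun ω => bregman d (z k ω) xs) μ) :
    Integrable (fun ω => objective P F (y (k + 1) ω) - objective P F xs) μ ∧
    Integrable (fun ω => bregman d (z (k + 1) ω) xs) μ ∧
    ((k : ℝ) + 2) ^ 2 * potScale n p L₂ *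
        (∫ ω, (objective P F (y (k + 1) ω) - objective P F xs) ∂μ) +
      ∫ ω, bregman d (z (k + 1) ω) xs ∂μ ≤
    (k : ℝ) * (k + 2) * potScale n p L₂ * (∫ ω, (objective P F (y k ω) - objective P F xs) ∂μ) +
      ∫ ω, bregman d (z k ω) xs ∂μ +
      stepSize n p L₂ k * √n * (√Δζ + Δη) * √(2 * ∫ ω, bregman d (z k ω) xs ∂μ) +
    ((k : ℝ) + 2) ^ 2 * potScale n p L₂ *
      (7 / (8 * L₂) * (5 / 4 * Δζ + 5 * Δη ^ 2) + 3 / (8 * L₂ * n) * (σ ^ 2 / m)) := by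
  have hp0 : 0 < p := by linarith
  have hn' : n ≠ 0 := by omega
  have := isProbabilityMeasure_uniformSphere hn'
  have hβ := potScale_pos hn hp1 hp2 hP.L₂_pos
  obtain ⟨W, hW⟩ := exists_isDualWeight hn hp1 hp2
  obtain ⟨hmeas, hind⟩ := hrun.indepFun hP hN hp1 hp2 hd hs
  have hSk := hmeas k k.2.le
  have hSk1 := hmeas (k + 1) k.2
  have hinp : Measurable fun ω => (e k ω, fun i => ξ k i ω) :=
    (hs.measurable_e k).prodMk (measurable_pi_lambda _ fun i => hs.measurable_ξ k i)
  have hwV : ∀ ω, ‖z k ω - xs‖ ^ 2 ≤ 2 * bregman d (z k ω) xs := fun ω => by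
    linarith [hd.half_norm_sq_le_bregman hp0 hp2 (z k ω) xs]
  have hwm : Measurable fun ω => ‖z k ω - xs‖ := ((measurable_snd.comp hSk).sub_const xs).norm
  have hw2 : Integrable (fun ω => ‖z k ω - xs‖ ^ 2) μ := by
    refine (hV.const_mul 2).mono' (hwm.pow_const 2).aestronglyMeasurable
      (Filter.Eventually.of_forall fun ω => ?_)
    rw [Real.norm_of_nonneg (sq_nonneg _)]
    exact hwV ω
  have hwL : MemLp (fun ω => ‖z k ω - xs‖) 2 μ :=
    (memLp_two_iff_integrable_sq hwm.aestronglyMeasurable).mpr hw2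
  have hw1 : Integrable (fun ω => ‖z k ω - xs‖) μ := hwL.integrable one_le_two
  have hwE : ∫ ω, ‖z k ω - xs‖ ∂μ ≤ √(2 * ∫ ω, bregman d (z k ω) xs ∂μ) := by
    refine Real.le_sqrt_of_sq_le ((sq_integral_le hwL).trans ?_)
    rw [← integral_const_mul]
    exact integral_mono hw2 (hV.const_mul 2) hwV
  have hK1 : Integrable (fun ω => (k : ℝ) * (k + 2) * potScale n p L₂ *
      (objective P F (y k ω) - objective P F xs) + bregman d (z k ω) xs) μ :=
    (hφ.const_mul _).add hV
  have hK2 : Integrable (fun ω => (k : ℝ) * (k + 2) * potScale n p L₂ *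
      (objective P F (y k ω) - objective P F xs) + bregman d (z k ω) xs +
      stepSize n p L₂ k * √n * (√Δζ + Δη) * ‖z k ω - xs‖) μ := hK1.add (hw1.const_mul _)
  have hK : Integrable (fun ω => stepMean p L₂ σ Δζ Δη m P F d xs k (y k ω, z k ω)) μ :=
    hK2.add (integrable_const _)
  have hKval : ∫ ω, stepMean p L₂ σ Δζ Δη m P F d xs k (y k ω, z k ω) ∂μ =
      (k : ℝ) * (k + 2) * potScale n p L₂ * (∫ ω, (objective P F (y k ω) - objective P F xs) ∂μ) +
      ∫ ω, bregman d (z k ω) xs ∂μ +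
      stepSize n p L₂ k * √n * (√Δζ + Δη) * (∫ ω, ‖z k ω - xs‖ ∂μ) +
      ((k : ℝ) + 2) ^ 2 * potScale n p L₂ *
      (7 / (8 * L₂) * (5 / 4 * Δζ + 5 * Δη ^ 2) + 3 / (8 * L₂ * n) * (σ ^ 2 / m)) := by
    unfold stepMean
    rw [integral_add hK2 (integrable_const _), integral_add hK1 (hw1.const_mul _),
      integral_add (hφ.const_mul _) hV, integral_const_mul, integral_const_mul]
    simp
  obtain ⟨hHint, hHle⟩ := integral_comp_indepFun_le hSk hinp (hind k) (hs.law k)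
    (measurable_stepUpper (m := m) hP hN hd hW xs k)
    (stepUpper_nonneg hn hp1 hp2 hP hd hW _ hxs k) (measurable_stepMean hP hd xs k)
    (integral_stepUpper_le hn hm hp1 hp2 hP hN hW xs k) hK
  have hpt : ∀ ω, ((k : ℝ) + 2) ^ 2 * potScale n p L₂ *
      (objective P F (y (k + 1) ω) - objective P F xs) + bregman d (z (k + 1) ω) xs ≤
      stepUpper p L₂ W P F (oracle g ζ η) d xs k
        ((y k ω, z k ω), (e k ω, fun i => ξ k i ω)) := by
    intro ω
    rw [hrun.y_eq]
    exact potential_le_stepUpper hn hp1 hp2 hP hd hW (oracle g ζ η) xs k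
      ((y k ω, z k ω), (e k ω, fun i => ξ k i ω)) (hrun.gradient_eq hd k ω)
  have hc : 0 < ((k : ℝ) + 2) ^ 2 * potScale n p L₂ := by positivity
  have hgap : ∀ ω, 0 ≤ objective P F (y (k + 1) ω) - objective P F xs := fun ω =>
    sub_nonneg.mpr (hxs _)
  have hV0 : ∀ ω, 0 ≤ bregman d (z (k + 1) ω) xs := fun ω =>
    le_trans (by positivity) (hd.half_norm_sq_le_bregman hp0 hp2 (z (k + 1) ω) xs)
  have hV1 : Integrable (fun ω => bregman d (z (k + 1) ω) xs) μ := by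
    refine hHint.mono' ((hd.measurable_bregman xs).comp
      (measurable_snd.comp hSk1)).aestronglyMeasurable (Filter.Eventually.of_forall fun ω => ?_)
    rw [Real.norm_of_nonneg (hV0 ω)]
    linarith [hpt ω, mul_nonneg hc.le (hgap ω)]
  have hφ1 : Integrable (fun ω => objective P F (y (k + 1) ω) - objective P F xs) μ := by
    refine (hHint.const_mul (((k : ℝ) + 2) ^ 2 * potScale n p L₂)⁻¹).mono'
      ((hP.continuous_objective.measurable.comp
        (measurable_fst.comp hSk1)).sub_const _).aestronglyMeasurable
      (Filter.Eventually.of_forall fun ω => ?_)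
    rw [Real.norm_of_nonneg (hgap ω), ← div_eq_inv_mul, le_div_iff₀ hc]
    linarith [hpt ω, hV0 ω]
  refine ⟨hφ1, hV1, ?_⟩
  have hlhs : ∫ ω, (((k : ℝ) + 2) ^ 2 * potScale n p L₂ *
      (objective P F (y (k + 1) ω) - objective P F xs) + bregman d (z (k + 1) ω) xs) ∂μ =
      ((k : ℝ) + 2) ^ 2 * potScale n p L₂ *
        (∫ ω, (objective P F (y (k + 1) ω) - objective P F xs) ∂μ) +
      ∫ ω, bregman d (z (k + 1) ω) xs ∂μ := by
    rw [integral_add (hφ1.const_mul _) hV1, integral_const_mul]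
  rw [← hlhs]
  refine (integral_mono ((hφ1.const_mul _).add hV1) hHint hpt).trans (hHle.trans ?_)
  rw [hKval]
  obtain ⟨e₀, he₀⟩ := (ae_norm_eq_one_uniformSphere n).exists
  have hb0 : 0 ≤ √Δζ + Δη := add_nonneg (Real.sqrt_nonneg _) (hN.Δη_nonneg he₀)
  have hα0 : 0 ≤ stepSize n p L₂ k := by rw [stepSize_eq]; positivity
  have := mul_le_mul_of_nonneg_left hwE
    (by positivity : 0 ≤ stepSize n p L₂ k * √n * (√Δζ + Δη))
  linarith

lemma IsRun.integrable (hn : 8 ≤ n) (hm : 1 ≤ m) (hp1 : 1 ≤ p) (hp2 : p ≤ 2)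
    (hP : IsProblem P F g L L₂ σ) (hN : IsNoise P ζ η Δζ Δη)
    (hxs : ∀ v, objective P F xs ≤ objective P F v) (hd : IsProxFunction p d)
    (hs : IsSampling P μ e ξ) (hrun : IsRun p L₂ d (oracle g ζ η) x₀ e ξ x y z) :
    ∀ k ≤ N, Integrable (fun ω => objective P F (y k ω) - objective P F xs) μ ∧
      Integrable (fun ω => bregman d (z k ω) xs) μ := by
  intro k
  induction k with
  | zero =>
    intro _
    simp only [hrun.y_zero, hrun.z_zero]
    exact ⟨integrable_const _, integrable_const _⟩
  | succ k ih =>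
    intro hk
    obtain ⟨h1, h2⟩ := ih (by omega)
    have h := hrun.step hn hm hp1 hp2 hP hN hxs hd hs ⟨k, hk⟩ h1 h2
    exact ⟨h.1, h.2.1⟩

theorem IsRun.gap_le (hn : 8 ≤ n) (hN1 : 1 ≤ N) (hm : 1 ≤ m) (hp1 : 1 ≤ p) (hp2 : p ≤ 2)
    (hP : IsProblem P F g L L₂ σ) (hN : IsNoise P ζ η Δζ Δη)
    (hxs : ∀ v, objective P F xs ≤ objective P F v) (hd : IsProxFunction p d)
    (hs : IsSampling P μ e ξ) (hrun : IsRun p L₂ d (oracle g ζ η) x₀ e ξ x y z) :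
    Integrable (fun ω => objective P F (y N ω)) μ ∧
      ∫ ω, objective P F (y N ω) ∂μ - objective P F xs ≤
        384 * bregman d x₀ xs * (n : ℝ) ^ 2 * rho n p * L₂ / (N : ℝ) ^ 2
          + 4 * (N : ℝ) / (n * L₂) * (σ ^ 2 / m)
          + 61 * (N : ℝ) / (24 * L₂) * Δζ
          + 122 * (N : ℝ) / (3 * L₂) * Δη ^ 2
          + 12 * √(2 * n * bregman d x₀ xs) / (N : ℝ) ^ 2 * (√Δζ / 2 + 2 * Δη)
          + (N : ℝ) ^ 2 / (12 * n * rho n p * L₂) * (√Δζ / 2 + 2 * Δη) ^ 2 := by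
  have hp0 : 0 < p := by linarith
  have hL := hP.L₂_pos
  have hρ := rho_pos hn hp1 hp2
  have hn0 : (0 : ℝ) < n := by exact_mod_cast (by omega : 0 < n)
  have hm0 : (0 : ℝ) < m := by exact_mod_cast hm
  have hN0 : (1 : ℝ) ≤ N := by exact_mod_cast hN1
  have hβ := potScale_pos hn hp1 hp2 hL
  have hprob := isProbabilityMeasure_uniformSphere (n := n) (by omega)
  obtain ⟨e₀, he₀⟩ := (ae_norm_eq_one_uniformSphere n).exists
  have hΔη := hN.Δη_nonneg he₀
  have hΔζ := hN.Δζ_nonneg he₀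
  have hint := hrun.integrable hn hm hp1 hp2 hP hN hxs hd hs
  have hV0 : ∀ v, 0 ≤ bregman d v xs := fun v =>
    le_trans (by positivity) (hd.half_norm_sq_le_bregman hp0 hp2 v xs)
  set β := potScale n p L₂ with hβdef
  set φ : ℕ → ℝ := fun k => ∫ ω, (objective P F (y k ω) - objective P F xs) ∂μ with hφ
  set V : ℕ → ℝ := fun k => ∫ ω, bregman d (z k ω) xs ∂μ with hV
  set b := √Δζ + Δη with hb
  set ν := 7 / (8 * L₂) * (5 / 4 * Δζ + 5 * Δη ^ 2) + 3 / (8 * L₂ * n) * (σ ^ 2 / m) with hν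
  have hb0 : 0 ≤ b := add_nonneg (Real.sqrt_nonneg _) hΔη
  have hν0 : 0 ≤ ν := by positivity
  have hφ0 : ∀ k, 0 ≤ φ k := fun k => integral_nonneg fun ω => sub_nonneg.mpr (hxs _)
  have hVk0 : ∀ k, 0 ≤ V k := fun k => integral_nonneg fun ω => hV0 _
  have hw0 : ∀ k, 0 ≤ gapWeight n p L₂ k := fun k => by
    unfold gapWeight
    split_ifs
    · exact le_rfl
    · positivity
  have hrec : ∀ k < N, (gapWeight n p L₂ (k + 1) * φ (k + 1) + V (k + 1)) ≤
      (gapWeight n p L₂ k * φ k + V k) +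
      (stepSize n p L₂ k * √n * b * √2) * √(gapWeight n p L₂ k * φ k + V k) +
      ((k : ℝ) + 2) ^ 2 * β * ν := by
    intro k hk
    have h := (hrun.step hn hm hp1 hp2 hP hN hxs hd hs ⟨k, hk⟩ (hint k hk.le).1 (hint k hk.le).2).2.2
    have hw1 : gapWeight n p L₂ (k + 1) = ((k : ℝ) + 2) ^ 2 * β := by
      rw [gapWeight, if_neg (Nat.succ_ne_zero k)]
      push_cast
      ring
    -- Here `k (k + 2) ≤ (k + 1)²`, while for `k = 0` both sides vanish. The potential therefore
    -- starts at `V[x₀](x*)`, without the initial gap `f(x₀) - f(x*)`.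
    have hw2 : (k : ℝ) * (k + 2) * β ≤ gapWeight n p L₂ k := by
      unfold gapWeight
      split_ifs with h0
      · simp [h0]
      · exact mul_le_mul_of_nonneg_right (by nlinarith) hβ.le
    have hα0 : 0 ≤ stepSize n p L₂ k := by rw [stepSize_eq]; positivity
    have hs1 : √(2 * V k) ≤ √2 * √(gapWeight n p L₂ k * φ k + V k) := by
      rw [Real.sqrt_mul zero_le_two]
      gcongr
      linarith [mul_nonneg (hw0 k) (hφ0 k)]
    have hs2 := mul_le_mul_of_nonneg_left hs1
      (by positivity : 0 ≤ stepSize n p L₂ k * √n * b)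
    have hs3 := mul_le_mul_of_nonneg_right hw2 (hφ0 k)
    rw [hw1]
    calc _ ≤ (k : ℝ) * (k + 2) * β * φ k + V k + stepSize n p L₂ k * √n * b * √(2 * V k) +
          ((k : ℝ) + 2) ^ 2 * β * ν := h
      _ ≤ _ := by linarith
  have hmain := le_sq_of_sqrt_recursion
    (R := fun k => gapWeight n p L₂ k * φ k + V k)
    (a := fun k => stepSize n p L₂ k * √n * b * √2)
    (h := fun k => ((k : ℝ) + 2) ^ 2 * β * ν) (N := N)
    (fun k => add_nonneg (mul_nonneg (hw0 k) (hφ0 k)) (hVk0 k))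
    (fun k => by
      have hα0 : 0 ≤ stepSize n p L₂ k := by rw [stepSize_eq]; positivity
      positivity) (fun k => by positivity) hrec N le_rfl
  have hR0 : gapWeight n p L₂ 0 * φ 0 + V 0 = bregman d x₀ xs := by
    simp [gapWeight, hV, hrun.z_zero]
  have hwN : gapWeight n p L₂ N = ((N : ℝ) + 1) ^ 2 * β := by
    rw [gapWeight, if_neg (by omega)]
  have hsa : ∑ k ∈ Finset.range N, stepSize n p L₂ k * √n * b * √2 =
      β * √n * b * √2 * (N * (N + 3)) := by
    have : ∀ k ∈ Finset.range N, stepSize n p L₂ k * √n * b * √2 =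
        2 * β * √n * b * √2 * ((k : ℝ) + 2) := fun k _ => by rw [stepSize_eq]; ring
    rw [Finset.sum_congr rfl this, ← Finset.mul_sum, sum_range_add_two]
    ring
  have hsh : ∑ k ∈ Finset.range N, ((k : ℝ) + 2) ^ 2 * β * ν ≤ N * ((N : ℝ) + 1) ^ 2 * (β * ν) := by
    have : ∀ k ∈ Finset.range N, ((k : ℝ) + 2) ^ 2 * β * ν = ((k : ℝ) + 2) ^ 2 * (β * ν) :=
      fun k _ => by ring
    rw [Finset.sum_congr rfl this, ← Finset.sum_mul]
    exact mul_le_mul_of_nonneg_right (sum_range_add_two_sq_le N) (by positivity)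
  simp only [hR0, hwN, hsa] at hmain
  set Θ := bregman d x₀ xs
  have hΘ : 0 ≤ Θ := hV0 x₀
  set H := ∑ k ∈ Finset.range N, ((k : ℝ) + 2) ^ 2 * β * ν
  have hH0 : 0 ≤ H := Finset.sum_nonneg fun k _ => by positivity
  have hbound : ((N : ℝ) + 1) ^ 2 * β * φ N ≤
      2 * Θ + 2 * (N * ((N : ℝ) + 1) ^ 2 * (β * ν)) + β ^ 2 * n * b ^ 2 * (N * (N + 3)) ^ 2 := by
    have h1 : √(Θ + H) ^ 2 = Θ + H := Real.sq_sqrt (by positivity)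
    have h2 : (β * √n * b * √2 * (N * (N + 3))) ^ 2 =
        2 * (β ^ 2 * n * b ^ 2 * (N * (N + 3)) ^ 2) := by
      rw [mul_pow, mul_pow, mul_pow, mul_pow, Real.sq_sqrt hn0.le, Real.sq_sqrt zero_le_two]
      ring
    -- This separates `Θ` from the bias at the price of a factor 2, the source of `384 = 2 · 192`.
    have h3 : ∀ r q : ℝ, (r + q / 2) ^ 2 ≤ 2 * r ^ 2 + q ^ 2 / 2 := fun r q => by
      linarith [sq_nonneg (r - q / 2)]
    have h4 := hmain.trans (h3 _ _)
    rw [h1, h2] at h4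
    linarith [hVk0 N]
  have hfint : Integrable (fun ω => objective P F (y N ω)) μ :=
    ((hint N le_rfl).1.add (integrable_const (objective P F xs))).congr
      (Filter.Eventually.of_forall fun ω => sub_add_cancel _ _)
  have hinteg : ∫ ω, objective P F (y N ω) ∂μ - objective P F xs = φ N := by
    rw [hφ]
    simp only
    rw [integral_sub hfint (integrable_const _)]
    simp
  refine ⟨hfint, ?_⟩
  rw [hinteg]
  exact gap_le_of_weighted_gap_le hL hρ hn0 hm0 hN0 hΘ hΔζ hΔη hbound

end Convergence

/-! ### The scalar two-point inequality. -/

section TwoPoint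

/-- The derivative of the difference is nonnegative by the arithmetic–geometric mean inequality,
because `(1 + r)^{s-1} (1 - r)^{s-1} = (1 - r²)^{s-1} ≥ 1`. -/
lemma two_mul_le_rpow_sub_rpow {s r : ℝ} (hs : 0 < s) (hs1 : s ≤ 1) (hr : r ∈ Set.Icc (0 : ℝ) 1) :
    2 * s * r ≤ (1 + r) ^ s - (1 - r) ^ s := by
  have hmono : MonotoneOn (fun r : ℝ => (1 + r) ^ s - (1 - r) ^ s - 2 * s * r)
      (Set.Icc 0 1) := by
    have hd : ∀ r ∈ Set.Ioo (0 : ℝ) 1, HasDerivAt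
        (fun r : ℝ => (1 + r) ^ s - (1 - r) ^ s - 2 * s * r)
        (s * (1 + r) ^ (s - 1) + s * (1 - r) ^ (s - 1) - 2 * s) r := by
      intro r hr
      have h1 := (((hasDerivAt_id r).const_add 1).rpow_const (p := s)
        (Or.inl (by simp only [id]; linarith [hr.1])))
      have h2 := (((hasDerivAt_id r).const_sub 1).rpow_const (p := s)
        (Or.inl (by simp only [id]; linarith [hr.2])))
      refine ((h1.sub h2).sub ((hasDerivAt_id r).const_mul (2 * s))).congr_deriv ?_
      simp only [id]
      ring
    refine monotoneOn_of_deriv_nonneg (convex_Icc 0 1) ?_ ?_ ?_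
    · refine ContinuousOn.sub (ContinuousOn.sub ?_ ?_) (by fun_prop)
      · exact ContinuousOn.rpow_const (by fun_prop) fun _ _ => Or.inr hs.le
      · exact ContinuousOn.rpow_const (by fun_prop) fun _ _ => Or.inr hs.le
    · rw [interior_Icc]
      exact fun r hr => (hd r hr).differentiableAt.differentiableWithinAt
    · rw [interior_Icc]
      intro r hr
      rw [(hd r hr).deriv]
      have hp : 0 < 1 + r := by linarith [hr.1]
      have hm : 0 < 1 - r := by linarith [hr.2]
      have hA := Real.rpow_pos_of_pos hp (s - 1)
      have hB := Real.rpow_pos_of_pos hm (s - 1)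
      have hAB : 1 ≤ (1 + r) ^ (s - 1) * (1 - r) ^ (s - 1) := by
        rw [← Real.mul_rpow hp.le hm.le]
        refine Real.one_le_rpow_of_pos_of_le_one_of_nonpos (by positivity) ?_ (by linarith)
        nlinarith [hr.1]
      have : 2 ≤ (1 + r) ^ (s - 1) + (1 - r) ^ (s - 1) := by
        nlinarith [sq_nonneg ((1 + r) ^ (s - 1) - (1 - r) ^ (s - 1))]
      nlinarith
  have h := hmono (Set.left_mem_Icc.mpr zero_le_one) hr hr.1
  simp only [add_zero, sub_zero, Real.one_rpow, mul_zero, sub_self] at h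
  linarith

/-- The derivative of the difference is `p` times the previous inequality for `s = p - 1`. -/
lemma two_add_le_rpow_add_rpow {p r : ℝ} (hp : 1 < p) (hp2 : p ≤ 2)
    (hr : r ∈ Set.Icc (0 : ℝ) 1) :
    2 + p * (p - 1) * r ^ 2 ≤ (1 + r) ^ p + (1 - r) ^ p := by
  have hmono : MonotoneOn (fun r : ℝ => (1 + r) ^ p + (1 - r) ^ p - p * (p - 1) * r ^ 2)
      (Set.Icc 0 1) := by
    have hd : ∀ r : ℝ, HasDerivAt
        (fun r : ℝ => (1 + r) ^ p + (1 - r) ^ p - p * (p - 1) * r ^ 2)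
        (p * ((1 + r) ^ (p - 1) - (1 - r) ^ (p - 1) - 2 * (p - 1) * r)) r := by
      intro r
      have h1 := ((hasDerivAt_id r).const_add 1).rpow_const (p := p) (Or.inr hp.le)
      have h2 := ((hasDerivAt_id r).const_sub 1).rpow_const (p := p) (Or.inr hp.le)
      refine ((h1.add h2).sub (((hasDerivAt_id r).pow 2).const_mul (p * (p - 1)))).congr_deriv ?_
      simp only [id, Nat.cast_ofNat, Nat.add_one_sub_one, pow_one]
      ring
    refine monotoneOn_of_deriv_nonneg (convex_Icc 0 1)
      (fun r _ => (hd r).continuousAt.continuousWithinAt)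
      (fun r _ => (hd r).differentiableAt.differentiableWithinAt) ?_
    rw [interior_Icc]
    intro r hr
    rw [(hd r).deriv]
    have := two_mul_le_rpow_sub_rpow (s := p - 1) (by linarith) (by linarith)
      (Set.Ioo_subset_Icc_self hr)
    exact mul_nonneg (by linarith) (by linarith)
  have h := hmono (Set.left_mem_Icc.mpr zero_le_one) hr hr.1
  simp only [add_zero, sub_zero, Real.one_rpow] at h
  linarith

/-- By homogeneity only `r = b / a` matters; Bernoulli's inequality for the exponent `p / 2 ≤ 1`
reduces the claim to the previous lemma. -/
lemma two_point_of_le {p a b : ℝ} (hp : 1 < p) (hp2 : p ≤ 2) (hb : 0 ≤ b) (hab : b ≤ a) :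
    2 * (a ^ 2 + (p - 1) * b ^ 2) ^ (p / 2) ≤ (a + b) ^ p + (a - b) ^ p := by
  have ha : 0 ≤ a := hb.trans hab
  rcases ha.eq_or_lt with h0 | h0
  · have hb0 : b = 0 := le_antisymm (hab.trans h0.ge) hb
    rw [hb0, ← h0]
    rw [show (0 : ℝ) ^ 2 + (p - 1) * 0 ^ 2 = 0 by ring, add_zero, sub_zero,
      Real.zero_rpow (by linarith), Real.zero_rpow (by linarith)]
    norm_num
  set r := b / a with hr
  have hrI : r ∈ Set.Icc (0 : ℝ) 1 := ⟨by positivity, (div_le_one h0).mpr hab⟩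
  have hbr : b = a * r := by rw [hr]; field_simp
  have h1 := two_add_le_rpow_add_rpow hp hp2 hrI
  have h2 := rpow_one_add_le_one_add_mul_self (s := (p - 1) * r ^ 2)
    (by nlinarith [sq_nonneg r]) (p := p / 2) (by linarith) (by linarith)
  have e1 : a ^ 2 + (p - 1) * b ^ 2 = a ^ 2 * (1 + (p - 1) * r ^ 2) := by rw [hbr]; ring
  have e2 : a + b = a * (1 + r) := by rw [hbr]; ring
  have e3 : a - b = a * (1 - r) := by rw [hbr]; ring
  have e4 : (a ^ 2) ^ (p / 2) = a ^ p := by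
    rw [← Real.rpow_natCast, ← Real.rpow_mul ha]
    congr 1
    push_cast
    ring
  rw [e1, e2, e3, Real.mul_rpow (by positivity) (by nlinarith [sq_nonneg r]), e4,
    Real.mul_rpow ha (by linarith [hrI.1]), Real.mul_rpow ha (by linarith [hrI.2]), ← mul_add]
  have hap : 0 ≤ a ^ p := Real.rpow_nonneg ha p
  nlinarith

/-- The right side depends only on `|a|` and `|b|` and is symmetric in them. Since `p - 1 ≤ 1`,
putting the larger one in the first place can only increase the left side. -/
lemma two_point {p : ℝ} (hp : 1 < p) (hp2 : p ≤ 2) (a b : ℝ) :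
    2 * (a ^ 2 + (p - 1) * b ^ 2) ^ (p / 2) ≤ |a + b| ^ p + |a - b| ^ p := by
  have habs : |a + b| ^ p + |a - b| ^ p = (|a| + |b|) ^ p + |(|a| - |b|)| ^ p := by
    rcases le_total 0 a with ha | ha <;> rcases le_total 0 b with hb | hb
    · rw [abs_of_nonneg ha, abs_of_nonneg hb, abs_of_nonneg (add_nonneg ha hb)]
    · rw [abs_of_nonneg ha, abs_of_nonpos hb, ← sub_eq_add_neg,
        abs_of_nonneg (show 0 ≤ a - b by linarith), sub_neg_eq_add, add_comm]
    · rw [abs_of_nonpos ha, abs_of_nonneg hb, abs_of_nonpos (show a - b ≤ 0 by linarith),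
        show -a - b = -(a + b) by ring, abs_neg, add_comm]
      congr 2
      ring
    · rw [abs_of_nonpos ha, abs_of_nonpos hb, abs_of_nonpos (add_nonpos ha hb),
        show -a - -b = -(a - b) by ring, abs_neg]
      congr 2
      ring
  rw [habs, ← sq_abs a, ← sq_abs b]
  rcases le_total |b| |a| with h | h
  · rw [abs_of_nonneg (sub_nonneg.mpr h)]
    exact two_point_of_le hp hp2 (abs_nonneg b) h
  · rw [abs_sub_comm, abs_of_nonneg (sub_nonneg.mpr h), add_comm |a|]
    refine le_trans ?_ (two_point_of_le hp hp2 (abs_nonneg a) h)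
    have h2 : |a| ^ 2 ≤ |b| ^ 2 := pow_le_pow_left₀ (abs_nonneg a) h 2
    have h3 : |a| ^ 2 + (p - 1) * |b| ^ 2 ≤ |b| ^ 2 + (p - 1) * |a| ^ 2 := by nlinarith
    have h4 : 0 ≤ |a| ^ 2 + (p - 1) * |b| ^ 2 :=
      add_nonneg (sq_nonneg _) (mul_nonneg (by linarith) (sq_nonneg _))
    gcongr

end TwoPoint

/-! ### Uniform convexity of `ℓ_p` and the standard prox-functions. -/

section StrongConvexity

variable {n : ℕ}

/-- Minkowski's inequality in the plane with the `ℓ_r` norm, for the vectors `(f i, g i)`. -/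
lemma rpow_sum_add_rpow_sum_le {ι : Type*} (S : Finset ι) {r : ℝ} (hr : 1 ≤ r) {f g : ι → ℝ}
    (hf : ∀ i, 0 ≤ f i) (hg : ∀ i, 0 ≤ g i) :
    ((∑ i ∈ S, f i) ^ r + (∑ i ∈ S, g i) ^ r) ^ (1 / r) ≤
      ∑ i ∈ S, (f i ^ r + g i ^ r) ^ (1 / r) := by
  classical
  induction S using Finset.induction_on with
  | empty =>
    have : r ≠ 0 := by linarith
    simp [Real.zero_rpow this, Real.zero_rpow (inv_ne_zero this)]
  | insert a S ha ih =>
    rw [Finset.sum_insert ha, Finset.sum_insert ha, Finset.sum_insert ha]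
    have hF : 0 ≤ ∑ i ∈ S, f i := Finset.sum_nonneg fun i _ => hf i
    have hG : 0 ≤ ∑ i ∈ S, g i := Finset.sum_nonneg fun i _ => hg i
    have h := Real.Lp_add_le_of_nonneg (s := (Finset.univ : Finset (Fin 2)))
      (f := ![f a, g a]) (g := ![∑ i ∈ S, f i, ∑ i ∈ S, g i]) hr
      (fun i _ => by fin_cases i <;> simp [hf, hg])
      (fun i _ => by fin_cases i <;> simp [hF, hG])
    simp only [Fin.sum_univ_two, Matrix.cons_val_zero, Matrix.cons_val_one] at h
    linarith

/-- Minkowski with exponent `2 / p` bounds `(‖x‖² + (p - 1) ‖y‖²)^{p/2}` by `∑ (x_i² + (p - 1)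
y_i²)^{p/2}`, and the two-point inequality bounds each summand. Convexity of `t ↦ t^{2/p}` then
passes from `p`-th powers of the norms to squares. -/
lemma two_mul_pNorm_sq_add_le {p : ℝ} (hp : 1 < p) (hp2 : p ≤ 2) (x y : Vec n) :
    2 * pNorm p x ^ 2 + 2 * ((p - 1) * pNorm p y ^ 2) ≤
      pNorm p (x + y) ^ 2 + pNorm p (x - y) ^ 2 := by
  have hp0 : 0 < p := by linarith
  have hr : 1 ≤ 2 / p := by rw [one_le_div hp0]; exact hp2
  have hpow : ∀ v : Vec n, (pNorm p v ^ p) ^ (2 / p) = pNorm p v ^ 2 := fun v => by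
    rw [← Real.rpow_mul (pNorm_nonneg p v), mul_div_cancel₀ _ hp0.ne']
    exact_mod_cast Real.rpow_natCast _ 2
  have hcoord : ∀ t : ℝ, (|t| ^ p) ^ (2 / p) = t ^ 2 := fun t => by
    rw [← Real.rpow_mul (abs_nonneg t), mul_div_cancel₀ _ hp0.ne', ← sq_abs]
    exact_mod_cast Real.rpow_natCast _ 2
  have hc0 : 0 ≤ p - 1 := by linarith
  have hM := rpow_sum_add_rpow_sum_le Finset.univ hr (f := fun i => |x i| ^ p)
    (g := fun i => (p - 1) ^ (p / 2) * |y i| ^ p)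
    (fun i => by positivity) (fun i => by positivity)
  have hcc : ((p - 1) ^ (p / 2)) ^ (2 / p) = p - 1 := by
    rw [← Real.rpow_mul hc0, div_mul_div_cancel₀ (by norm_num), div_self hp0.ne', Real.rpow_one]
  have e1 : ∀ i, ((p - 1) ^ (p / 2) * |y i| ^ p) ^ (2 / p) = (p - 1) * y i ^ 2 := fun i => by
    rw [Real.mul_rpow (by positivity) (by positivity), hcc, hcoord]
  simp_rw [e1, hcoord] at hM
  rw [← Finset.mul_sum, ← pNorm_rpow hp0, ← pNorm_rpow hp0,
    Real.mul_rpow (by positivity) (Real.rpow_nonneg (pNorm_nonneg p y) p), hcc, hpow, hpow,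
    one_div_div] at hM
  have hS : 2 * ∑ i, (x i ^ 2 + (p - 1) * y i ^ 2) ^ (p / 2) ≤
      pNorm p (x + y) ^ p + pNorm p (x - y) ^ p := by
    rw [pNorm_rpow hp0, pNorm_rpow hp0, ← Finset.sum_add_distrib, Finset.mul_sum]
    exact Finset.sum_le_sum fun i _ => two_point hp hp2 (x i) (y i)
  set A := pNorm p (x + y) with hA
  set B := pNorm p (x - y) with hB
  have hA0 : 0 ≤ A := pNorm_nonneg p _
  have hB0 : 0 ≤ B := pNorm_nonneg p _
  have hmean := (convexOn_rpow hr).2 (Set.mem_Ici.mpr (Real.rpow_nonneg hA0 p))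
    (Set.mem_Ici.mpr (Real.rpow_nonneg hB0 p)) (show (0 : ℝ) ≤ 1 / 2 by norm_num)
    (show (0 : ℝ) ≤ 1 / 2 by norm_num) (by norm_num)
  simp only [smul_eq_mul] at hmean
  rw [hA, hB, hpow, hpow, ← hA, ← hB] at hmean
  have hT0 : 0 ≤ pNorm p x ^ 2 + (p - 1) * pNorm p y ^ 2 := by positivity
  have hle : (pNorm p x ^ 2 + (p - 1) * pNorm p y ^ 2) ^ (p / 2) ≤
      1 / 2 * A ^ p + 1 / 2 * B ^ p := by linarith
  have h3 := Real.rpow_le_rpow (by positivity) hle (by positivity : 0 ≤ 2 / p)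
  rw [← Real.rpow_mul hT0, div_mul_div_cancel₀ (by norm_num), div_self hp0.ne',
    Real.rpow_one] at h3
  linarith

lemma differentiable_pNorm_sq {p : ℝ} (hp : 1 < p) (hp2 : p ≤ 2) :
    Differentiable ℝ fun x : Vec n => pNorm p x ^ 2 := by
  have hp0 : 0 < p := by linarith
  have h1 : (fun x : Vec n => pNorm p x ^ 2) = fun x => (∑ i, ‖x i‖ ^ p) ^ (2 / p) := by
    ext x
    rw [pNorm, ← Real.rpow_natCast, ← Real.rpow_mul (sum_abs_rpow_nonneg p x)]
    simp only [Real.norm_eq_abs]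
    congr 1
    push_cast
    ring
  rw [h1]
  refine Differentiable.rpow_const ?_ fun x => Or.inr (by rw [one_le_div hp0]; exact hp2)
  refine Differentiable.fun_sum fun i _ => ?_
  exact ((contDiff_norm_rpow (E := ℝ) hp).differentiable one_ne_zero).comp
    (by fun_prop : Differentiable ℝ fun x : Vec n => x i)

/-- The difference quotient of `f` minus `t M(v)` does not increase when `t` is halved; its limit
along `t = 2^{-k}` is the derivative. -/
lemma add_inner_add_le_of_midpoint {f M : Vec n → ℝ} (hf : Differentiable ℝ f)
    (hM : ∀ (t : ℝ) (v : Vec n), M (t • v) = t ^ 2 * M v)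
    (h : ∀ x v, 2 * f x + 2 * M v ≤ f (x + v) + f (x - v)) (x v : Vec n) :
    M v ≤ f (x + v) - f x - inner ℝ (gradient f x) v := by
  set q : ℝ → ℝ := fun t => (f (x + t • v) - f x) / t - t * M v with hq
  have hstep : ∀ t : ℝ, 0 < t → q (t / 2) ≤ q t := by
    intro t ht
    have h1 := h (x + (t / 2) • v) ((t / 2) • v)
    have e1 : x + (t / 2) • v + (t / 2) • v = x + t • v := by module
    rw [e1, add_sub_cancel_right, hM] at h1
    simp only [hq]
    have h2 : (f (x + (t / 2) • v) - f x) / (t / 2) = 2 * (f (x + (t / 2) • v) - f x) / t := by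
      field_simp
    have h3 : (f (x + t • v) - f x) / t - 2 * (f (x + (t / 2) • v) - f x) / t ≥ t / 2 * M v := by
      rw [← sub_div, ge_iff_le, le_div_iff₀ ht]
      linarith
    rw [h2]
    linarith
  have hk : ∀ k : ℕ, q ((1 / 2) ^ k) ≤ q 1 := by
    intro k
    induction k with
    | zero => simp
    | succ k ih =>
      refine le_trans ?_ ih
      have := hstep ((1 / 2) ^ k) (by positivity)
      rwa [pow_succ, mul_one_div]
  have hder : HasDerivAt (fun t : ℝ => f (x + t • v)) (inner ℝ (gradient f x) v) 0 :=
    hasDerivAt_comp_line (by simpa using (hf x).hasGradientAt)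
  have ht : Filter.Tendsto (fun k : ℕ => ((1 : ℝ) / 2) ^ k) Filter.atTop (nhdsWithin 0 {0}ᶜ) := by
    refine tendsto_nhdsWithin_iff.mpr
      ⟨tendsto_pow_atTop_nhds_zero_of_lt_one (by norm_num) (by norm_num),
        Filter.Eventually.of_forall fun k => ?_⟩
    simp
  have hlim : Filter.Tendsto (fun k : ℕ => q ((1 / 2) ^ k)) Filter.atTop
      (nhds (inner ℝ (gradient f x) v - 0 * M v)) := by
    refine Filter.Tendsto.sub ?_ ((tendsto_nhds_of_tendsto_nhdsWithin ht).mul_const _)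
    have := (hasDerivAt_iff_tendsto_slope.mp hder).comp ht
    refine this.congr fun k => ?_
    simp [slope, div_eq_inv_mul]
  have := le_of_tendsto hlim (Filter.Eventually.of_forall hk)
  simp only [hq, one_smul, div_one, one_mul, zero_mul, sub_zero] at this
  linarith

lemma pNorm_smul {p : ℝ} (hp : 0 < p) (t : ℝ) (v : Vec n) : pNorm p (t • v) = |t| * pNorm p v := by
  unfold pNorm
  simp only [PiLp.smul_apply, smul_eq_mul, abs_mul]
  simp_rw [Real.mul_rpow (abs_nonneg t) (abs_nonneg (v _))]
  rw [← Finset.mul_sum, Real.mul_rpow (Real.rpow_nonneg (abs_nonneg t) p) (sum_abs_rpow_nonneg p v),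
    ← Real.rpow_mul (abs_nonneg t), mul_one_div_cancel hp.ne', Real.rpow_one]

lemma isProxFunction_of_midpoint {p : ℝ} (hp : 0 < p) {d : Vec n → ℝ} (hd : Differentiable ℝ d)
    (h : ∀ x v, 2 * d x + pNorm p v ^ 2 ≤ d (x + v) + d (x - v)) : IsProxFunction p d where
  differentiable := hd
  strongly_convex x y := by
    have := add_inner_add_le_of_midpoint (M := fun v => 1 / 2 * pNorm p v ^ 2) hd
      (fun t v => by rw [pNorm_smul hp, mul_pow, sq_abs]; ring)
      (fun x v => by linarith [h x v]) x (y - x)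
    rwa [add_sub_cancel] at this

lemma kappa_mem {n : ℕ} (hn : 8 ≤ n) : 1 < kappa n ∧ kappa n ≤ 2 := by
  have := two_le_log hn
  unfold kappa
  constructor
  · have : 0 < 1 / Real.log n := by positivity
    linarith
  · have : 1 / Real.log n ≤ 1 := by rw [div_le_one (by linarith)]; linarith
    linarith

lemma rpow_kappa_sub_one {n : ℕ} (hn : 8 ≤ n) : (n : ℝ) ^ (kappa n - 1) = Real.exp 1 := by
  have hlog := two_le_log hn
  have hn0 : (0 : ℝ) < n := by exact_mod_cast (by omega : 0 < n)
  rw [Real.rpow_def_of_pos hn0, kappa, add_sub_cancel_left, mul_one_div_cancel (by linarith)]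

/-- For `p = 1`, `n^{κ-1} = e` turns the constant of `d` into `(n^{1 - 1/κ})² ln n / 2`. Uniform
convexity of `ℓ_κ` supplies the factor `κ - 1 = 1 / ln n`, which cancels the logarithm, and `‖v‖₁ ≤
n^{1 - 1/κ} ‖v‖_κ` does the rest. For `p = 2` it is the parallelogram law. -/
theorem isProxFunction_stdProx {p : ℝ} (hn : 8 ≤ n) (hp : p = 1 ∨ p = 2) :
    IsProxFunction (n := n) p (stdProx n p) := by
  rcases hp with rfl | rfl
  · have hlog := two_le_log hn
    have hn0 : (0 : ℝ) < n := by exact_mod_cast (by omega : 0 < n)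
    obtain ⟨hκ1, hκ2⟩ := kappa_mem hn
    have hκ0 : 0 < kappa n := by linarith
    have hexp : Real.exp 1 * (n : ℝ) ^ ((kappa n - 1) * (2 - kappa n) / kappa n) =
        ((n : ℝ) ^ (1 / 1 - 1 / kappa n)) ^ 2 := by
      rw [← rpow_kappa_sub_one hn, ← Real.rpow_add hn0, ← Real.rpow_natCast, ← Real.rpow_mul hn0.le]
      congr 1
      push_cast
      field_simp
      ring
    have hstd : ∀ x : Vec n, stdProx n 1 x =
        ((n : ℝ) ^ (1 / 1 - 1 / kappa n)) ^ 2 * Real.log n / 2 * pNorm (kappa n) x ^ 2 := by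
      intro x
      rw [stdProx, if_pos rfl, hexp]
    refine isProxFunction_of_midpoint one_pos ?_ fun x v => ?_
    · rw [show stdProx n 1 = _ from funext hstd]
      exact (differentiable_pNorm_sq hκ1 hκ2).const_mul _
    · rw [hstd, hstd, hstd]
      set K := ((n : ℝ) ^ (1 / 1 - 1 / kappa n)) ^ 2
      have hK : 0 ≤ K * Real.log n / 2 := by positivity
      have h1 := mul_le_mul_of_nonneg_left (two_mul_pNorm_sq_add_le hκ1 hκ2 x v) hK
      have h2 : pNorm 1 v ^ 2 ≤ K * pNorm (kappa n) v ^ 2 := by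
        rw [← mul_pow]
        exact pow_le_pow_left₀ (pNorm_nonneg 1 v)
          (pNorm_le_rpow_mul_pNorm one_pos hκ1.le v) 2
      have h3 : K * Real.log n / 2 * (2 * ((kappa n - 1) * pNorm (kappa n) v ^ 2)) =
          K * pNorm (kappa n) v ^ 2 := by
        rw [kappa, add_sub_cancel_left]
        field_simp
      linarith
  · have hstd : stdProx n 2 = fun x : Vec n => (1 / 2) * ‖x‖ ^ 2 := by
      ext x
      rw [stdProx, if_neg (by norm_num)]
    rw [hstd]
    refine isProxFunction_of_midpoint two_pos ?_ fun x v => ?_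
    · exact ((contDiff_norm_sq ℝ (n := 1)).differentiable one_ne_zero).const_mul _
    · rw [pNorm_two]
      have := parallelogram_law_with_norm ℝ x v
      nlinarith

end StrongConvexity

/-- Each of the six terms is at most `ε / 6`. The first is settled by the size of `N` and the second
by the batch size. The third noise levels serve the terms linear in `Δζ` and `Δη²`, the first ones
the term with `√Θ`, and the second ones the last term. Here `ν`, `ℓ`, `r` stand for `n`, `ln n`,
`ρ_n`, and `A` for `n^{1 + 2/q}`. -/
lemma gap_bound_le {ν ℓ L R ε σ Θ r A T N m Δζ Δη : ℝ} (hν : 0 < ν) (hℓ : 2 ≤ ℓ) (hL : 0 < L)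
    (hR : 0 < R) (hε : 0 < ε) (hm : 0 < m) (hT : 0 < T) (hA : 0 < A)
    (hTε : T ^ 2 * ε = A * L * R ^ 2) (hAr : A ≤ ν ^ 2 * r) (hrA : ν ^ 2 * r ≤ 16 * ℓ * A)
    (hΘ : Θ ≤ 4 * ℓ * R ^ 2) (hN1 : 384 * ℓ * T ≤ N) (hN2 : N ≤ 768 * ℓ * T)
    (hmN : 24 * N * σ ^ 2 ≤ m * (ν * L * ε)) (hη0 : 0 ≤ Δη)
    (hζ1 : Δζ ≤ (A * L * R / (√ν * (10 ^ 4 * ℓ))) ^ 2)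
    (hζ2 : Δζ ≤ (ε / (√ν * R * (10 ^ 4 * ℓ))) ^ 2)
    (hζ3 : Δζ ≤ ε * L / (T * (10 ^ 8 * ℓ ^ 2)))
    (hη1 : Δη ≤ A * L * R / (√ν * (10 ^ 8 * ℓ)))
    (hη2 : Δη ≤ ε / (√ν * R * (10 ^ 8 * ℓ)))
    (hη3 : Δη ^ 2 ≤ ε * L / (T * (10 ^ 8 * ℓ) ^ 2)) :
    384 * Θ * ν ^ 2 * r * L / N ^ 2 + 4 * N / (ν * L) * (σ ^ 2 / m) + 61 * N / (24 * L) * Δζ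
      + 122 * N / (3 * L) * Δη ^ 2 + 12 * √(2 * ν * Θ) / N ^ 2 * (√Δζ / 2 + 2 * Δη)
      + N ^ 2 / (12 * ν * r * L) * (√Δζ / 2 + 2 * Δη) ^ 2 ≤ ε := by
  have hS : 0 < √ν := Real.sqrt_pos.mpr hν
  have hSS : √ν ^ 2 = ν := Real.sq_sqrt hν.le
  have hℓ0 : 0 < ℓ := by linarith
  have hN0 : 0 < N := lt_of_lt_of_le (by positivity) hN1
  have hr : 0 < r := by
    have : 0 < ν ^ 2 * r := hA.trans_le hAr
    exact pos_of_mul_pos_right this (by positivity)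
  have hNT : (384 * ℓ * T) ^ 2 ≤ N ^ 2 := pow_le_pow_left₀ (by positivity) hN1 2
  have hNT' : N ^ 2 ≤ (768 * ℓ * T) ^ 2 := pow_le_pow_left₀ hN0.le hN2 2
  have hB0 : 0 ≤ √Δζ / 2 + 2 * Δη := by positivity
  have hB1 : √Δζ / 2 + 2 * Δη ≤ A * L * R / (√ν * (10 ^ 4 * ℓ)) := by
    have h1 := Real.sqrt_le_sqrt hζ1
    rw [Real.sqrt_sq (by positivity)] at h1
    have h2 : A * L * R / (√ν * (10 ^ 8 * ℓ)) = A * L * R / (√ν * (10 ^ 4 * ℓ)) / 10 ^ 4 := by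
      field_simp
    have h3 : 0 ≤ A * L * R / (√ν * (10 ^ 4 * ℓ)) := by positivity
    rw [h2] at hη1
    linarith
  have hB2 : √Δζ / 2 + 2 * Δη ≤ ε / (√ν * R * (10 ^ 4 * ℓ)) := by
    have h1 := Real.sqrt_le_sqrt hζ2
    rw [Real.sqrt_sq (by positivity)] at h1
    have h2 : ε / (√ν * R * (10 ^ 8 * ℓ)) = ε / (√ν * R * (10 ^ 4 * ℓ)) / 10 ^ 4 := by
      field_simp
    have h3 : 0 ≤ ε / (√ν * R * (10 ^ 4 * ℓ)) := by positivity
    rw [h2] at hη2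
    linarith
  -- The factors `4ℓ` from `Θ` and `16ℓ` from `ρ_n` are matched by `N ≥ 384 ℓ T`, since `384 · 64 /
  -- 384² = 1/6`.
  have t1 : 384 * Θ * ν ^ 2 * r * L / N ^ 2 ≤ ε / 6 := by
    rw [div_le_iff₀ (by positivity)]
    calc 384 * Θ * ν ^ 2 * r * L = 384 * L * (Θ * (ν ^ 2 * r)) := by ring
      _ ≤ 384 * L * ((4 * ℓ * R ^ 2) * (16 * ℓ * A)) :=
          mul_le_mul_of_nonneg_left (mul_le_mul hΘ hrA (by positivity) (by positivity))
            (by positivity)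
      _ = 384 * 64 * ℓ ^ 2 * (A * L * R ^ 2) := by ring
      _ = ε / 6 * (384 * ℓ * T) ^ 2 := by rw [← hTε]; ring
      _ ≤ ε / 6 * N ^ 2 := mul_le_mul_of_nonneg_left hNT (by positivity)
  have t2 : 4 * N / (ν * L) * (σ ^ 2 / m) ≤ ε / 6 := by
    rw [div_mul_div_comm, div_le_iff₀ (by positivity)]
    linarith
  have t3 : 61 * N / (24 * L) * Δζ ≤ ε / 6 := by
    calc 61 * N / (24 * L) * Δζ
        ≤ 61 * (768 * ℓ * T) / (24 * L) * (ε * L / (T * (10 ^ 8 * ℓ ^ 2))) :=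
          mul_le_mul_of_nonneg (by gcongr) hζ3 (by positivity) (by positivity)
      _ = ε * (61 * 32 / 10 ^ 8 / ℓ) := by field_simp; norm_num
      _ ≤ ε * (1 / 6) := by
          refine mul_le_mul_of_nonneg_left ?_ hε.le
          rw [div_le_iff₀ hℓ0]
          linarith
      _ = ε / 6 := by ring
  have t4 : 122 * N / (3 * L) * Δη ^ 2 ≤ ε / 6 := by
    calc 122 * N / (3 * L) * Δη ^ 2
        ≤ 122 * (768 * ℓ * T) / (3 * L) * (ε * L / (T * (10 ^ 8 * ℓ) ^ 2)) :=
          mul_le_mul_of_nonneg (by gcongr) hη3 (by positivity) (by positivity)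
      _ = ε * (122 * 256 / 10 ^ 16 / ℓ) := by field_simp; norm_num
      _ ≤ ε * (1 / 6) := by
          refine mul_le_mul_of_nonneg_left ?_ hε.le
          rw [div_le_iff₀ hℓ0]
          linarith
      _ = ε / 6 := by ring
  have t5 : 12 * √(2 * ν * Θ) / N ^ 2 * (√Δζ / 2 + 2 * Δη) ≤ ε / 6 := by
    have hs : √(2 * ν * Θ) ≤ √ν * R * (2 * ℓ) := by
      refine Real.sqrt_le_iff.mpr ⟨by positivity, ?_⟩
      rw [mul_pow, mul_pow, hSS]
      calc 2 * ν * Θ ≤ 2 * ν * (4 * ℓ * R ^ 2) := by gcongr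
        _ = ν * R ^ 2 * (4 * (2 * ℓ)) := by ring
        _ ≤ ν * R ^ 2 * (4 * (ℓ * ℓ)) := by gcongr
        _ = ν * R ^ 2 * (2 * ℓ) ^ 2 := by ring
    calc 12 * √(2 * ν * Θ) / N ^ 2 * (√Δζ / 2 + 2 * Δη)
        ≤ 12 * (√ν * R * (2 * ℓ)) / (384 * ℓ * T) ^ 2 * (A * L * R / (√ν * (10 ^ 4 * ℓ))) :=
          mul_le_mul_of_nonneg (by gcongr) hB1 (by positivity) (by positivity)
      _ = 24 / 10 ^ 4 * (A * L * R ^ 2) / (384 * ℓ * T) ^ 2 := by field_simp; norm_num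
      _ = ε * (24 / 10 ^ 4 / 384 ^ 2 / (ℓ * ℓ)) := by rw [← hTε]; field_simp
      _ ≤ ε * (1 / 6) := by
          refine mul_le_mul_of_nonneg_left ?_ hε.le
          rw [div_le_iff₀ (by positivity)]
          nlinarith
      _ = ε / 6 := by ring
  have t6 : N ^ 2 / (12 * ν * r * L) * (√Δζ / 2 + 2 * Δη) ^ 2 ≤ ε / 6 := by
    have hd : A / ν ≤ ν * r := by rw [div_le_iff₀ hν]; linarith
    calc N ^ 2 / (12 * ν * r * L) * (√Δζ / 2 + 2 * Δη) ^ 2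
        = N ^ 2 / (12 * (ν * r) * L) * (√Δζ / 2 + 2 * Δη) ^ 2 := by ring
      _ ≤ (768 * ℓ * T) ^ 2 / (12 * (A / ν) * L) * (ε / (√ν * R * (10 ^ 4 * ℓ))) ^ 2 :=
          mul_le_mul_of_nonneg (by gcongr) (pow_le_pow_left₀ hB0 hB2 2) (by positivity)
            (by positivity)
      _ = 768 ^ 2 / 12 / 10 ^ 8 * (T ^ 2 * ε) * ε / (A * L * R ^ 2) := by
          rw [div_pow, mul_pow (√ν * R), mul_pow √ν, hSS]
          field_simp
      _ = 768 ^ 2 / 12 / 10 ^ 8 * ε := by rw [hTε]; field_simp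
      _ ≤ ε / 6 := by linarith
  linarith

/-! ### Choice of the number of iterations and of the batch size. -/

section Complexity

variable {n : ℕ}

lemma gradient_comp_sub (d : Vec n → ℝ) (x₀ x : Vec n) :
    gradient (fun v => d (v - x₀)) x = gradient d (x - x₀) := by
  rw [gradient, gradient, fderiv_comp_sub]

lemma IsProxFunction.comp_sub {p : ℝ} {d : Vec n → ℝ} (hd : IsProxFunction p d) (x₀ : Vec n) :
    IsProxFunction p fun v => d (v - x₀) where
  differentiable := hd.differentiable.comp (differentiable_id.sub_const x₀)
  strongly_convex x y := by
    rw [gradient_comp_sub]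
    simpa using hd.strongly_convex (x - x₀) (y - x₀)

lemma stdProx_nonneg (p : ℝ) (v : Vec n) : 0 ≤ stdProx n p v := by
  unfold stdProx
  split_ifs
  · have := Real.log_natCast_nonneg n
    positivity
  · positivity

lemma stdProx_zero {p : ℝ} (hn : 8 ≤ n) : stdProx n p (0 : Vec n) = 0 := by
  have hκ : kappa n ≠ 0 := by linarith [(kappa_mem hn).1]
  have h0 : pNorm (kappa n) (0 : Vec n) = 0 := by simp [pNorm, hκ]
  simp [stdProx, h0]

/-- The origin minimises the standard prox-function, so the gradient there vanishes. -/
lemma bregman_stdProx {p : ℝ} (hn : 8 ≤ n) (x₀ x : Vec n) :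
    bregman (fun v => stdProx n p (v - x₀)) x₀ x = stdProx n p (x - x₀) := by
  have hg : gradient (stdProx n p) (0 : Vec n) = 0 := by
    rw [gradient, IsLocalMin.fderiv_eq_zero, map_zero]
    exact Filter.Eventually.of_forall fun v => by
      rw [stdProx_zero hn]; exact stdProx_nonneg p v
  rw [bregman, gradient_comp_sub, sub_self, hg, stdProx_zero hn, inner_zero_left, sub_zero, sub_zero]

/-- For `p = 1` the power of `n` is at most `n^{κ-1} = e`, so the constant is at most `e² ln n / 2 ≤
4 ln n`. -/
lemma stdProx_le {p : ℝ} (hn : 8 ≤ n) (hp : p = 1 ∨ p = 2) (v : Vec n) :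
    stdProx n p v ≤ 4 * Real.log n * pNorm p v ^ 2 := by
  have hlog := two_le_log hn
  rcases hp with rfl | rfl
  · obtain ⟨hκ1, hκ2⟩ := kappa_mem hn
    have hn1 : (1 : ℝ) ≤ n := by exact_mod_cast (by omega : 1 ≤ n)
    have h1 : (n : ℝ) ^ ((kappa n - 1) * (2 - kappa n) / kappa n) ≤ Real.exp 1 := by
      rw [← rpow_kappa_sub_one hn]
      refine Real.rpow_le_rpow_of_exponent_le hn1 ?_
      rw [div_le_iff₀ (by linarith)]
      exact mul_le_mul_of_nonneg_left (by linarith) (by linarith)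
    have h2 : pNorm (kappa n) v ^ 2 ≤ pNorm 1 v ^ 2 :=
      pow_le_pow_left₀ (pNorm_nonneg _ v) (pNorm_anti one_pos hκ1.le v) 2
    have h3 : Real.exp 1 * Real.exp 1 ≤ 8 := by nlinarith [Real.exp_one_lt_d9, Real.exp_pos 1]
    rw [stdProx, if_pos rfl]
    refine mul_le_mul ?_ h2 (by positivity) (by positivity)
    have h4 := mul_le_mul_of_nonneg_left h1 (Real.exp_pos 1).le
    nlinarith
  · rw [stdProx, if_neg (by norm_num), pNorm_two]
    nlinarith [sq_nonneg ‖v‖]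

lemma sq_mul_rho_mem {p : ℝ} (hn : 8 ≤ n) (hp : p = 1 ∨ p = 2) :
    (n : ℝ) ^ 2 * rho n p ∈ Set.Icc ((n : ℝ) ^ (1 + 2 * invConj p))
      (16 * Real.log n * (n : ℝ) ^ (1 + 2 * invConj p)) := by
  have hlog := two_le_log hn
  have hn0 : (0 : ℝ) < n := by exact_mod_cast (by omega : 0 < n)
  have hA : (n : ℝ) ^ 2 * (n : ℝ) ^ (2 * invConj p - 1) = (n : ℝ) ^ (1 + 2 * invConj p) := by
    rw [← Real.rpow_natCast, ← Real.rpow_add hn0]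
    congr 1
    push_cast
    ring
  have hA0 : 0 < (n : ℝ) ^ (1 + 2 * invConj p) := Real.rpow_pos_of_pos hn0 _
  rw [rho, mul_left_comm, hA]
  have hc : (if p = 1 then 16 * Real.log n - 8 else min (p / (p - 1) - 1) (16 * Real.log n - 8)) ∈
      Set.Icc 1 (16 * Real.log n) := by
    rcases hp with rfl | rfl
    · rw [if_pos rfl]
      constructor <;> linarith
    · rw [if_neg (by norm_num), min_eq_left (by linarith)]
      constructor <;> linarith
  exact ⟨le_mul_of_one_le_left hA0.le hc.1, mul_le_mul_of_nonneg_right hc.2 hA0.le⟩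

/-- `N` is `384 ℓ T` rounded up, and `m` is one more than the integer part of the required batch
size `b`. Hence `N m ≤ N b + N`, where the relation between `T` and `M` makes `N b` at most `24 ·
768² ℓ² M`. -/
lemma exists_iterations_batch {ν ℓ T L ε σ M : ℝ} (hℓ : 2 ≤ ℓ) (hT : 1 ≤ T) (hν : 0 < ν)
    (hL : 0 < L) (hε : 0 < ε) (hM : T ^ 2 * σ ^ 2 = M * (ν * L * ε)) :
    ∃ N m : ℕ, 1 ≤ N ∧ 1 ≤ m ∧ (N : ℝ) * m ≤ 10 ^ 8 * ℓ ^ 2 * max T M ∧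
      384 * ℓ * T ≤ N ∧ N ≤ 768 * ℓ * T ∧ 24 * N * σ ^ 2 ≤ m * (ν * L * ε) := by
  have hℓT : 1 ≤ ℓ * T := by nlinarith
  set N := ⌈384 * ℓ * T⌉₊ with hN
  have hN1 : 384 * ℓ * T ≤ N := Nat.le_ceil _
  have hN2 : (N : ℝ) ≤ 768 * ℓ * T := by
    have := Nat.ceil_lt_add_one (show 0 ≤ 384 * ℓ * T by positivity)
    linarith
  have hD : 0 < ν * L * ε := by positivity
  set b := 24 * N * σ ^ 2 / (ν * L * ε) with hb
  have hbD : b * (ν * L * ε) = 24 * N * σ ^ 2 := div_mul_cancel₀ _ hD.ne'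
  have hm1 : b < (⌊b⌋₊ : ℝ) + 1 := Nat.lt_floor_add_one b
  have hm2 : (⌊b⌋₊ : ℝ) ≤ b := Nat.floor_le (by positivity)
  refine ⟨N, ⌊b⌋₊ + 1, ?_, by omega, ?_, hN1, hN2, ?_⟩
  · have : (0 : ℝ) < N := by linarith
    exact_mod_cast this
  · have hM0 : 0 ≤ M := by
      by_contra hneg
      nlinarith [sq_nonneg (T * σ), mul_neg_of_neg_of_pos (not_le.mp hneg) hD]
    have hNb : N * b ≤ 24 * 768 ^ 2 * ℓ ^ 2 * M := by
      refine le_of_mul_le_mul_right ?_ hD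
      have hsq : (N : ℝ) ^ 2 ≤ (768 * ℓ * T) ^ 2 := pow_le_pow_left₀ (Nat.cast_nonneg N) hN2 2
      calc N * b * (ν * L * ε) = 24 * σ ^ 2 * (N : ℝ) ^ 2 := by rw [mul_assoc, hbD]; ring
        _ ≤ 24 * σ ^ 2 * (768 * ℓ * T) ^ 2 := mul_le_mul_of_nonneg_left hsq (by positivity)
        _ = 24 * 768 ^ 2 * ℓ ^ 2 * (T ^ 2 * σ ^ 2) := by ring
        _ = 24 * 768 ^ 2 * ℓ ^ 2 * M * (ν * L * ε) := by rw [hM]; ring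
    have h1 : ℓ ^ 2 * M ≤ ℓ ^ 2 * max T M := by gcongr; exact le_max_right _ _
    have h2 : ℓ * T ≤ ℓ ^ 2 * max T M :=
      mul_le_mul (by nlinarith) (le_max_left _ _) (by linarith) (by positivity)
    push_cast
    nlinarith
  · push_cast
    rw [← hbD]
    exact mul_le_mul_of_nonneg_right hm1.le hD.le

/-- Brings the third noise level to the form `ε L / T` in which the parameters are compared. -/
lemma noise_level_eq {ν i L R ε : ℝ} (hν : 0 < ν) (hL : 0 < L) (hR : 0 < R) (hε : 0 < ε) :
    ε ^ (3 / 2 : ℝ) / ν ^ (1 / 2 + i) * √(L / R ^ 2) =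
      ε * L / (ν ^ (1 / 2 + i) * √(L * R ^ 2 / ε)) := by
  have h1 : ε ^ (3 / 2 : ℝ) = ε * √ε := by
    rw [Real.sqrt_eq_rpow, ← Real.rpow_one_add' hε.le (by norm_num)]
    norm_num
  have hν' := Real.rpow_pos_of_pos hν (1 / 2 + i)
  rw [h1, Real.sqrt_div hL.le, Real.sqrt_div (by positivity), Real.sqrt_mul hL.le,
    Real.sqrt_sq hR.le]
  have hε' := Real.sqrt_pos.mpr hε
  have hL' := Real.sqrt_pos.mpr hL
  field_simp
  rw [Real.sq_sqrt hL.le]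

lemma sq_noise_level_eq {ν i L R ε : ℝ} (hν : 0 < ν) (hL : 0 < L) (hR : 0 < R) (hε : 0 < ε) :
    (ε ^ (3 / 4 : ℝ) / ν ^ (1 / 4 + i / 2) * (L / R ^ 2) ^ (1 / 4 : ℝ)) ^ 2 =
      ε ^ (3 / 2 : ℝ) / ν ^ (1 / 2 + i) * √(L / R ^ 2) := by
  have hLR : 0 ≤ L / R ^ 2 := by positivity
  rw [mul_pow, div_pow, Real.sqrt_eq_rpow, ← Real.rpow_mul_natCast hε.le,
    ← Real.rpow_mul_natCast hν.le, ← Real.rpow_mul_natCast hLR]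
  congr 2
  · norm_num
  · congr 1
    push_cast
    ring
  · norm_num

end Complexity

/-- Translates the noise levels into the variables of `gap_bound_le`, with `A = n^{1 + 2/q}` and `T²
ε = A L₂ R²`. The powers `n^{1 + 4/q}` and `n^{1/2 + 2/q}` become `A² / n` and `A / √n`. -/
lemma IsRun.gap_le_of_noise_le {n N m : ℕ} {p L₂ σ R ε : ℝ} {X Ω : Type*} [MeasurableSpace X]
    [MeasurableSpace Ω] {P : Measure X} [IsProbabilityMeasure P] {μ : Measure Ω}
    [IsProbabilityMeasure μ] {F : Vec n → X → ℝ} {g : Vec n → X → Vec n} {L : X → ℝ}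
    {ζ η : Vec n → X → Vec n → ℝ} {Δζ Δη : ℝ} {x₀ xs : Vec n} {e : Fin N → Ω → Vec n}
    {ξ : Fin N → Fin m → Ω → X} {x y z : ℕ → Ω → Vec n}
    (hrun : IsRun p L₂ (fun v => stdProx n p (v - x₀)) (oracle g ζ η) x₀ e ξ x y z)
    (hn : 8 ≤ n) (hp : p = 1 ∨ p = 2) (hR : 0 < R) (hε : 0 < ε) (hN1 : 1 ≤ N) (hm1 : 1 ≤ m)
    (hNge : 384 * Real.log n * ((n : ℝ) ^ (1 / 2 + invConj p) * √(L₂ * R ^ 2 / ε)) ≤ N)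
    (hNle : N ≤ 768 * Real.log n * ((n : ℝ) ^ (1 / 2 + invConj p) * √(L₂ * R ^ 2 / ε)))
    (hmN : 24 * N * σ ^ 2 ≤ m * (n * L₂ * ε))
    (hP : IsProblem P F g L L₂ σ) (hNoise : IsNoise P ζ η Δζ Δη)
    (hζ : Δζ ≤ 1 / (10 ^ 8 * Real.log n ^ 2) *
      min ((n : ℝ) ^ (1 + 4 * invConj p) * L₂ ^ 2 * R ^ 2)
        (min (ε ^ 2 / (n * R ^ 2))
          (ε ^ (3 / 2 : ℝ) / (n : ℝ) ^ (1 / 2 + invConj p) * √(L₂ / R ^ 2))))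
    (hη : Δη ≤ 1 / (10 ^ 8 * Real.log n) *
      min ((n : ℝ) ^ (1 / 2 + 2 * invConj p) * L₂ * R)
        (min (ε / (√n * R))
          (ε ^ (3 / 4 : ℝ) / (n : ℝ) ^ (1 / 4 + invConj p / 2) * (L₂ / R ^ 2) ^ (1 / 4 : ℝ))))
    (hxs : ∀ v, objective P F xs ≤ objective P F v) (hdist : pNorm p (xs - x₀) ≤ R)
    (hs : IsSampling P μ e ξ) :
    Integrable (fun ω => objective P F (y N ω)) μ ∧
      ∫ ω, objective P F (y N ω) ∂μ - objective P F xs ≤ ε := by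
  have hn0 : (0 : ℝ) < n := by exact_mod_cast (by omega : 0 < n)
  have hℓ := two_le_log hn
  have hL := hP.L₂_pos
  have hp1 : 1 ≤ p := by rcases hp with rfl | rfl <;> norm_num
  have hp2 : p ≤ 2 := by rcases hp with rfl | rfl <;> norm_num
  obtain ⟨hint, hgap⟩ := hrun.gap_le hn hN1 hm1 hp1 hp2 hP hNoise hxs
    ((isProxFunction_stdProx hn hp).comp_sub x₀) hs
  rw [bregman_stdProx hn] at hgap
  refine ⟨hint, hgap.trans ?_⟩
  have hη0 : 0 ≤ Δη := by
    have := isProbabilityMeasure_uniformSphere (n := n) (by omega)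
    obtain ⟨u, hu⟩ := (ae_norm_eq_one_uniformSphere n).exists
    exact hNoise.Δη_nonneg hu
  have hS : 0 < √(n : ℝ) := Real.sqrt_pos.mpr hn0
  have hSS : √(n : ℝ) ^ 2 = n := Real.sq_sqrt hn0.le
  have hΘ : stdProx n p (xs - x₀) ≤ 4 * Real.log n * R ^ 2 :=
    (stdProx_le hn hp _).trans (mul_le_mul_of_nonneg_left
      (pow_le_pow_left₀ (pNorm_nonneg _ _) hdist 2) (by positivity))
  obtain ⟨hAr, hrA⟩ := sq_mul_rho_mem hn hp
  have hA : 0 < (n : ℝ) ^ (1 + 2 * invConj p) := Real.rpow_pos_of_pos hn0 _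
  have hA4 : (n : ℝ) ^ (1 + 4 * invConj p) = ((n : ℝ) ^ (1 + 2 * invConj p)) ^ 2 / n := by
    rw [← Real.rpow_mul_natCast hn0.le, ← Real.rpow_sub_one hn0.ne']
    congr 1
    push_cast
    ring
  have hA2 : (n : ℝ) ^ (1 / 2 + 2 * invConj p) = (n : ℝ) ^ (1 + 2 * invConj p) / √n := by
    rw [Real.sqrt_eq_rpow, ← Real.rpow_sub hn0]
    congr 1
    ring
  have hT : 0 < (n : ℝ) ^ (1 / 2 + invConj p) * √(L₂ * R ^ 2 / ε) := by positivity
  have hT2 : ((n : ℝ) ^ (1 / 2 + invConj p) * √(L₂ * R ^ 2 / ε)) ^ 2 * ε =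
      (n : ℝ) ^ (1 + 2 * invConj p) * L₂ * R ^ 2 := by
    rw [mul_pow, Real.sq_sqrt (by positivity), ← Real.rpow_mul_natCast hn0.le,
      show (1 / 2 + invConj p) * ((2 : ℕ) : ℝ) = 1 + 2 * invConj p by push_cast; ring]
    field_simp
  have hsq := sq_noise_level_eq (i := invConj p) hn0 hL hR hε
  rw [noise_level_eq hn0 hL hR hε] at hsq hζ
  rw [hA4] at hζ
  rw [hA2] at hη
  have hcζ : 0 ≤ 1 / (10 ^ 8 * Real.log n ^ 2) := by positivity
  have hcη : 0 ≤ 1 / (10 ^ 8 * Real.log n) := by positivity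
  refine gap_bound_le hn0 hℓ hL hR hε (by exact_mod_cast hm1) hT hA hT2 hAr hrA hΘ hNge hNle hmN
    hη0 (hζ.trans ?_) (hζ.trans ?_) (hζ.trans ?_) (hη.trans ?_) (hη.trans ?_) ?_
  · refine (mul_le_mul_of_nonneg_left (min_le_left _ _) hcζ).trans_eq ?_
    rw [div_pow, mul_pow √_, hSS]
    field_simp
  · refine (mul_le_mul_of_nonneg_left ((min_le_right _ _).trans (min_le_left _ _)) hcζ).trans_eq ?_
    rw [div_pow, mul_pow (√_ * R), mul_pow √_, hSS]
    field_simp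
  · refine (mul_le_mul_of_nonneg_left ((min_le_right _ _).trans (min_le_right _ _)) hcζ).trans_eq ?_
    field_simp
  · refine (mul_le_mul_of_nonneg_left (min_le_left _ _) hcη).trans_eq ?_
    field_simp
  · refine (mul_le_mul_of_nonneg_left ((min_le_right _ _).trans (min_le_left _ _)) hcη).trans_eq ?_
    field_simp
  · have h := pow_le_pow_left₀ hη0 (hη.trans
      (mul_le_mul_of_nonneg_left ((min_le_right _ _).trans (min_le_right _ _)) hcη)) 2
    rw [mul_pow, hsq] at h
    refine h.trans_eq ?_
    field_simp

lemma exists_iterations_batch_of_le {n : ℕ} {p L₂ σ R ε : ℝ} (hn : 8 ≤ n) (hL : 0 < L₂)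
    (hR : 0 < R) (hε : 0 < ε) (hεle : ε ≤ (n : ℝ) ^ (1 + 2 * invConj p) * L₂ * R ^ 2) :
    ∃ N m : ℕ, 1 ≤ N ∧ 1 ≤ m ∧
      (N : ℝ) * m ≤ 10 ^ 8 * Real.log n ^ 2 *
        max ((n : ℝ) ^ (1 / 2 + invConj p) * √(L₂ * R ^ 2 / ε))
          ((n : ℝ) ^ (2 * invConj p) * σ ^ 2 * R ^ 2 / ε ^ 2) ∧
      384 * Real.log n * ((n : ℝ) ^ (1 / 2 + invConj p) * √(L₂ * R ^ 2 / ε)) ≤ N ∧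
      N ≤ 768 * Real.log n * ((n : ℝ) ^ (1 / 2 + invConj p) * √(L₂ * R ^ 2 / ε)) ∧
      24 * N * σ ^ 2 ≤ m * (n * L₂ * ε) := by
  have hn0 : (0 : ℝ) < n := by exact_mod_cast (by omega : 0 < n)
  have hT2 : ((n : ℝ) ^ (1 / 2 + invConj p) * √(L₂ * R ^ 2 / ε)) ^ 2 =
      (n : ℝ) ^ (1 + 2 * invConj p) * L₂ * R ^ 2 / ε := by
    rw [mul_pow, Real.sq_sqrt (by positivity), ← Real.rpow_mul_natCast hn0.le,
      show (1 / 2 + invConj p) * ((2 : ℕ) : ℝ) = 1 + 2 * invConj p by push_cast; ring]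
    ring
  refine exists_iterations_batch (two_le_log hn) ?_ hn0 hL hε ?_
  -- The upper bound on `ε` says precisely that `T ≥ 1`.
  · rw [← one_le_sq_iff₀ (by positivity), hT2, one_le_div hε]
    exact hεle
  · rw [hT2, Real.rpow_add hn0, Real.rpow_one]
    field_simp

end ARDD

end

theorem theorem1 :
    -- the two standard prox-functions are prox-functions
    (∀ (n : ℕ) (p : ℝ), 8 ≤ n → p = 1 ∨ p = 2 → ARDD.IsProxFunction p (ARDD.stdProx n p)) ∧
    -- the convergence bound
    (∀ (n N m : ℕ) (p : ℝ) (X Ω : Type*) [MeasurableSpace X] [MeasurableSpace Ω]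
        (P : Measure X) [IsProbabilityMeasure P] (μ : Measure Ω) [IsProbabilityMeasure μ]
        (F : ARDD.Vec n → X → ℝ) (g : ARDD.Vec n → X → ARDD.Vec n) (L : X → ℝ)
        (ζ η : ARDD.Vec n → X → ARDD.Vec n → ℝ) (L₂ σ Δζ Δη : ℝ)
        (d : ARDD.Vec n → ℝ) (x₀ xs : ARDD.Vec n)
        (e : Fin N → Ω → ARDD.Vec n) (ξ : Fin N → Fin m → Ω → X) (x y z : ℕ → Ω → ARDD.Vec n),
      8 ≤ n → 1 ≤ N → 1 ≤ m → 1 ≤ p → p ≤ 2 →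
      ARDD.IsProblem P F g L L₂ σ →
      ARDD.IsNoise P ζ η Δζ Δη →
      (∀ v, ARDD.objective P F xs ≤ ARDD.objective P F v) →
      ARDD.IsProxFunction p d →
      ARDD.IsSampling P μ e ξ →
      ARDD.IsRun p L₂ d (ARDD.oracle g ζ η) x₀ e ξ x y z →
      Integrable (fun ω => ARDD.objective P F (y N ω)) μ ∧
      ∫ ω, ARDD.objective P F (y N ω) ∂μ - ARDD.objective P F xs ≤
        384 * ARDD.bregman d x₀ xs * (n : ℝ) ^ 2 * ARDD.rho n p * L₂ / (N : ℝ) ^ 2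
          + 4 * (N : ℝ) / (n * L₂) * (σ ^ 2 / m)
          + 61 * (N : ℝ) / (24 * L₂) * Δζ
          + 122 * (N : ℝ) / (3 * L₂) * Δη ^ 2
          + 12 * √(2 * n * ARDD.bregman d x₀ xs) / (N : ℝ) ^ 2 * (√Δζ / 2 + 2 * Δη)
          + (N : ℝ) ^ 2 / (12 * n * ARDD.rho n p * L₂) * (√Δζ / 2 + 2 * Δη) ^ 2) ∧
    -- the oracle complexity: the number of oracle calls is `N * m`
    (∃ C : ℝ, 0 < C ∧
      ∀ (n : ℕ) (p L₂ σ R ε : ℝ), 8 ≤ n → p = 1 ∨ p = 2 → 0 < L₂ → 0 < R → 0 < ε →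
        ε ≤ (n : ℝ) ^ (1 + 2 * ARDD.invConj p) * L₂ * R ^ 2 →
        ∃ N m : ℕ, 1 ≤ N ∧ 1 ≤ m ∧
          (N : ℝ) * m ≤ C * Real.log n ^ 2 *
            max ((n : ℝ) ^ (1 / 2 + ARDD.invConj p) * √(L₂ * R ^ 2 / ε))
              ((n : ℝ) ^ (2 * ARDD.invConj p) * σ ^ 2 * R ^ 2 / ε ^ 2) ∧
          ∀ (X Ω : Type*) [MeasurableSpace X] [MeasurableSpace Ω]
            (P : Measure X) [IsProbabilityMeasure P] (μ : Measure Ω) [IsProbabilityMeasure μ]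
            (F : ARDD.Vec n → X → ℝ) (g : ARDD.Vec n → X → ARDD.Vec n) (L : X → ℝ)
            (ζ η : ARDD.Vec n → X → ARDD.Vec n → ℝ) (Δζ Δη : ℝ) (x₀ xs : ARDD.Vec n)
            (e : Fin N → Ω → ARDD.Vec n) (ξ : Fin N → Fin m → Ω → X)
            (x y z : ℕ → Ω → ARDD.Vec n),
          ARDD.IsProblem P F g L L₂ σ →
          ARDD.IsNoise P ζ η Δζ Δη →
          Δζ ≤ 1 / (C * Real.log n ^ 2) *
            min ((n : ℝ) ^ (1 + 4 * ARDD.invConj p) * L₂ ^ 2 * R ^ 2)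
              (min (ε ^ 2 / (n * R ^ 2))
                (ε ^ (3 / 2 : ℝ) / (n : ℝ) ^ (1 / 2 + ARDD.invConj p) * √(L₂ / R ^ 2))) →
          Δη ≤ 1 / (C * Real.log n) *
            min ((n : ℝ) ^ (1 / 2 + 2 * ARDD.invConj p) * L₂ * R)
              (min (ε / (√n * R))
                (ε ^ (3 / 4 : ℝ) / (n : ℝ) ^ (1 / 4 + ARDD.invConj p / 2) *
                  (L₂ / R ^ 2) ^ (1 / 4 : ℝ))) →
          (∀ v, ARDD.objective P F xs ≤ ARDD.objective P F v) →
          ARDD.pNorm p (xs - x₀) ≤ R →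
          ARDD.IsSampling P μ e ξ →
          ARDD.IsRun p L₂ (fun v => ARDD.stdProx n p (v - x₀)) (ARDD.oracle g ζ η) x₀ e ξ x y z →
          Integrable (fun ω => ARDD.objective P F (y N ω)) μ ∧
          ∫ ω, ARDD.objective P F (y N ω) ∂μ - ARDD.objective P F xs ≤ ε) := by
  refine ⟨fun n p hn hp => ARDD.isProxFunction_stdProx hn hp, ?_, 10 ^ 8, by norm_num, ?_⟩
  · intro n N m p X Ω _ _ P _ μ _ F g L ζ η L₂ σ Δζ Δη d x₀ xs e ξ x y z hn hN1 hm hp1 hp2 hP hN hxs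
      hd hs hrun
    exact hrun.gap_le hn hN1 hm hp1 hp2 hP hN hxs hd hs
  · intro n p L₂ σ R ε hn hp hL hR hε hεle
    obtain ⟨N, m, hN1, hm, hNm, hNge, hNle, hmN⟩ :=
      ARDD.exists_iterations_batch_of_le (σ := σ) hn hL hR hε hεle
    refine ⟨N, m, hN1, hm, hNm, ?_⟩
    intro X Ω _ _ P _ μ _ F g L ζ η Δζ Δη x₀ xs e ξ x y z hP hN hζ hη hxs hdist hs hrun
    exact hrun.gap_le_of_noise_le hn hp hR hε hN1 hm hNge hNle hmN hP hN hζ hη hxs hdist hs
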